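/- Let $\sigma=\sigma_B\sqcup\sigma_D$ be a finite relational signature, where all relations of $\sigma_D$ (the *distinguished* relations) are binary; the relations of $\sigma_B$ are the *base* relations. A set of facts $F$ over $\sigma$ is regarded as a first-order structure whose domain is the set $\mathrm{elems}(F)$ of elements mentioned in it. For a finite set of facts $F_0$, a finite set $\Sigma$ of first-order sentences and a sentence $Q$ (without constants), $\mathrm{QA}(F_0,\Sigma,Q)$ holds if every (possibly infinite) set of facts $F\supseteq F_0$ that satisfies $\Sigma$ satisfies $Q$; $\mathrm{QA}_{\mathrm{lin}}(F_0,\Sigma,Q)$ holds if this is so for every such $F$ in which each relation of $\sigma_D$ is a strict linear order on $\mathrm{elems}(F)$. A *base guard* is an atom over $\sigma_B$ or an equality $x=x$. BaseGNF consists of the first-order formulas built from atoms (including equalities), $\top$, $\bot$ by $\wedge$, $\vee$, $\exists$ and negation, where negation is applied only to sentences or to formulas $\varphi$ such that $\neg\varphi$ is conjoined with a base guard that contains all free variables of $\varphi$. BaseCovGNF consists of the BaseGNF formulas in which every $\sigma_D$-atom in the scope of an odd number of negations is covered: it, or a subformula that contains it, is conjoined with a base guard that contains all variables of the atom (these variables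 not being bound in between). A UCQ is a disjunction of Boolean conjunctive queries (existentially quantified conjunctions of atoms); it is *base-covered* if in each disjunct every $\sigma_D$-atom has a base guard among the atoms of this disjunct that contains its variables. There is a polynomial-time computable function that maps every signature $\sigma$, finite set of facts $F_0$ over $\sigma$, finite set $\Sigma$ of BaseCovGNF sentences over $\sigma$ and base-covered UCQ $Q$ over $\sigma$ to a finite set of facts $F_0'$ and a finite set $\Sigma'$ of BaseGNF sentences over $\sigma\cup\{G\}$, where $G$ is a fresh binary base relation, such that $$\mathrm{QA}_{\mathrm{lin}}(F_0,\Sigma,Q)\iff \mathrm{QA}(F_0',\Sigma',Q).$$ Moreover, if $\sigma_D\neq\emptyset$, then $F_0'=F_0\cup\{G(a,b): a,b\in\mathrm{elems}(F_0)\}$, and $\Sigma'$ is $\Sigma$ together with the following $k$-guardedly linear axioms for each $S\in\sigma_D$, where $k$ is the maximum of the size (number of symbols) of $\Sigma\wedge\neg Q$ and of the maximal arity of a relation of $\sigma\cup\{G\}$: * irreflexivity: $\neg\exists x\, S(x,x)$; * guarded totality: $\forall x y\,\bigl(\mathrm{guarded}(x,y)\rightarrow x=y\vee S(x,y)\vee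 S(y,x)\bigr)$; * $k$-guarded transitivity: $\forall x y\,\bigl(\psi_l(x,y)\wedge \mathrm{guarded}(x,y)\rightarrow S(x,y)\bigr)$ for $1\le l\le k-1$, and $\forall x\,\bigl(\psi_l(x,x)\rightarrow S(x,x)\bigr)$ for $1\le l\le k$. Here $\psi_l(x,y)$ says that there is an $S$-path with $l$ edges from $x$ to $y$, and $\mathrm{guarded}(x,y)$ says that $x$ and $y$ occur together in a fact of a relation of $\sigma_B\cup\{G\}$; the axioms with $\mathrm{guarded}(x,y)$ are written in BaseGNF, with one sentence for each base relation $R\in\sigma_B\cup\{G\}$ and each choice of the positions of $x$ and $y$ in an $R$-atom. -/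

import Mathlib

namespace LinQA

/-! ### Signatures, facts and formulas -/

/-- Names of variables and of elements of input databases are binary words. -/
abbrev Name := List Bool

/-- A relation is a base relation of some arity, or a distinguished (binary) relation. -/
inductive Decl
  | base (arity : ℕ)
  | dist

def Decl.arity : Decl → ℕ
  | .base n => n
  | .dist => 2

/-- A signature is a finite list of relations; a relation is referred to by its position. -/
abbrev Sig := List Decl

/-- The maximal arity of a relation of the signature. -/
def Sig.maxArity (σ : Sig) : ℕ := (σ.map Decl.arity).foldr max 0

/-- The signature `σ ∪ {G}`, where `G` is a fresh binary base relation, at position `σ.length`. -/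
def Sig.addG (σ : Sig) : Sig := σ ++ [Decl.base 2]

/-- A fact `R(a₁, …, aₙ)`. -/
@[ext]
structure Fact (α : Type) where
  rel : ℕ
  args : List α

def Fact.map {α β : Type} (g : α → β) (f : Fact α) : Fact β := ⟨f.rel, f.args.map g⟩

def Fact.Over {α : Type} (σ : Sig) (f : Fact α) : Prop :=
  ∃ d, σ[f.rel]? = some d ∧ f.args.length = d.arity

/-- The elements mentioned in a set of facts. -/
def elems {α : Type} (F : Set (Fact α)) : Set α := {a | ∃ f ∈ F, a ∈ f.args}

inductive Atom
  | rel (R : ℕ) (xs : List Name)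
  | eq (x y : Name)

/-- First-order formulas (without constants) with equality. -/
inductive Fml
  | tru
  | fls
  | atom (a : Atom)
  | and (φ ψ : Fml)
  | or (φ ψ : Fml)
  | ex (x : Name) (φ : Fml)
  | neg (φ : Fml)

def Atom.vars : Atom → Finset Name
  | .rel _ xs => xs.toFinset
  | .eq x y => {x, y}

def Atom.Over (σ : Sig) : Atom → Prop
  | .rel R xs => ∃ d, σ[R]? = some d ∧ xs.length = d.arity
  | .eq _ _ => True

/-- Free variables. -/
def Fml.fv : Fml → Finset Name
  | .tru => ∅
  | .fls => ∅
  | .atom a => a.vars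
  | .and φ ψ => φ.fv ∪ ψ.fv
  | .or φ ψ => φ.fv ∪ ψ.fv
  | .ex x φ => φ.fv.erase x
  | .neg φ => φ.fv

/-- All atoms that occur in a formula. -/
def Fml.atoms : Fml → List Atom
  | .tru => []
  | .fls => []
  | .atom a => [a]
  | .and φ ψ => φ.atoms ++ ψ.atoms
  | .or φ ψ => φ.atoms ++ ψ.atoms
  | .ex _ φ => φ.atoms
  | .neg φ => φ.atoms

/-- The formula is a sentence over the signature `σ`. -/
def Fml.IsSentence (σ : Sig) (φ : Fml) : Prop :=
  φ.fv = ∅ ∧ ∀ a ∈ φ.atoms, a.Over σ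

/-! ### Size: the number of symbols -/

def Atom.size : Atom → ℕ
  | .rel _ xs => 1 + xs.length
  | .eq _ _ => 3

def Fml.size : Fml → ℕ
  | .tru => 1
  | .fls => 1
  | .atom a => a.size
  | .and φ ψ => φ.size + 1 + ψ.size
  | .or φ ψ => φ.size + 1 + ψ.size
  | .ex _ φ => 2 + φ.size
  | .neg φ => 1 + φ.size

/-- The conjunction of a list of formulas. -/
def bigAnd (Φ : List Fml) : Fml := Φ.foldr Fml.and Fml.tru

/-! ### Semantics (over the elements mentioned in a set of facts) -/

def Atom.Sat {α : Type} (F : Set (Fact α)) (v : Name → α) : Atom → Prop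
  | .rel R xs => (⟨R, xs.map v⟩ : Fact α) ∈ F
  | .eq x y => v x = v y

def Fml.Sat {α : Type} (F : Set (Fact α)) : (Name → α) → Fml → Prop
  | _, .tru => True
  | _, .fls => False
  | v, .atom a => a.Sat F v
  | v, .and φ ψ => φ.Sat F v ∧ ψ.Sat F v
  | v, .or φ ψ => φ.Sat F v ∨ ψ.Sat F v
  | v, .ex x φ => ∃ a ∈ elems F, φ.Sat F (Function.update v x a)
  | v, .neg φ => ¬ φ.Sat F v

/-- A set of facts satisfies a sentence; for sentences the valuation plays no role. -/
def Models {α : Type} (F : Set (Fact α)) (φ : Fml) : Prop := ∀ v : Name → α, φ.Sat F v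

/-- The relation `S` is a strict linear order on the elements of `F`. -/
def IsLinear {α : Type} (F : Set (Fact α)) (S : ℕ) : Prop :=
  IsStrictTotalOrder (elems F) (fun a b => (⟨S, [a.1, b.1]⟩ : Fact α) ∈ F)

/-! ### Fragments -/

/-- A base guard: an atom over a base relation, or a trivial equality `x = x`. -/
def Atom.IsBaseGuard (σ : Sig) : Atom → Prop
  | .rel R _ => ∃ n, σ[R]? = some (Decl.base n)
  | .eq x y => x = y

/-- An atom over a distinguished relation. -/
def Atom.IsDist (σ : Sig) : Atom → Prop
  | .rel R _ => σ[R]? = some Decl.dist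
  | .eq _ _ => False

/-- The base guards among the conjuncts of a formula. -/
def Fml.guards (σ : Sig) : Fml → Set Atom
  | .atom a => {b | b = a ∧ a.IsBaseGuard σ}
  | .and φ ψ => φ.guards σ ∪ ψ.guards σ
  | _ => ∅

/-- Base-guarded negation, relative to the set `Γ` of base guards with which the formula is
conjoined: the free variables of a negated formula are contained in a single base guard with which
the negation is conjoined (a sentence needs no guard). -/
def Fml.BaseGNFIn (σ : Sig) : Set Atom → Fml → Prop
  | _, .tru => True
  | _, .fls => True
  | _, .atom _ => True
  | Γ, .and φ ψ => φ.BaseGNFIn σ (Γ ∪ ψ.guards σ) ∧ ψ.BaseGNFIn σ (Γ ∪ φ.guards σ)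
  | _, .or φ ψ => φ.BaseGNFIn σ ∅ ∧ ψ.BaseGNFIn σ ∅
  | _, .ex _ φ => φ.BaseGNFIn σ ∅
  | Γ, .neg φ => (φ.fv = ∅ ∨ ∃ A ∈ Γ, φ.fv ⊆ A.vars) ∧ φ.BaseGNFIn σ ∅

/-- The base-guarded negation fragment. -/
def Fml.BaseGNF (σ : Sig) (φ : Fml) : Prop := φ.BaseGNFIn σ ∅

/-- Base-coveredness at a polarity (`true` for positive occurrences) and relative to the set `Γ` of
base guards with which the formula, or a formula around it, is conjoined: the variables of every
distinguished atom that occurs negatively are contained in such a guard. Guards that mention a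
variable are lost when this variable is bound again. -/
def Fml.CoveredIn (σ : Sig) : Bool → Set Atom → Fml → Prop
  | _, _, .tru => True
  | _, _, .fls => True
  | pol, Γ, .atom a => pol = false → a.IsDist σ → ∃ A ∈ Γ, a.vars ⊆ A.vars
  | pol, Γ, .and φ ψ =>
      φ.CoveredIn σ pol (Γ ∪ ψ.guards σ) ∧ ψ.CoveredIn σ pol (Γ ∪ φ.guards σ)
  | pol, Γ, .or φ ψ => φ.CoveredIn σ pol Γ ∧ ψ.CoveredIn σ pol Γ
  | pol, Γ, .ex x φ => φ.CoveredIn σ pol {A ∈ Γ | x ∉ A.vars}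
  | pol, Γ, .neg φ => φ.CoveredIn σ (!pol) Γ

/-- The base-covered guarded negation fragment. -/
def Fml.BaseCovGNF (σ : Sig) (φ : Fml) : Prop := φ.BaseGNF σ ∧ φ.CoveredIn σ true ∅

/-- A conjunction of atoms. -/
def Fml.IsAtomConj : Fml → Prop
  | .tru => True
  | .atom _ => True
  | .and φ ψ => φ.IsAtomConj ∧ ψ.IsAtomConj
  | _ => False

/-- A conjunctive query: an existentially quantified conjunction of atoms. -/
def Fml.IsCQ : Fml → Prop
  | .ex _ φ => φ.IsCQ
  | φ => φ.IsAtomConj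

/-- For conjunctive queries: every distinguished atom of the query has a base guard among the atoms
of the query that contains its variables. -/
def Fml.CQCovered (σ : Sig) (q : Fml) : Prop :=
  ∀ a ∈ q.atoms, a.IsDist σ → ∃ A ∈ q.atoms, A.IsBaseGuard σ ∧ a.vars ⊆ A.vars

/-- A base-covered union of conjunctive queries. -/
def Fml.IsBaseCoveredUCQ (σ : Sig) : Fml → Prop
  | .fls => True
  | .or φ ψ => φ.IsBaseCoveredUCQ σ ∧ ψ.IsBaseCoveredUCQ σ
  | φ => φ.IsCQ ∧ φ.CQCovered σ

/-! ### Query answering -/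

/-- A signature, a finite set of facts over it, and a finite set of constraints. -/
structure KB where
  sig : Sig
  facts : List (Fact Name)
  constraints : List Fml

/-- `F` is a set of facts over the signature that contains the given facts and satisfies the
constraints; `ι` identifies the names with elements of `α`. -/
def KB.IsModel (K : KB) {α : Type} (ι : Name ↪ α) (F : Set (Fact α)) : Prop :=
  (∀ f ∈ F, f.Over K.sig) ∧ (∀ f ∈ K.facts, f.map ι ∈ F) ∧ ∀ φ ∈ K.constraints, Models F φ

/-- Entailment of the query `Q`. -/
def QA (K : KB) (Q : Fml) : Prop :=
  ∀ (α : Type) (ι : Name ↪ α) (F : Set (Fact α)), K.IsModel ι F → Models F Q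

/-- Entailment of the query `Q` over linear orders. -/
def QAlin (K : KB) (Q : Fml) : Prop :=
  ∀ (α : Type) (ι : Name ↪ α) (F : Set (Fact α)), K.IsModel ι F →
    (∀ S, K.sig[S]? = some Decl.dist → IsLinear F S) → Models F Q

/-! ### The guardedly linear axioms -/

/-- Two disjoint families of variables. -/
def zvar (i : ℕ) : Name := false :: List.replicate i true

def wvar (i : ℕ) : Name := true :: List.replicate i true

def zvars (n : ℕ) : List Name := (List.range n).map zvar

def exs (xs : List Name) (φ : Fml) : Fml := xs.foldr Fml.ex φ

def binAtom (S : ℕ) (x y : Name) : Fml := .atom (.rel S [x, y])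

/-- There is an `S`-path with `m + 1` edges (so `m` intermediate nodes) from `x` to `y`, where `x`
and `y` are not among the variables `wvar 0, …, wvar (m - 1)`. -/
def pathFml (S : ℕ) (x : Name) : ℕ → Name → Fml
  | 0, y => binAtom S x y
  | m + 1, y => .ex (wvar m) (.and (pathFml S x m (wvar m)) (binAtom S (wvar m) y))

def irreflAx (S : ℕ) : Fml := .neg (.ex (zvar 0) (binAtom S (zvar 0) (zvar 0)))

/-- Any two elements at the positions `i`, `j` of an `R`-fact are equal or comparable by `S`. -/
def totalAx (S R n i j : ℕ) : Fml :=
  .neg (exs (zvars n) (.and (.atom (.rel R (zvars n)))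
    (.neg (.or (.atom (.eq (zvar i) (zvar j)))
      (.or (binAtom S (zvar i) (zvar j)) (binAtom S (zvar j) (zvar i)))))))

/-- If there is an `S`-path with `m + 1` edges between the elements at the positions `i`, `j` of an
`R`-fact, then there is an `S`-edge. -/
def transAx (S R n i j m : ℕ) : Fml :=
  .neg (exs (zvars n) (.and (pathFml S (zvar i) m (zvar j))
    (.and (.atom (.rel R (zvars n))) (.neg (binAtom S (zvar i) (zvar j))))))

/-- If there is an `S`-cycle with `m + 1` edges at an element, then there is an `S`-loop at it. -/
def loopAx (S m : ℕ) : Fml :=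
  .neg (.ex (zvar 0) (.and (pathFml S (zvar 0) m (zvar 0))
    (.and (.atom (.eq (zvar 0) (zvar 0))) (.neg (binAtom S (zvar 0) (zvar 0))))))

/-- The `k`-guardedly linear axioms for all distinguished relations `S` of `τ`:
irreflexivity; guarded totality; and guarded transitivity for the paths with at most `k - 1` edges
between the elements of a base-guarded pair and for the cycles with at most `k` edges. That the pair
`x, y` is base-guarded means that, for some base relation `R` and some positions `i`, `j`, there is
an `R`-fact with `x` at `i` and `y` at `j`; there is one sentence for each choice of `R, i, j`. -/
def linAxioms (τ : Sig) (k : ℕ) : Set Fml :=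
  {φ | ∃ S, τ[S]? = some Decl.dist ∧
    (φ = irreflAx S ∨
     (∃ R n i j, τ[R]? = some (Decl.base n) ∧ i < n ∧ j < n ∧
        (φ = totalAx S R n i j ∨ ∃ m, m + 1 ≤ k - 1 ∧ φ = transAx S R n i j m)) ∨
     ∃ m, m + 1 ≤ k ∧ φ = loopAx S m)}

/-- The parameter `k`: the maximum of the size of `Σ ∧ ¬Q` and of the arity of `σ ∪ {G}`. -/
def width (K : KB) (Q : Fml) : ℕ :=
  max (Fml.and (bigAnd K.constraints) (Fml.neg Q)).size K.sig.addG.maxArity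

/-- The facts `G(a, b)` for all elements `a`, `b` of the given facts. -/
def gFacts (K : KB) : Set (Fact Name) :=
  {f | ∃ a ∈ elems {g | g ∈ K.facts}, ∃ b ∈ elems {g | g ∈ K.facts}, f = ⟨K.sig.length, [a, b]⟩}

/-! ### Encoding of inputs and outputs as strings over a finite alphabet -/

inductive Sym
  | zero | one | fin | item | base | dist | rel | eq | tru | fls | and | or | ex | neg
  deriving DecidableEq

instance : Fintype Sym where
  elems := {.zero, .one, .fin, .item, .base, .dist, .rel, .eq, .tru, .fls, .and, .or, .ex, .neg}
  complete x := by cases x <;> decide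

/-- Names are written as they are. -/
def encName (w : Name) : List Sym := w.map (fun b => if b then Sym.one else Sym.zero) ++ [Sym.fin]

/-- Arities and positions in the signature are written in unary. -/
def encNat (n : ℕ) : List Sym := List.replicate n Sym.one ++ [Sym.fin]

def encList {β : Type} (e : β → List Sym) (l : List β) : List Sym :=
  l.flatMap (fun b => Sym.item :: e b) ++ [Sym.fin]

def Decl.encode : Decl → List Sym
  | .base n => Sym.base :: encNat n
  | .dist => [Sym.dist]

def encFact (f : Fact Name) : List Sym := encNat f.rel ++ encList encName f.args

def Atom.encode : Atom → List Sym
  | .rel R xs => Sym.rel :: encNat R ++ encList encName xs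
  | .eq x y => Sym.eq :: encName x ++ encName y

def Fml.encode : Fml → List Sym
  | .tru => [Sym.tru]
  | .fls => [Sym.fls]
  | .atom a => a.encode
  | .and φ ψ => Sym.and :: φ.encode ++ ψ.encode
  | .or φ ψ => Sym.or :: φ.encode ++ ψ.encode
  | .ex x φ => Sym.ex :: encName x ++ φ.encode
  | .neg φ => Sym.neg :: φ.encode

def KB.encode (K : KB) : List Sym :=
  encList Decl.encode K.sig ++ encList encFact K.facts ++ encList Fml.encode K.constraints

def encInput (I : KB × Fml) : List Sym := I.1.encode ++ I.2.encode

/-! Inputs and outputs are determined by their encodings. -/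

/-- No encoding is a proper prefix of another one, and the encoding is injective. -/
def PrefixCode {β : Type} (e : β → List Sym) : Prop :=
  ∀ a b s t, e a ++ s = e b ++ t → a = b ∧ s = t

theorem prefixCode_encNat : PrefixCode encNat := by
  intro a
  induction a with
  | zero => intro b s t h; cases b <;> simp_all [encNat, List.replicate_succ]
  | succ n ih =>
    intro b s t h
    cases b with
    | zero => simp_all [encNat, List.replicate_succ]
    | succ m =>
      have := ih m s t (by simpa [encNat, List.replicate_succ] using h)
      simpa using this

theorem prefixCode_encName : PrefixCode encName := by
  intro a
  induction a with
  | nil => intro b s t h; rcases b with _ | ⟨_ | _, b⟩ <;> simp_all [encName]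
  | cons c a ih =>
    intro b s t h
    rcases b with _ | ⟨d, b⟩
    · cases c <;> simp_all [encName]
    · simp only [encName, List.map_cons, List.cons_append, List.cons.injEq] at h
      have h1 := ih b s t h.2
      have h2 : c = d := by
        have := h.1
        cases c <;> cases d <;> simp at this <;> rfl
      simp [h1.1, h1.2, h2]

theorem PrefixCode.list {β : Type} {e : β → List Sym} (he : PrefixCode e) :
    PrefixCode (encList e) := by
  intro a
  induction a with
  | nil => intro b s t h; cases b <;> simp_all [encList]
  | cons c a ih =>
    intro b s t h
    cases b with
    | nil => simp_all [encList]
    | cons d b =>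
      have h1 := he c d (encList e a ++ s) (encList e b ++ t) (by simpa [encList] using h)
      have h2 := ih b s t h1.2
      simp [h1.1, h2.1, h2.2]

theorem prefixCode_decl : PrefixCode Decl.encode := by
  intro a b s t h
  rcases a with n | _ <;> rcases b with m | _ <;>
    simp only [Decl.encode, List.cons_append, List.nil_append, List.cons.injEq, reduceCtorEq,
      false_and, true_and] at h
  · have h1 := prefixCode_encNat _ _ _ _ h
    simp [h1.1, h1.2]
  · exact ⟨rfl, h⟩

theorem prefixCode_fact : PrefixCode encFact := by
  rintro ⟨R, xs⟩ ⟨R', xs'⟩ s t h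
  have h1 := prefixCode_encNat R R' (encList encName xs ++ s) (encList encName xs' ++ t)
    (by simpa [encFact] using h)
  have h2 := prefixCode_encName.list _ _ _ _ h1.2
  simp [h1.1, h2.1, h2.2]

theorem prefixCode_atom : PrefixCode Atom.encode := by
  intro a b s t h
  rcases a with ⟨R, xs⟩ | ⟨x, y⟩ <;> rcases b with ⟨R', xs'⟩ | ⟨x', y'⟩ <;>
    simp only [Atom.encode, List.cons_append, List.append_assoc, List.cons.injEq, reduceCtorEq,
      false_and, true_and] at h
  · have h1 := prefixCode_encNat _ _ _ _ h
    have h2 := prefixCode_encName.list _ _ _ _ h1.2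
    simp [h1.1, h2.1, h2.2]
  · have h1 := prefixCode_encName _ _ _ _ h
    have h2 := prefixCode_encName _ _ _ _ h1.2
    simp [h1.1, h2.1, h2.2]

theorem prefixCode_fml : PrefixCode Fml.encode := by
  intro a
  induction a with
  | tru => intro b s t h; rcases b with _ | _ | ⟨_ | _⟩ | _ | _ | _ | _ <;>
      simp_all [Fml.encode, Atom.encode]
  | fls => intro b s t h; rcases b with _ | _ | ⟨_ | _⟩ | _ | _ | _ | _ <;>
      simp_all [Fml.encode, Atom.encode]
  | atom a =>
    intro b s t h
    cases b with
    | atom b =>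
      have h1 := prefixCode_atom a b s t h
      simp [h1.1, h1.2]
    | _ => cases a <;> simp_all [Fml.encode, Atom.encode]
  | and φ ψ ih1 ih2 =>
    intro b s t h
    rcases b with _ | _ | ⟨_ | _⟩ | ⟨φ', ψ'⟩ | _ | _ | _ <;>
      simp only [Fml.encode, Atom.encode, List.cons_append, List.append_assoc, List.cons.injEq,
        reduceCtorEq, false_and, true_and, List.nil_append] at h
    have h1 := ih1 _ _ _ h
    have h2 := ih2 _ _ _ h1.2
    simp [h1.1, h2.1, h2.2]
  | or φ ψ ih1 ih2 =>
    intro b s t h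
    rcases b with _ | _ | ⟨_ | _⟩ | _ | ⟨φ', ψ'⟩ | _ | _ <;>
      simp only [Fml.encode, Atom.encode, List.cons_append, List.append_assoc, List.cons.injEq,
        reduceCtorEq, false_and, true_and, List.nil_append] at h
    have h1 := ih1 _ _ _ h
    have h2 := ih2 _ _ _ h1.2
    simp [h1.1, h2.1, h2.2]
  | ex x φ ih =>
    intro b s t h
    rcases b with _ | _ | ⟨_ | _⟩ | _ | _ | ⟨y, ψ⟩ | _ <;>
      simp only [Fml.encode, Atom.encode, List.cons_append, List.append_assoc, List.cons.injEq,
        reduceCtorEq, false_and, true_and, List.nil_append] at h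
    have h1 := prefixCode_encName _ _ _ _ h
    have h2 := ih _ _ _ h1.2
    simp [h1.1, h2.1, h2.2]
  | neg φ ih =>
    intro b s t h
    rcases b with _ | _ | ⟨_ | _⟩ | _ | _ | _ | ψ <;>
      simp only [Fml.encode, Atom.encode, List.cons_append, List.append_assoc, List.cons.injEq,
        reduceCtorEq, false_and, true_and, List.nil_append] at h
    have h1 := ih _ _ _ h
    simp [h1.1, h1.2]

theorem prefixCode_kb : PrefixCode KB.encode := by
  rintro ⟨σ, F, C⟩ ⟨σ', F', C'⟩ s t h
  simp only [KB.encode, List.append_assoc] at h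
  have h1 := prefixCode_decl.list _ _ _ _ h
  have h2 := prefixCode_fact.list _ _ _ _ h1.2
  have h3 := prefixCode_fml.list _ _ _ _ h2.2
  simp [h1.1, h2.1, h3.1, h3.2]

theorem kb_encode_injective : Function.Injective KB.encode := by
  intro K K' h
  exact (prefixCode_kb K K' [] [] (by simpa using h)).1

theorem encInput_injective : Function.Injective encInput := by
  rintro ⟨K, Q⟩ ⟨K', Q'⟩ h
  obtain ⟨h1, h2⟩ : K = K' ∧ Q.encode = Q'.encode := prefixCode_kb _ _ _ _ h
  have h3 := prefixCode_fml Q Q' [] [] (by simpa using h2)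
  simp [h1, h3.1]

end LinQA

open LinQA

/-! From linear orders to arbitrary models (`QAlin_of_QA_reduction`): a linear model of the input
stays one after all facts `G(a, b)` on the input elements are added, and a linear order satisfies
every axiom. So an entailment of the output gives the entailment over linear orders.

The converse (`QA_reduction_of_QAlin`) turns a model `F` of the output that violates `Q` into a
linear model of the input that violates `Q`. `F` is unravelled into a tree of bags. The root bag
consists of the input elements, which are pairwise guarded by `G`; every other bag has at most `k`
elements, and it shares with its parent only a pairwise guarded set. Guarded-negation sentences of
size at most `k` cannot tell `F` from its unravelling (`sat_unravel`, `models_unravel`), so the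
constraints still hold and `Q` still fails.

The gain is that a distinguished relation `S` has no cycle in the unravelling
(`not_transGen_unravel`). Inside one bag there is none: on the root bag `S` is total and has no
cycles of length at most three, and elsewhere a shortest cycle would have length at most `k`. A path
that makes a detour into a child bag leaves the parent and returns to it at shared elements. These
are guarded, hence comparable by `S`; the reverse edge would close a cycle in the child, so the
detour can be replaced by one edge of the parent. Thus `S` extends to a strict linear order
(`exists_linear_extension`). A base-guarded pair is already decided by `S`, so the extension changes
only unguarded pairs, to which base-covered constraints and queries are insensitive
(`sat_of_covered`, `sat_ucq_of_covered`). Of the axioms, this direction needs irreflexivity, guarded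
totality and the cycle axioms.

Without distinguished relations there is nothing to order. The output then forbids facts over `G`,
and the two classes of models coincide (`QAlin_iff_of_not_dist`).

For the polynomial time bound (`polyTime_reduction`), the output is described in a small language of
string generators, whose loops run over the suffixes of a stack. Generators compile to structured
stack programs, and these to `FinTM2` machines. Bounds on output length and running time are
polynomials defined by recursion on the generator (`Gen.exec`). -/

namespace LinQA

open Function (update)
open Relation (TransGen ReflTransGen)

/-! ### A structured language for stack machines -/

/-- Programs that act on stacks indexed by `κ`, all over the alphabet `Sym`. -/
inductive Prog (κ : Type)
  | skip
  | push (k : κ) (s : Sym)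
  | copyTop (i j : κ)
  | pop (k : κ)
  | seq (p q : Prog κ)
  | ite (k : κ) (c : Sym → Bool) (p q : Prog κ)
  | loop (k : κ) (p : Prog κ)

abbrev Store (κ : Type) := κ → List Sym

/-- `Exec p ρ ρ₁ t`: started on the stacks `ρ`, the program ends after `t` steps with `ρ₁`. -/
inductive Exec {κ : Type} [DecidableEq κ] : Prog κ → Store κ → Store κ → ℕ → Prop
  | skip (ρ) : Exec .skip ρ ρ 1
  | push (k s ρ) : Exec (.push k s) ρ (update ρ k (s :: ρ k)) 1
  | copyTop (i j ρ) : Exec (.copyTop i j) ρ (update ρ j ((ρ i).head?.toList ++ ρ j)) 1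
  | pop (k ρ) : Exec (.pop k) ρ (update ρ k (ρ k).tail) 1
  | seq {p q ρ ρ₁ ρ₂ t₁ t₂} : Exec p ρ ρ₁ t₁ → Exec q ρ₁ ρ₂ t₂ → Exec (.seq p q) ρ ρ₂ (t₁ + t₂)
  | ite_pos {k c p q ρ ρ₁ t} : (ρ k).head?.any c = true → Exec p ρ ρ₁ t →
      Exec (.ite k c p q) ρ ρ₁ (1 + t)
  | ite_neg {k c p q ρ ρ₁ t} : (ρ k).head?.any c = false → Exec q ρ ρ₁ t →
      Exec (.ite k c p q) ρ ρ₁ (1 + t)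
  | loop_nil {k p ρ} : ρ k = [] → Exec (.loop k p) ρ ρ 1
  | loop_cons {k p ρ ρ₁ ρ₂ t₁ t₂} : ρ k ≠ [] → Exec p ρ ρ₁ t₁ → Exec (.loop k p) ρ₁ ρ₂ t₂ →
      Exec (.loop k p) ρ ρ₂ (1 + (t₁ + t₂))

/-- The labels of the machine that executes a program. -/
def Prog.Label {κ : Type} : Prog κ → Type
  | .skip => Unit
  | .push _ _ => Unit
  | .copyTop _ _ => Unit
  | .pop _ => Unit
  | .seq p q => p.Label ⊕ q.Label
  | .ite _ _ p q => Option (p.Label ⊕ q.Label)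
  | .loop _ p => Option p.Label

@[reducible] def Prog.labelFintype {κ : Type} : (p : Prog κ) → Fintype p.Label
  | .skip => inferInstanceAs (Fintype Unit)
  | .push _ _ => inferInstanceAs (Fintype Unit)
  | .copyTop _ _ => inferInstanceAs (Fintype Unit)
  | .pop _ => inferInstanceAs (Fintype Unit)
  | .seq p q =>
    letI := p.labelFintype
    letI := q.labelFintype
    inferInstanceAs (Fintype (p.Label ⊕ q.Label))
  | .ite _ _ p q =>
    letI := p.labelFintype
    letI := q.labelFintype
    inferInstanceAs (Fintype (Option (p.Label ⊕ q.Label)))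
  | .loop _ p =>
    letI := p.labelFintype
    inferInstanceAs (Fintype (Option p.Label))

def Prog.start {κ : Type} : (p : Prog κ) → p.Label
  | .skip => ()
  | .push _ _ => ()
  | .copyTop _ _ => ()
  | .pop _ => ()
  | .seq p _ => Sum.inl p.start
  | .ite _ _ _ _ => none
  | .loop _ _ => none

/-- The code of a program inside a machine with labels `Λ`, which is left at the label `next`. -/
def Prog.code {κ Λ : Type} : (p : Prog κ) → (p.Label → Λ) → Λ → p.Label →
    Turing.TM2.Stmt (fun _ : κ => Sym) Λ (Option Sym)
  | .skip, _, next, _ => .goto fun _ => next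
  | .push k s, _, next, _ => .push k (fun _ => s) (.goto fun _ => next)
  | .copyTop i j, _, next, _ =>
      .peek i (fun _ o => o)
        -- The default `.fin` is never pushed: this branch is taken only if the register holds a
        -- symbol.
        (.branch Option.isSome (.push j (fun v => v.getD .fin) (.goto fun _ => next))
          (.goto fun _ => next))
  | .pop k, _, next, _ => .pop k (fun v _ => v) (.goto fun _ => next)
  | .seq p q, emb, _, .inl l => p.code (fun l => emb (.inl l)) (emb (.inr q.start)) l
  | .seq _ q, emb, next, .inr l => q.code (fun l => emb (.inr l)) next l
  | .ite k c p q, emb, _, none =>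
      .peek k (fun _ o => o)
        (.goto fun v => if v.any c then emb (some (.inl p.start)) else emb (some (.inr q.start)))
  | .ite _ _ p _, emb, next, some (.inl l) => p.code (fun l => emb (some (.inl l))) next l
  | .ite _ _ _ q, emb, next, some (.inr l) => q.code (fun l => emb (some (.inr l))) next l
  | .loop k p, emb, next, none =>
      .peek k (fun _ o => o) (.goto fun v => if v.isSome then emb (some p.start) else next)
  | .loop _ p, emb, _, some l => p.code (fun l => emb (some l)) (emb none) l

/-- The host machine `M`, the embedding of the labels and the exit label are arbitrary, so that the
induction applies to subprograms in place. The final register can be left unspecified, because each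
construct that consults the register first peeks at a stack. -/
theorem Exec.iterate_step {κ Λ : Type} [DecidableEq κ] {p : Prog κ} {ρ ρ' : Store κ} {t : ℕ}
    (h : Exec p ρ ρ' t)
    (M : Λ → Turing.TM2.Stmt (fun _ : κ => Sym) Λ (Option Sym)) (emb : p.Label → Λ) (next : Λ)
    (hM : ∀ l, M (emb l) = p.code emb next l) (v : Option Sym) :
    ∃ v', (flip bind (Turing.TM2.step M))^[t] (some ⟨some (emb p.start), v, ρ⟩) =
      some ⟨some next, v', ρ'⟩ := by
  have hstep : ∀ (p : Prog κ) (emb : p.Label → Λ) (next : Λ)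
      (_ : ∀ l, M (emb l) = p.code emb next l) (v : Option Sym) (ρ : Store κ),
      flip bind (Turing.TM2.step M) (some ⟨some (emb p.start), v, ρ⟩) =
        some (Turing.TM2.stepAux (p.code emb next p.start) v ρ) := by
    intro p emb next hM v ρ
    simp [flip, hM]
  induction h generalizing next v with
  | skip ρ => exact ⟨v, (hstep _ emb next hM _ _).trans (by simp [Prog.code])⟩
  | push k s ρ => exact ⟨v, (hstep _ emb next hM _ _).trans (by simp [Prog.code])⟩
  | copyTop i j ρ =>
    refine ⟨(ρ i).head?, ?_⟩
    cases h : (ρ i).head? <;> exact (hstep _ emb next hM _ _).trans (by simp [Prog.code, h])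
  | pop k ρ => exact ⟨v, (hstep _ emb next hM _ _).trans (by simp [Prog.code])⟩
  | @seq p q ρ ρ₁ ρ₂ t₁ t₂ h1 h2 ih1 ih2 =>
    obtain ⟨v1, e1⟩ := ih1 (fun l => emb (.inl l)) (emb (.inr q.start)) (fun l => hM _) v
    obtain ⟨v2, e2⟩ := ih2 (fun l => emb (.inr l)) next (fun l => hM _) v1
    refine ⟨v2, ?_⟩
    rw [Nat.add_comm, Function.iterate_add_apply]
    exact (congrArg _ e1).trans e2
  | @ite_pos k c p q ρ ρ₁ t hc h ih =>
    obtain ⟨v1, e1⟩ := ih (fun l => emb (some (.inl l))) next (fun l => hM _) (ρ k).head?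
    refine ⟨v1, ?_⟩
    rw [Nat.add_comm, Function.iterate_add_apply]
    refine Eq.trans ?_ e1
    congr 1
    exact (hstep _ emb next hM _ _).trans (by simp [Prog.code, Prog.start, hc])
  | @ite_neg k c p q ρ ρ₁ t hc h ih =>
    obtain ⟨v1, e1⟩ := ih (fun l => emb (some (.inr l))) next (fun l => hM _) (ρ k).head?
    refine ⟨v1, ?_⟩
    rw [Nat.add_comm, Function.iterate_add_apply]
    refine Eq.trans ?_ e1
    congr 1
    exact (hstep _ emb next hM _ _).trans (by simp [Prog.code, Prog.start, hc])
  | @loop_nil k p ρ hk =>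
    exact ⟨none, (hstep _ emb next hM _ _).trans (by simp [Prog.code, Prog.start, hk])⟩
  | @loop_cons k p ρ ρ₁ ρ₂ t₁ t₂ hk h1 h2 ih1 ih2 =>
    obtain ⟨v1, e1⟩ := ih1 (fun l => emb (some l)) (emb none) (fun l => hM _) (ρ k).head?
    obtain ⟨v2, e2⟩ := ih2 emb next hM v1
    refine ⟨v2, ?_⟩
    rw [Nat.add_comm, Nat.add_comm t₁, Function.iterate_add_apply, Function.iterate_add_apply]
    refine Eq.trans ?_ e2
    congr 1
    refine Eq.trans ?_ e1
    congr 1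
    cases hk' : ρ k with
    | nil => exact absurd hk' hk
    | cons s l => exact (hstep _ emb next hM _ _).trans (by simp [Prog.code, Prog.start, hk'])

/-- The machine that executes a program and halts. -/
def Prog.machine {κ : Type} [DecidableEq κ] [Fintype κ] (k₀ k₁ : κ) (p : Prog κ) :
    Turing.FinTM2 :=
  letI := p.labelFintype
  { K := κ
    k₀ := k₀
    k₁ := k₁
    Γ := fun _ => Sym
    Λ := Option p.Label
    main := some p.start
    σ := Option Sym
    initialState := none
    m := fun
      -- A halting configuration prescribes the register as well, hence the reset. This extra step
      -- is the `+ 1` in the time bound of `Prog.polyTime`.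
      | none => .load (fun _ => none) .halt
      | some l => p.code some none l }

/-- A program that turns the encoding of every input into the encoding of the output, and that
needs polynomially many steps, yields a polynomial-time machine. -/
theorem Prog.polyTime {κ α β : Type} [DecidableEq κ] [Fintype κ] (k₀ k₁ : κ) (p : Prog κ)
    (ea : α → List Sym) (eb : β → List Sym) (f : α → β) (T : Polynomial ℕ)
    (h : ∀ a, ∃ t ≤ T.eval (ea a).length,
      Exec p (update (fun _ => []) k₀ (ea a)) (update (fun _ => []) k₁ (eb (f a))) t) :
    Nonempty (Turing.TM2ComputableInPolyTime ea eb f) := by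
  refine ⟨{ tm := p.machine k₀ k₁
            inputAlphabet := Equiv.refl Sym
            outputAlphabet := Equiv.refl Sym
            time := T + 1
            outputsFun := fun a => ?_ }⟩
  refine Classical.choice ?_
  obtain ⟨t, ht, he⟩ := h a
  obtain ⟨v, hv⟩ := he.iterate_step (p.machine k₀ k₁).m some none (fun l => rfl) none
  refine ⟨⟨⟨t + 1, ?_⟩, ?_⟩⟩
  · have h0 : Turing.initList (p.machine k₀ k₁) (List.map (Equiv.refl Sym).invFun (ea a)) =
        ⟨some (some p.start), none, update (fun _ => []) k₀ (ea a)⟩ := by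
      simp only [Turing.initList]
      congr 1
      refine funext fun k : κ => ?_
      by_cases hk : k = k₀
      · subst hk
        exact (dif_pos rfl).trans
          ((List.map_id _).trans (Function.update_self (β := fun _ => List Sym) k _ _).symm)
      · exact (dif_neg hk).trans
          (Function.update_of_ne (β := fun _ => List Sym) hk _ (fun _ => [])).symm
    have h1 : Turing.haltList (p.machine k₀ k₁) (List.map (Equiv.refl Sym).invFun (eb (f a))) =
        ⟨none, none, update (fun _ => []) k₁ (eb (f a))⟩ := by
      simp only [Turing.haltList]
      congr 1
      refine funext fun k : κ => ?_
      by_cases hk : k = k₁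
      · subst hk
        exact (dif_pos rfl).trans
          ((List.map_id _).trans (Function.update_self (β := fun _ => List Sym) k _ _).symm)
      · exact (dif_neg hk).trans
          (Function.update_of_ne (β := fun _ => List Sym) hk _ (fun _ => [])).symm
    rw [h0, Option.map_some, h1, Function.iterate_succ_apply']
    refine (congrArg (flip bind (p.machine k₀ k₁).step) hv).trans ?_
    rfl
  · simp only [Polynomial.eval_add, Polynomial.eval_one]
    omega

section StackPrograms

variable {κ : Type} [DecidableEq κ]

/-- Move the top of the stack `i` to the stack `j`. -/
def Prog.move (i j : κ) : Prog κ := .seq (.copyTop i j) (.pop i)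

/-- Empty the stack `k`. -/
def Prog.clear (k : κ) : Prog κ := .loop k (.pop k)

/-- Move the whole stack `i` to the stack `j`, which reverses it. -/
def Prog.moveAll (i j : κ) : Prog κ := .loop i (.move i j)

theorem Exec.of_eq {p : Prog κ} {ρ ρ₁ ρ₂ : Store κ} {t₁ t₂ : ℕ} (h : Exec p ρ ρ₁ t₁)
    (hρ : ρ₁ = ρ₂) (ht : t₁ = t₂) : Exec p ρ ρ₂ t₂ := hρ ▸ ht ▸ h

theorem Exec.move {i j : κ} (hij : i ≠ j) {ρ : Store κ} {s : Sym} {l : List Sym}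
    (h : ρ i = s :: l) : Exec (.move i j) ρ (update (update ρ j (s :: ρ j)) i l) 2 := by
  refine (Exec.seq (Exec.copyTop i j ρ) (Exec.pop i _)).of_eq ?_ rfl
  simp [h, hij]

theorem Exec.clear (k : κ) (ρ : Store κ) :
    Exec (.clear k) ρ (update ρ k []) (2 * (ρ k).length + 1) := by
  generalize hl : ρ k = l
  induction l generalizing ρ with
  | nil => exact (Exec.loop_nil hl).of_eq (by simp [← hl]) rfl
  | cons s l ih =>
    refine (Exec.loop_cons (by simp [hl]) (Exec.pop k ρ) (ih _ (by simp [hl]))).of_eq ?_ ?_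
    · simp
    · simp only [List.length_cons]; ring

theorem Exec.moveAll {i j : κ} (hij : i ≠ j) (ρ : Store κ) :
    Exec (.moveAll i j) ρ (update (update ρ j ((ρ i).reverse ++ ρ j)) i [])
      (3 * (ρ i).length + 1) := by
  generalize hl : ρ i = l
  induction l generalizing ρ with
  | nil => exact (Exec.loop_nil hl).of_eq (by
      rw [List.reverse_nil, List.nil_append, Function.update_eq_self, ← hl,
        Function.update_eq_self]) rfl
  | cons s l ih =>
    refine (Exec.loop_cons (by simp [hl]) (Exec.move hij hl) (ih _ (by simp))).of_eq ?_ ?_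
    · funext k
      by_cases hi : k = i
      · subst hi; simp
      · by_cases hj : k = j
        · subst hj; simp [hi]
        · simp [hi, hj]
    · simp only [List.length_cons]; ring

end StackPrograms

/-! ### A language of polynomial-time string generators -/

/-- Programs that read stacks and emit symbols. In `loop i j p`, the body is run for every nonempty
suffix of the stack `i`; it sees this suffix as `i` and the reversed prefix before it as `j`. In
`letE j p q`, the reversed output of `p` is available to `q` as `j`. -/
inductive Gen (κ : Type)
  | skip
  | emit (s : Sym)
  | emitTop (i : κ)
  | seq (p q : Gen κ)
  | ite (i : κ) (c : Sym → Bool) (p q : Gen κ)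
  | loop (i j : κ) (p : Gen κ)
  | letE (j : κ) (p q : Gen κ)

/-- Concatenate the values of `g` at all splits of a word into a reversed prefix and a nonempty
suffix. -/
def walk (g : List Sym → List Sym → List Sym) : List Sym → List Sym → List Sym
  | [], _ => []
  | s :: l, acc => g (s :: l) acc ++ walk g l (s :: acc)

section Gen

variable {κ : Type} [DecidableEq κ]

/-- The output of a generator. -/
def Gen.run : Gen κ → Store κ → List Sym
  | .skip, _ => []
  | .emit s, _ => [s]
  | .emitTop i, ρ => (ρ i).head?.toList
  | .seq p q, ρ => p.run ρ ++ q.run ρ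
  | .ite i c p q, ρ => if (ρ i).head?.any c then p.run ρ else q.run ρ
  | .loop i j p, ρ => walk (fun l acc => p.run (update (update ρ i l) j acc)) (ρ i) []
  | .letE j p q, ρ => q.run (update ρ j (p.run ρ).reverse)

/-- The program that pushes the output of a generator onto the stack `o`. -/
def Gen.prog : Gen κ → κ → Prog κ
  | .skip, _ => .skip
  | .emit s, o => .push o s
  | .emitTop i, o => .copyTop i o
  | .seq p q, o => .seq (p.prog o) (q.prog o)
  | .ite i c p q, o => .ite i c (p.prog o) (q.prog o)
  -- The traversal empties `i` onto `j`; the final `moveAll` restores `i` and empties `j` again.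
  | .loop i j p, o => .seq (.loop i (.seq (p.prog o) (.move i j))) (.moveAll j i)
  | .letE j p q, o => .seq (p.prog j) (.seq (q.prog o) (.clear j))

/-- A generator reads only the stacks in `U`, and it uses as auxiliary stacks none of those
in `V`. -/
def Gen.WF : Gen κ → Finset κ → Finset κ → Prop
  | .skip, _, _ => True
  | .emit _, _, _ => True
  | .emitTop i, U, _ => i ∈ U
  | .seq p q, U, V => p.WF U V ∧ q.WF U V
  | .ite i _ p q, U, V => i ∈ U ∧ p.WF U V ∧ q.WF U V
  | .loop i j p, U, V => i ∈ U ∧ j ∉ V ∧ p.WF (insert j U) (insert j V)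
  | .letE j p q, U, V => j ∉ V ∧ p.WF U (insert j V) ∧ q.WF (insert j U) (insert j V)

/-- A bound for the length of the output in terms of the lengths of the stacks. -/
noncomputable def Gen.len : Gen κ → Polynomial ℕ
  | .skip => 0
  | .emit _ => 1
  | .emitTop _ => 1
  | .seq p q => p.len + q.len
  | .ite _ _ p q => p.len + q.len
  | .loop _ _ p => .X * p.len
  -- The stack that holds the output of `p` may be longer than all stacks before, so `q` is
  -- evaluated at a larger bound.
  | .letE _ p q => q.len.comp (.X + p.len)

/-- A bound for the running time in terms of the lengths of the stacks. -/
noncomputable def Gen.time : Gen κ → Polynomial ℕ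
  | .skip => 1
  | .emit _ => 1
  | .emitTop _ => 1
  | .seq p q => p.time + q.time
  | .ite _ _ p q => 1 + p.time + q.time
  -- Per symbol: the body, one test, two steps for the move and three for restoring the stack. The
  -- two final tests give the `+ 2`.
  | .loop _ _ p => .X * (p.time + 6) + 2
  | .letE _ p q => p.time + q.time.comp (.X + p.len) + 2 * p.len + 1

theorem walk_congr {g g' : List Sym → List Sym → List Sym} (h : ∀ l acc, g l acc = g' l acc)
    (l acc : List Sym) : walk g l acc = walk g' l acc := by
  rw [show g = g' from funext fun l => funext fun acc => h l acc]

/-- Needed because the stack that receives the output grows during the run; it lies outside `U`, so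
the growth is invisible to the generator. -/
theorem Gen.run_congr {p : Gen κ} {U V : Finset κ} (hp : p.WF U V) {ρ ρ' : Store κ}
    (h : ∀ k ∈ U, ρ k = ρ' k) : p.run ρ = p.run ρ' := by
  induction p generalizing U V ρ ρ' with
  | skip => rfl
  | emit s => rfl
  | emitTop i => simp only [Gen.run, h i hp]
  | seq p q ihp ihq => simp only [Gen.run, ihp hp.1 h, ihq hp.2 h]
  | ite i c p q ihp ihq => simp only [Gen.run, h i hp.1, ihp hp.2.1 h, ihq hp.2.2 h]
  | loop i j p ih =>
    simp only [Gen.run, h i hp.1]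
    refine walk_congr (fun l acc => ih hp.2.2 fun k hk => ?_) _ _
    by_cases hj : k = j
    · subst hj; simp
    · by_cases hi : k = i
      · subst hi; simp [hj]
      · simpa [hi, hj] using h k ((Finset.mem_insert.1 hk).resolve_left hj)
  | letE j p q ihp ihq =>
    simp only [Gen.run]
    refine ihq hp.2.2 fun k hk => ?_
    by_cases hj : k = j
    · subst hj; simp [ihp hp.2.1 h]
    · simpa [hj] using h k ((Finset.mem_insert.1 hk).resolve_left hj)

/-- Suffix and prefix together always have the length of the whole word, so the bound `N` applies to
both at every split. -/
theorem length_walk_le {g : List Sym → List Sym → List Sym} {b N : ℕ}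
    (hg : ∀ l acc, l.length ≤ N → acc.length ≤ N → (g l acc).length ≤ b) (l acc : List Sym)
    (h : l.length + acc.length ≤ N) : (walk g l acc).length ≤ l.length * b := by
  induction l generalizing acc with
  | nil => simp [walk]
  | cons s l ih =>
    simp only [List.length_cons] at h
    have h1 := hg (s :: l) acc (by simp; omega) (by omega)
    have h2 := ih (s :: acc) (by simp; omega)
    simp only [walk, List.length_append, List.length_cons, Nat.add_mul, Nat.one_mul]
    omega

theorem Gen.length_run_le {p : Gen κ} {U V : Finset κ} (hp : p.WF U V) {ρ : Store κ}
    {N : ℕ} (h : ∀ k ∈ U, (ρ k).length ≤ N) : (p.run ρ).length ≤ p.len.eval N := by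
  induction p generalizing U V ρ N with
  | skip => simp [Gen.run]
  | emit s => simp [Gen.run, Gen.len]
  | emitTop i => cases hi : (ρ i).head? <;> simp [Gen.run, Gen.len, hi]
  | seq p q ihp ihq =>
    simpa [Gen.run, Gen.len] using add_le_add (ihp hp.1 h) (ihq hp.2 h)
  | ite i c p q ihp ihq =>
    have h1 := ihp hp.2.1 h
    have h2 := ihq hp.2.2 h
    simp only [Gen.run, Gen.len, Polynomial.eval_add]
    split <;> omega
  | loop i j p ih =>
    simp only [Gen.run, Gen.len, Polynomial.eval_mul, Polynomial.eval_X]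
    refine (length_walk_le (N := N) (b := p.len.eval N) (fun l acc hl ha => ?_) _ _
      (by simpa using h i hp.1)).trans (Nat.mul_le_mul_right _ (h i hp.1))
    refine ih hp.2.2 fun k hk => ?_
    by_cases hj : k = j
    · subst hj; simpa using ha
    · by_cases hi : k = i
      · subst hi; simpa [hj] using hl
      · simpa [hi, hj] using h k ((Finset.mem_insert.1 hk).resolve_left hj)
  | letE j p q ihp ihq =>
    simp only [Gen.run, Gen.len, Polynomial.eval_comp, Polynomial.eval_add, Polynomial.eval_X]
    refine ihq hp.2.2 fun k hk => ?_
    have h1 := ihp hp.2.1 h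
    by_cases hj : k = j
    · subst hj; simp; omega
    · have := h k ((Finset.mem_insert.1 hk).resolve_left hj)
      simp [hj]; omega

/-- The program of a generator computes its output in polynomial time. -/
theorem Gen.exec {p : Gen κ} {U V : Finset κ} (hp : p.WF U V) (hUV : U ⊆ V) {o : κ} (hoV : o ∈ V)
    (hoU : o ∉ U) {ρ : Store κ} {N : ℕ} (hV : ∀ k ∉ V, ρ k = [])
    (h : ∀ k ∈ U, (ρ k).length ≤ N) :
    ∃ t ≤ p.time.eval N, Exec (p.prog o) ρ (update ρ o ((p.run ρ).reverse ++ ρ o)) t := by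
  induction p generalizing U V o ρ N with
  | skip => exact ⟨1, by simp [Gen.time], (Exec.skip ρ).of_eq (by simp [Gen.run]) rfl⟩
  | emit s => exact ⟨1, by simp [Gen.time], (Exec.push o s ρ).of_eq (by simp [Gen.run]) rfl⟩
  | emitTop i =>
    refine ⟨1, by simp [Gen.time], (Exec.copyTop i o ρ).of_eq ?_ rfl⟩
    cases hi : (ρ i).head? <;> simp [Gen.run, hi]
  | seq p q ihp ihq =>
    obtain ⟨t1, ht1, e1⟩ := ihp hp.1 hUV hoV hoU hV h
    have hne : ∀ k ∈ U, k ≠ o := fun k hk e => hoU (e ▸ hk)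
    obtain ⟨t2, ht2, e2⟩ := ihq (ρ := update ρ o ((p.run ρ).reverse ++ ρ o)) hp.2 hUV hoV hoU
      (fun k hk => by
        have hko : k ≠ o := fun e => hk (e ▸ hoV)
        rw [Function.update_of_ne hko]; exact hV k hk)
      (fun k hk => by rw [Function.update_of_ne (hne k hk)]; exact h k hk)
    refine ⟨t1 + t2, by simp only [Gen.time, Polynomial.eval_add]; omega, (e1.seq e2).of_eq ?_ rfl⟩
    rw [Gen.run_congr (ρ' := ρ) hp.2 (fun k hk => Function.update_of_ne (hne k hk) _ _)]
    simp [Gen.run]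
  | ite i c p q ihp ihq =>
    obtain ⟨t1, ht1, e1⟩ := ihp hp.2.1 hUV hoV hoU hV h
    obtain ⟨t2, ht2, e2⟩ := ihq hp.2.2 hUV hoV hoU hV h
    cases hc : (ρ i).head?.any c with
    | true =>
      refine ⟨1 + t1, by simp [Gen.time]; omega, (Exec.ite_pos hc e1).of_eq ?_ rfl⟩
      simp only [Gen.run, hc, if_true]
    | false =>
      refine ⟨1 + t2, by simp [Gen.time]; omega, (Exec.ite_neg hc e2).of_eq ?_ rfl⟩
      simp only [Gen.run, hc, Bool.false_eq_true, if_false]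
  | loop i j p ih =>
    obtain ⟨hi, hj, hp⟩ := hp
    have hij : i ≠ j := fun e => hj (e ▸ hUV hi)
    have hoj : o ≠ j := fun e => hj (e ▸ hoV)
    have hoi : o ≠ i := fun e => hoU (e ▸ hi)
    set g : List Sym → List Sym → List Sym := fun l acc => p.run (update (update ρ i l) j acc)
      with hg
    -- The state in the middle of the loop: `l` is still to be read, `acc` has been moved to `j`,
    -- and `w` is on the output stack.
    have key : ∀ l acc w, l.length + acc.length ≤ N →
        ∃ t ≤ l.length * (p.time.eval N + 3) + 1,
          Exec (.loop i (.seq (p.prog o) (.move i j)))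
            (update (update (update ρ i l) j acc) o w)
            (update (update (update ρ i []) j (l.reverse ++ acc)) o
              ((walk g l acc).reverse ++ w)) t := by
      intro l
      induction l with
      | nil =>
        intro acc w _
        refine ⟨1, by simp, (Exec.loop_nil ?_).of_eq (by simp [walk]) rfl⟩
        simp [hij, hoi.symm]
      | cons s l ihl =>
        intro acc w hN
        simp only [List.length_cons] at hN
        obtain ⟨t1, ht1, e1⟩ := ih (ρ := update (update (update ρ i (s :: l)) j acc) o w)
          (N := N) (o := o) hp (Finset.insert_subset_insert j hUV)
          (Finset.mem_insert_of_mem hoV) (by simp [hoU, hoj])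
          (fun k hk => by
            simp only [Finset.mem_insert, not_or] at hk
            have h1 : k ≠ o := fun e => hk.2 (e ▸ hoV)
            have h2 : k ≠ i := fun e => hk.2 (e ▸ hUV hi)
            simpa [h1, h2, hk.1] using hV k hk.2)
          (fun k hk => by
            have h1 : k ≠ o := fun e => by subst e; simp [hoj, hoU] at hk
            by_cases h2 : k = j
            · subst h2; simp [h1]; omega
            · by_cases h3 : k = i
              · subst h3; simp [h1, h2]; omega
              · simpa [h1, h2, h3] using h k ((Finset.mem_insert.1 hk).resolve_left h2))
        have hrun : p.run (update (update (update ρ i (s :: l)) j acc) o w) = g (s :: l) acc :=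
          Gen.run_congr hp fun k hk => by
            have h1 : k ≠ o := fun e => by subst e; simp [hoj, hoU] at hk
            simp [h1]
        rw [hrun] at e1
        obtain ⟨t2, ht2, e2⟩ := ihl (s :: acc) ((g (s :: l) acc).reverse ++ w) (by simp; omega)
        refine ⟨1 + (t1 + 2 + t2), ?_, ?_⟩
        · simp only [List.length_cons, Nat.add_mul, Nat.one_mul] at ht2 ⊢; omega
        · have em := Exec.move (ρ := update (update (update ρ i (s :: l)) j acc) o
            ((g (s :: l) acc).reverse ++ w)) (s := s) (l := l) hij (by simp [hij, hoi.symm])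
          refine (Exec.loop_cons (by simp [hij, hoi.symm])
            (((e1.of_eq (by simp) rfl).seq em).of_eq ?_ rfl) e2).of_eq ?_ rfl
          · funext k
            by_cases h1 : k = o
            · subst h1; simp [hoi, hoj]
            · by_cases h2 : k = j
              · subst h2; simp [hij.symm, h1]
              · by_cases h3 : k = i
                · subst h3; simp [h1, h2]
                · simp [h1, h2, h3]
          · simp [walk]
    have hjn : ρ j = [] := hV j hj
    obtain ⟨t, ht, e⟩ := key (ρ i) [] (ρ o) (by simpa using h i hi)
    have hst : update (update (update ρ i (ρ i)) j []) o (ρ o) = ρ := by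
      funext k
      by_cases h1 : k = o
      · subst h1; simp
      · by_cases h2 : k = j
        · subst h2; simp [h1, hjn]
        · simp [h1, h2]
    rw [hst] at e
    have hm := Exec.moveAll hij.symm (update (update (update ρ i []) j ((ρ i).reverse ++ [])) o
              ((walk g (ρ i) []).reverse ++ ρ o))
    refine ⟨_, ?_, (e.seq hm).of_eq ?_ rfl⟩
    · have h1 := h i hi
      have h2 : (ρ i).length * (p.time.eval N + 3) ≤ N * (p.time.eval N + 3) :=
        Nat.mul_le_mul_right _ h1
      simp [Gen.time, hoj.symm]
      simp only [Nat.mul_add] at h2 ht ⊢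
      omega
    · funext k
      by_cases h1 : k = o
      · subst h1; simp [hoi, hoj, Gen.run, hg]
      · by_cases h2 : k = j
        · subst h2; simp [h1, hjn]
        · by_cases h3 : k = i
          · subst h3; simp [h1, h2, hoj.symm]
          · simp [h1, h2, h3]
  | letE j p q ihp ihq =>
    obtain ⟨hj, hp, hq⟩ := hp
    have hoj : o ≠ j := fun e => hj (e ▸ hoV)
    have hjU : j ∉ U := fun e => hj (hUV e)
    have hlen := Gen.length_run_le hp h
    have hjn : ρ j = [] := hV j hj
    obtain ⟨t1, ht1, e1⟩ := ihp (o := j) hp (hUV.trans (Finset.subset_insert _ _))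
      (Finset.mem_insert_self _ _) hjU
      (fun k hk => hV k fun h => hk (Finset.mem_insert_of_mem h)) h
    rw [hjn, List.append_nil] at e1
    obtain ⟨t2, ht2, e2⟩ := ihq (o := o) (ρ := update ρ j (p.run ρ).reverse)
      (N := N + p.len.eval N) hq
      (Finset.insert_subset_insert j hUV) (Finset.mem_insert_of_mem hoV) (by simp [hoU, hoj])
      (fun k hk => by
        simp only [Finset.mem_insert, not_or] at hk
        simpa [hk.1] using hV k hk.2)
      (fun k hk => by
        by_cases h2 : k = j
        · subst h2; simp; omega
        · have := h k ((Finset.mem_insert.1 hk).resolve_left h2)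
          simp [h2]; omega)
    have hc := Exec.clear j (update (update ρ j (p.run ρ).reverse) o
      ((q.run (update ρ j (p.run ρ).reverse)).reverse ++ ρ o))
    rw [Function.update_of_ne hoj] at e2
    refine ⟨_, ?_, (e1.seq (e2.seq hc)).of_eq ?_ rfl⟩
    · simp [Gen.time, hoj.symm]
      omega
    · funext k
      by_cases h1 : k = o
      · subst h1; simp [hoj, Gen.run]
      · by_cases h2 : k = j
        · subst h2; simp [h1, hjn]
        · simp [h1, h2]

end Gen

/-! ### Splitting the input -/

/-- The stacks of the machine. -/
inductive Stk
  | inp | cnt | flag | trash | sigR | factR | nameR | consR | out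
  | res | sig | tauR | tau | names | names2 | gpos | ksR | ks | facts | cons | some
  | aux | aux2 | aux3 | jS | s | jR | r | tok | n | i | n2 | j | n3 | jK | tokK | a | a1 | m | x
  | jN | jN2
  deriving DecidableEq

instance : Fintype Stk :=
  Fintype.ofList [.inp, .cnt, .flag, .trash, .sigR, .factR, .nameR, .consR, .out, .res, .sig,
    .tauR, .tau, .names, .names2, .gpos, .ksR, .ks, .facts, .cons, .some, .aux, .aux2, .aux3, .jS,
    .s, .jR, .r, .tok, .n, .i, .n2, .j, .n3, .jK, .tokK, .a, .a1, .m, .x, .jN, .jN2]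
    (by intro k; cases k <;> simp)

/-- The program needs at most `b` steps. -/
def Runs {κ : Type} [DecidableEq κ] (p : Prog κ) (ρ ρ' : Store κ) (b : ℕ) : Prop :=
  ∃ t ≤ b, Exec p ρ ρ' t

theorem Exec.runs {κ : Type} [DecidableEq κ] {p : Prog κ} {ρ ρ₁ ρ₂ : Store κ} {t : ℕ}
    (h : Exec p ρ ρ₁ t) (e : ρ₁ = ρ₂) : Runs p ρ ρ₂ t := ⟨t, le_rfl, e ▸ h⟩

theorem Runs.seq {κ : Type} [DecidableEq κ] {p q : Prog κ} {ρ ρ₁ ρ₂ : Store κ} {b₁ b₂ : ℕ}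
    (h₁ : Runs p ρ ρ₁ b₁) (h₂ : Runs q ρ₁ ρ₂ b₂) : Runs (.seq p q) ρ ρ₂ (b₁ + b₂) := by
  obtain ⟨t₁, l₁, e₁⟩ := h₁
  obtain ⟨t₂, l₂, e₂⟩ := h₂
  exact ⟨t₁ + t₂, by omega, e₁.seq e₂⟩

theorem Runs.mono {κ : Type} [DecidableEq κ] {p : Prog κ} {ρ ρ₁ ρ₂ : Store κ} {b₁ b₂ : ℕ}
    (h : Runs p ρ ρ₁ b₁) (e : ρ₁ = ρ₂) (hb : b₁ ≤ b₂) : Runs p ρ ρ₂ b₂ := by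
  obtain ⟨t, l, h⟩ := h
  exact ⟨t, l.trans hb, e ▸ h⟩

/-- The number of complete pieces (names, numbers, lists, formulas) that have to follow a symbol. -/
def Sym.demand : Sym → ℕ
  | .zero => 1
  | .one => 1
  | .fin => 0
  | .item => 2
  | .base => 1
  | .dist => 0
  | .rel => 2
  | .eq => 2
  | .tru => 0
  | .fls => 0
  | .and => 2
  | .or => 2
  | .ex => 2
  | .neg => 1

/-- The word consists of exactly `d` complete pieces. -/
def Demand : List Sym → ℕ → Prop
  | [], d => d = 0
  | _ :: _, 0 => False
  | s :: l, d + 1 => Demand l (d + s.demand)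

/-- Encodings are words in Polish notation: a part of the input ends when the number of outstanding
pieces drops to zero. This lets the machine cut the input with a unary counter. A list marker asks
for two pieces, the item and the rest of the list. -/
theorem Demand.append {u v : List Sym} {a b : ℕ} (hu : Demand u a) (hv : Demand v b) :
    Demand (u ++ v) (a + b) := by
  induction u generalizing a with
  | nil =>
    obtain rfl : a = 0 := hu
    simpa using hv
  | cons s u ih =>
    cases a with
    | zero => exact hu.elim
    | succ a =>
      rw [show a + 1 + b = (a + b) + 1 by omega]
      change Demand (u ++ v) (a + b + s.demand)
      rw [show a + b + s.demand = a + s.demand + b by omega]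
      exact ih hu

theorem demand_encNat (n : ℕ) : Demand (encNat n) 1 := by
  induction n with
  | zero => exact rfl
  | succ n ih => exact ih

theorem demand_encName (w : Name) : Demand (encName w) 1 := by
  induction w with
  | nil => exact rfl
  | cons b w ih => cases b <;> exact ih

theorem demand_encList {β : Type} {e : β → List Sym} (he : ∀ b, Demand (e b) 1) (l : List β) :
    Demand (encList e l) 1 := by
  induction l with
  | nil => exact rfl
  | cons b l ih =>
    have : encList e (b :: l) = Sym.item :: (e b ++ encList e l) := by simp [encList]
    rw [this]
    exact (he b).append ih

theorem demand_decl (d : Decl) : Demand d.encode 1 := by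
  cases d with
  | base n => exact demand_encNat n
  | dist => exact rfl

theorem demand_atom (A : Atom) : Demand A.encode 1 := by
  cases A with
  | rel R xs => exact (demand_encNat R).append (demand_encList demand_encName xs)
  | eq x y => exact (demand_encName x).append (demand_encName y)

theorem demand_fml (φ : Fml) : Demand φ.encode 1 := by
  induction φ with
  | tru => exact rfl
  | fls => exact rfl
  | atom A => exact demand_atom A
  | and φ ψ ih1 ih2 => exact Demand.append (a := 1) (b := 1) ih1 ih2
  | or φ ψ ih1 ih2 => exact Demand.append (a := 1) (b := 1) ih1 ih2
  | ex x φ ih => exact (demand_encName x).append ih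
  | neg φ ih => exact ih

/-- Move pieces of the input, as many as `cnt` says, to both of the storeOf `A` and `B`. -/
def consume (A B : Stk) : Prog Stk :=
  .loop .cnt (.seq (.pop .cnt)
    (.seq (.ite .inp (fun s => s.demand == 1) (.push .cnt .one)
        (.ite .inp (fun s => s.demand == 2) (.seq (.push .cnt .one) (.push .cnt .one)) .skip))
      (.seq (.copyTop .inp A) (.seq (.copyTop .inp B) (.pop .inp)))))

/-- The invariant is that the counter holds the demand of the unread part. Each symbol costs at most
nine steps: one test, one `pop`, four for raising the counter and three for the copies. -/
theorem runs_consume {A B : Stk} (hA : A ≠ .inp ∧ A ≠ .cnt) (hB : B ≠ .inp ∧ B ≠ .cnt)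
    (hAB : A ≠ B) {u : List Sym} (r : List Sym) {d : ℕ} (hu : Demand u d) (ρ : Store Stk)
    (hi : ρ .inp = u ++ r) (hc : ρ .cnt = List.replicate d .one) :
    Runs (consume A B) ρ (update (update (update (update ρ .cnt []) .inp r)
      A (u.reverse ++ ρ A)) B (u.reverse ++ ρ B)) (9 * u.length + 1) := by
  induction u generalizing d ρ with
  | nil =>
    obtain rfl : d = 0 := hu
    refine (Exec.loop_nil hc).runs ?_
    have h1 : ρ .inp = r := hi
    have h2 : ρ .cnt = [] := hc
    funext k
    by_cases e1 : k = B
    · subst e1; simp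
    · by_cases e2 : k = A
      · subst e2; simp [e1]
      · by_cases e3 : k = .inp
        · subst e3; simp [e1, e2, h1]
        · by_cases e4 : k = .cnt
          · subst e4; simp [e1, e2, h2]
          · simp [e1, e2, e3, e4]
  | cons s u ih =>
    cases d with
    | zero => exact hu.elim
    | succ d =>
      have hu' : Demand u (d + s.demand) := hu
      set ρ₁ : Store Stk := update ρ .cnt (List.replicate d .one) with hρ₁
      have e1 : Runs (.pop .cnt) ρ ρ₁ 1 := (Exec.pop _ _).runs (by simp [hρ₁, hc])
      set ρ₂ : Store Stk := update ρ .cnt (List.replicate (d + s.demand) .one) with hρ₂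
      have hi1 : ρ₁ .inp = s :: (u ++ r) := by simp [hρ₁, hi]
      have e2 : Runs (.ite .inp (fun s => s.demand == 1) (.push .cnt .one)
          (.ite .inp (fun s => s.demand == 2) (.seq (.push .cnt .one) (.push .cnt .one)) .skip))
          ρ₁ ρ₂ 4 := by
        by_cases h1 : s.demand = 1
        · refine Runs.mono (b₁ := 2) (((Exec.push .cnt .one ρ₁).ite_pos ?_).runs ?_) rfl (by omega)
          · simp [hi1, h1]
          · simp [hρ₁, hρ₂, h1, List.replicate_succ]
        · by_cases h2 : s.demand = 2
          · refine Runs.mono (b₁ := 4) (((((Exec.push .cnt .one ρ₁).seq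
              (Exec.push .cnt .one _)).ite_pos ?_).ite_neg ?_).runs ?_) rfl (by omega)
            · simp [hi1, h2]
            · simp [hi1, h2]
            · simp [hρ₁, hρ₂, h2, List.replicate_succ]
          · have h0 : s.demand = 0 := by revert h1 h2; cases s <;> simp [Sym.demand]
            refine ((((Exec.skip ρ₁).ite_neg ?_).ite_neg ?_).runs ?_).mono rfl (by omega)
            · simp [hi1, h0]
            · simp [hi1, h0]
            · simp [hρ₁, hρ₂, h0]
      have hi2 : ρ₂ .inp = s :: (u ++ r) := by simp [hρ₂, hi]
      set ρ₃ : Store Stk := update (update (update ρ₂ .inp (u ++ r)) A (s :: ρ A)) B (s :: ρ B)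
        with hρ₃
      have e3 : Runs (.seq (.copyTop .inp A) (.seq (.copyTop .inp B) (.pop .inp))) ρ₂ ρ₃ 3 := by
        refine ((Exec.copyTop _ _ _).seq ((Exec.copyTop _ _ _).seq (Exec.pop _ _))).runs ?_
        funext k
        by_cases k1 : k = B
        · subst k1; simp [hρ₃, hρ₂, hB, hi, hA.1.symm, hAB.symm]
        · by_cases k2 : k = A
          · subst k2; simp [hρ₃, hρ₂, hA, hi, k1]
          · by_cases k3 : k = .inp
            · subst k3; simp [hρ₃, hρ₂, k1, k2, hi]
            · simp [hρ₃, k1, k2, k3]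
      obtain ⟨t, ht, e⟩ := e1.seq (e2.seq e3)
      obtain ⟨t', ht', e'⟩ := ih hu' ρ₃ (by simp [hρ₃, hA.1.symm, hB.1.symm])
        (by simp [hρ₃, hρ₂, hA.2.symm, hB.2.symm])
      refine ⟨_, ?_, (Exec.loop_cons ?_ e e').of_eq ?_ rfl⟩
      · simp only [List.length_cons]; omega
      · simp [hc]
      · funext k
        by_cases k1 : k = B
        · subst k1; simp [hρ₃]
        · by_cases k2 : k = A
          · subst k2; simp [k1, hρ₃]
          · by_cases k3 : k = .inp
            · subst k3; simp [k1, k2]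
            · by_cases k4 : k = .cnt
              · subst k4; simp [k1, k2]
              · simp [hρ₃, hρ₂, k1, k2, k3, k4]

/-- The stacks after some part of the input has been read. -/
def storeOf (inp trash sigR factR nameR consR : List Sym) : Store Stk
  | .inp => inp
  | .trash => trash
  | .sigR => sigR
  | .factR => factR
  | .nameR => nameR
  | .consR => consR
  | _ => []

/-- The argument lists are copied a second time, to `nameR`, since the generator of the `G`-facts
ranges over elements only. The loop runs until the end marker of the list of facts clears `flag`. -/
def readFacts : Prog Stk :=
  .seq (.push .flag .one)
    (.loop .flag (.ite .inp (fun s => s == .item)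
      (.seq (.move .inp .factR) (.seq (.push .cnt .one) (.seq (consume .factR .trash)
        (.seq (.push .cnt .one) (consume .factR .nameR)))))
      (.seq (.move .inp .factR) (.pop .flag))))

/-- The end marker of the signature is dropped so that the declaration of `G` can be appended. What
is left on `inp` is the query. -/
def readInput : Prog Stk :=
  .seq (.push .cnt .one) (.seq (consume .sigR .trash) (.seq (.pop .sigR) (.seq readFacts
    (.seq (.push .cnt .one) (.seq (consume .consR .trash) (.clear .trash))))))

/-- The items of an encoded list, without the end marker. -/
def encItems {β : Type} (e : β → List Sym) (l : List β) : List Sym :=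
  l.flatMap (fun b => Sym.item :: e b)

theorem encList_eq {β : Type} (e : β → List Sym) (l : List β) :
    encList e l = encItems e l ++ [Sym.fin] := rfl

/-- Of the trash only the length matters, for the cost of clearing it. -/
theorem runs_readFacts (F : List (Fact Name)) (r tr sg fa na co : List Sym) :
    ∃ tr', tr'.length ≤ tr.length + (encList encFact F).length ∧
      Runs readFacts (storeOf (encList encFact F ++ r) tr sg fa na co)
        (storeOf r tr' sg ((encList encFact F).reverse ++ fa)
          ((F.flatMap fun f => encList encName f.args).reverse ++ na) co)
        (20 * (encList encFact F).length + 10) := by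
  have key : ∀ tr fa na, ∃ tr', tr'.length ≤ tr.length + (encList encFact F).length ∧
      Runs (.loop .flag (.ite .inp (fun s => s == .item)
          (.seq (.move .inp .factR) (.seq (.push .cnt .one) (.seq (consume .factR .trash)
            (.seq (.push .cnt .one) (consume .factR .nameR)))))
          (.seq (.move .inp .factR) (.pop .flag))))
        (update (storeOf (encList encFact F ++ r) tr sg fa na co) .flag [.one])
        (storeOf r tr' sg ((encList encFact F).reverse ++ fa)
          ((F.flatMap fun f => encList encName f.args).reverse ++ na) co)
        (20 * (encList encFact F).length + 8) := by
    induction F with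
    | nil =>
      intro tr fa na
      refine ⟨tr, by simp, _, ?_, (Exec.loop_cons (by simp) (Exec.ite_neg ?_
        ((Exec.move (s := .fin) (l := r) (by simp) ?_).seq (Exec.pop _ _)))
        (Exec.loop_nil (by simp))).of_eq ?_ rfl⟩
      · simp [encList]
      · simp [encList, storeOf]
      · simp [encList, storeOf]
      · funext k; cases k <;> simp [storeOf, encList]
    | cons f F ih =>
      intro tr fa na
      set l1 := encNat f.rel with hl1
      set l2 := encList encName f.args with hl2
      set l3 := encList encFact F with hl3
      have hl : encList encFact (f :: F) = Sym.item :: (l1 ++ (l2 ++ l3)) := by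
        simp [encList, encFact, hl1, hl2, hl3]
      obtain ⟨tr', htr', t', ht', e'⟩ := ih (l1.reverse ++ tr)
        (l2.reverse ++ (l1.reverse ++ (.item :: fa))) (l2.reverse ++ na)
      refine ⟨tr', by rw [hl]; simp at htr' ⊢; omega, ?_⟩
      set ρ₁ := update (storeOf (l1 ++ (l2 ++ (l3 ++ r))) tr sg (.item :: fa) na co) .flag [.one]
        with hρ₁
      have e1 : Runs (.move .inp .factR)
          (update (storeOf (encList encFact (f :: F) ++ r) tr sg fa na co) .flag [.one])
          ρ₁ 2 := by
        refine (Exec.move (s := .item) (l := l1 ++ (l2 ++ (l3 ++ r))) (by simp) ?_).runs ?_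
        · simp [hl, storeOf]
        · funext k; cases k <;> simp [storeOf, hρ₁]
      have e2 : Runs (.push .cnt .one) ρ₁ (update ρ₁ .cnt [.one]) 1 :=
        (Exec.push _ _ _).runs (by simp [hρ₁, storeOf])
      set ρ₂ := update (storeOf (l2 ++ (l3 ++ r)) (l1.reverse ++ tr) sg
        (l1.reverse ++ (.item :: fa)) na co) .flag [.one] with hρ₂
      have e3 : Runs (consume .factR .trash) (update ρ₁ .cnt [.one]) ρ₂ (9 * l1.length + 1) := by
        refine (runs_consume (by simp) (by simp) (by simp) (l2 ++ (l3 ++ r))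
          (demand_encNat f.rel) _ ?_ ?_).mono ?_ le_rfl
        · simp [hρ₁, storeOf, hl1]
        · simp
        · funext k; cases k <;> simp [storeOf, hρ₁, hρ₂, hl1]
      have e4 : Runs (.push .cnt .one) ρ₂ (update ρ₂ .cnt [.one]) 1 :=
        (Exec.push _ _ _).runs (by simp [hρ₂, storeOf])
      have e5 : Runs (consume .factR .nameR) (update ρ₂ .cnt [.one])
          (update (storeOf (l3 ++ r) (l1.reverse ++ tr) sg
            (l2.reverse ++ (l1.reverse ++ (.item :: fa))) (l2.reverse ++ na) co) .flag [.one])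
          (9 * l2.length + 1) := by
        refine (runs_consume (by simp) (by simp) (by simp) (l3 ++ r)
          (demand_encList demand_encName f.args) _ ?_ ?_).mono ?_ le_rfl
        · simp [hρ₂, storeOf, hl2]
        · simp
        · funext k; cases k <;> simp [storeOf, hρ₂, hl2]
      obtain ⟨t, ht, e⟩ := e1.seq (e2.seq (e3.seq (e4.seq e5)))
      refine ⟨_, ?_, (Exec.loop_cons (by simp) (e.ite_pos ?_) e').of_eq ?_ rfl⟩
      · rw [hl]; simp only [List.length_cons, List.length_append] at ht' ⊢; omega
      · simp [hl, storeOf]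
      · simp [hl, hl2]
  obtain ⟨tr', htr', h⟩ := key tr fa na
  have h0 : Runs (.push .flag .one) (storeOf (encList encFact F ++ r) tr sg fa na co)
      (update (storeOf (encList encFact F ++ r) tr sg fa na co) .flag [.one]) 1 :=
    (Exec.push _ _ _).runs (by simp [storeOf])
  exact ⟨tr', htr', (h0.seq h).mono rfl (by omega)⟩

theorem runs_readInput (K : KB) (Q : Fml) :
    Runs readInput (update (fun _ => []) .inp (encInput (K, Q)))
      (storeOf Q.encode [] (encItems Decl.encode K.sig).reverse (encList encFact K.facts).reverse
        (K.facts.flatMap fun f => encList encName f.args).reverse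
        (encList Fml.encode K.constraints).reverse)
      (60 * (encInput (K, Q)).length + 60) := by
  set l1 := encList Decl.encode K.sig with hl1
  set l2 := encList encFact K.facts with hl2
  set l3 := encList Fml.encode K.constraints with hl3
  set nm := K.facts.flatMap fun f => encList encName f.args
  have hl : encInput (K, Q) = l1 ++ (l2 ++ (l3 ++ Q.encode)) := by
    simp [encInput, KB.encode, hl1, hl2, hl3]
  rw [hl]
  obtain ⟨tr, htr, hF⟩ := runs_readFacts K.facts (l3 ++ Q.encode) l1.reverse
    (encItems Decl.encode K.sig).reverse [] [] []
  rw [← hl2] at hF htr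
  have e1 : Runs (.push .cnt .one) (update (fun _ => []) .inp (l1 ++ (l2 ++ (l3 ++ Q.encode))))
      (update (storeOf (l1 ++ (l2 ++ (l3 ++ Q.encode))) [] [] [] [] []) .cnt [.one]) 1 := by
    refine (Exec.push _ _ _).runs ?_
    funext k; cases k <;> simp [storeOf]
  have e2 : Runs (consume .sigR .trash)
      (update (storeOf (l1 ++ (l2 ++ (l3 ++ Q.encode))) [] [] [] [] []) .cnt [.one])
      (storeOf (l2 ++ (l3 ++ Q.encode)) l1.reverse l1.reverse [] [] []) (9 * l1.length + 1) := by
    refine (runs_consume (by simp) (by simp) (by simp) (l2 ++ (l3 ++ Q.encode))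
      (demand_encList demand_decl K.sig) _ ?_ ?_).mono ?_ le_rfl
    · simp [storeOf, hl1]
    · simp
    · funext k; cases k <;> simp [storeOf, hl1]
  have e3 : Runs (.pop .sigR) (storeOf (l2 ++ (l3 ++ Q.encode)) l1.reverse l1.reverse [] [] [])
      (storeOf (l2 ++ (l3 ++ Q.encode)) l1.reverse (encItems Decl.encode K.sig).reverse [] [] [])
      1 := by
    refine (Exec.pop _ _).runs ?_
    funext k; cases k <;> simp [storeOf, hl1, encList_eq]
  have e5 : Runs (.push .cnt .one)
      (storeOf (l3 ++ Q.encode) tr (encItems Decl.encode K.sig).reverse (l2.reverse ++ [])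
        (nm.reverse ++ []) [])
      (update (storeOf (l3 ++ Q.encode) tr (encItems Decl.encode K.sig).reverse (l2.reverse ++ [])
        (nm.reverse ++ []) []) .cnt [.one]) 1 :=
    (Exec.push _ _ _).runs (by simp [storeOf])
  have e6 : Runs (consume .consR .trash)
      (update (storeOf (l3 ++ Q.encode) tr (encItems Decl.encode K.sig).reverse (l2.reverse ++ [])
        (nm.reverse ++ []) []) .cnt [.one])
      (storeOf Q.encode (l3.reverse ++ tr) (encItems Decl.encode K.sig).reverse l2.reverse
        nm.reverse l3.reverse) (9 * l3.length + 1) := by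
    refine (runs_consume (by simp) (by simp) (by simp) Q.encode
      (demand_encList demand_fml K.constraints) _ ?_ ?_).mono ?_ le_rfl
    · simp [storeOf, hl3]
    · simp
    · funext k; cases k <;> simp [storeOf, hl3]
  have e7 : Runs (.clear .trash)
      (storeOf Q.encode (l3.reverse ++ tr) (encItems Decl.encode K.sig).reverse l2.reverse
        nm.reverse l3.reverse)
      (storeOf Q.encode [] (encItems Decl.encode K.sig).reverse l2.reverse
        nm.reverse l3.reverse) (2 * (l3.length + tr.length) + 1) := by
    refine (Exec.clear _ _).runs ?_ |>.mono rfl ?_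
    · funext k; cases k <;> simp [storeOf]
    · simp [storeOf]
  refine (e1.seq (e2.seq (e3.seq (hF.seq (e5.seq (e6.seq e7)))))).mono rfl ?_
  simp only [List.length_append, List.length_reverse] at htr ⊢
  omega

/-! ### The output -/

/-- The positions of the distinguished relations, counted from `p`. -/
def distPos : Sig → ℕ → List ℕ
  | [], _ => []
  | .dist :: σ, p => p :: distPos σ (p + 1)
  | .base _ :: σ, p => distPos σ (p + 1)

/-- The positions, counted from `p`, and the arities of the base relations. -/
def basePos : Sig → ℕ → List (ℕ × ℕ)
  | [], _ => []
  | .dist :: σ, p => basePos σ (p + 1)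
  | .base n :: σ, p => (p, n) :: basePos σ (p + 1)

/-- A list of numbers whose maximum is the width. -/
def widths (K : KB) (Q : Fml) : List ℕ :=
  (Fml.and (bigAnd K.constraints) (Fml.neg Q)).size :: (basePos K.sig.addG 0).map Prod.snd

/-- Ranging over every member of `ks` yields the same set of axioms as ranging up to their maximum,
and so the machine need not compute a maximum. -/
def linList (ds : List ℕ) (bs : List (ℕ × ℕ)) (ks : List ℕ) : List Fml :=
  ds.flatMap fun S =>
    irreflAx S ::
      ((bs.flatMap fun b => (List.range b.2).flatMap fun i => (List.range b.2).flatMap fun j =>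
          totalAx S b.1 b.2 i j ::
            ks.flatMap fun a => (List.range (a - 1)).map fun m => transAx S b.1 b.2 i j m) ++
        ks.flatMap fun a => (List.range a).map fun m => loopAx S m)

/-- There is no fact over the relation `G`. -/
def emptyAx (G : ℕ) : Fml := .neg (.ex (zvar 0) (.ex (zvar 1) (binAtom G (zvar 0) (zvar 1))))

/-- One copy of all pairs per distinguished relation: there are no `G`-facts if there is no such
relation, and otherwise the repetitions do not change the set. -/
def gList (K : KB) : List (Fact Name) :=
  (distPos K.sig 0).flatMap fun _ => K.facts.flatMap fun f => f.args.flatMap fun a =>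
    K.facts.flatMap fun f' => f'.args.map fun b => ⟨K.sig.length, [a, b]⟩

/-- The output of the reduction. -/
def reduction (I : KB × Fml) : KB where
  sig := I.1.sig.addG
  facts := gList I.1 ++ I.1.facts
  constraints :=
    -- Quantifiers range over the mentioned elements, so facts over `G` could enlarge the domain.
    -- With no order to put the new elements into, they have to be excluded.
    (if distPos I.1.sig 0 = [] then [emptyAx I.1.sig.length] else []) ++
      (linList (distPos I.1.sig 0) (basePos I.1.sig.addG 0) (widths I.1 I.2) ++ I.1.constraints)

/-! ### The generator of the output -/

abbrev ones (n : ℕ) : List Sym := List.replicate n .one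

def Gen.seqs (l : List (Gen Stk)) : Gen Stk := l.foldr Gen.seq Gen.skip

def Gen.emits (l : List Sym) : Gen Stk := .seqs (l.map Gen.emit)

/-- Emit the content of a stack. -/
def copyG (k : Stk) : Gen Stk := .loop k .aux (.emitTop k)

/-- Emit, in unary, the number of the symbols of a stack that satisfy a condition. -/
def countG (c : Sym → Bool) (k : Stk) : Gen Stk := .loop k .aux (.ite k c (.emit .one) .skip)

/-- Emit the content of a stack up to the first end marker. -/
def tokG (k : Stk) : Gen Stk :=
  .loop k .aux (.letE .aux2 (.loop .aux .aux3 (.ite .aux (· == .fin) (.emit .one) .skip))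
    (.ite .aux2 (fun _ => true) .skip (.emitTop k)))

def natG (k : Stk) : Gen Stk := .seq (copyG k) (.emit .fin)

def zvarG (k : Stk) : Gen Stk := .seqs [.emit .zero, copyG k, .emit .fin]

def wvarG (k : Stk) : Gen Stk := .seqs [.emit .one, copyG k, .emit .fin]

def binG (x y : Gen Stk) : Gen Stk :=
  .seqs [.emit .rel, natG .s, .emit .item, x, .emit .item, y, .emit .fin]

def pathG (x y : Gen Stk) : Gen Stk :=
  -- In round `t` the stack `m` holds `m - t` ones, which are the letters of the variable `wvar (m -
  -- t - 1)`.
  .seqs [.loop .m .x (.seqs [.emit .ex, copyG .m, .emits [.fin, .and]]),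
    .emit .rel, natG .s, .emit .item, x,
    .loop .m .x (.seqs [.emit .item, wvarG .x, .emits [.fin, .rel], natG .s, .emit .item,
      wvarG .x]),
    .emit .item, y, .emit .fin]

def irreflG : Gen Stk :=
  .seq (.emits [.item, .neg, .ex, .zero, .fin]) (binG (.emits [.zero, .fin]) (.emits [.zero, .fin]))

def exZG : Gen Stk := .loop .n3 .x (.seqs [.emit .ex, zvarG .x])

def relZG : Gen Stk :=
  .seqs [.emit .rel, natG .r, .loop .n3 .x (.seqs [.emit .item, zvarG .x]), .emit .fin]

def totalG : Gen Stk :=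
  .seqs [.emits [.item, .neg], exZG, .emit .and, relZG, .emits [.neg, .or, .eq], zvarG .i,
    zvarG .j, .emit .or, binG (zvarG .i) (zvarG .j), binG (zvarG .j) (zvarG .i)]

def transG : Gen Stk :=
  .seqs [.emits [.item, .neg], exZG, .emit .and, pathG (zvarG .i) (zvarG .j), .emit .and, relZG,
    .emit .neg, binG (zvarG .i) (zvarG .j)]

def loopG : Gen Stk :=
  .seqs [.emits [.item, .neg, .ex, .zero, .fin, .and],
    pathG (.emits [.zero, .fin]) (.emits [.zero, .fin]),
    .emits [.and, .eq, .zero, .fin, .zero, .fin, .neg],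
    binG (.emits [.zero, .fin]) (.emits [.zero, .fin])]

def forWidthG (p : Gen Stk) : Gen Stk :=
  .loop .ks .jK (.ite .ks (· == .item)
    (.letE .tokK (tokG .ks) (.letE .a (countG (· == .one) .tokK) p)) .skip)

def isDecl (s : Sym) : Bool := s == .base || s == .dist

def forBaseG (p : Gen Stk) : Gen Stk :=
  .loop .tau .jR (.ite .tau (· == .base)
    (.letE .r (countG isDecl .jR) (.letE .tok (tokG .tau) (.letE .n (countG (· == .one) .tok) p)))
    .skip)

/-- The loops show their bodies only suffixes of `n` and `n2`; the bodies find the full arity in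
`n3`. -/
def pairsG (p : Gen Stk) : Gen Stk :=
  .letE .n2 (copyG .n) (.letE .n3 (copyG .n) (.loop .n .i (.loop .n2 .j p)))

def linearityG : Gen Stk :=
  .seqs [irreflG,
    forBaseG (pairsG (.seq totalG (forWidthG
      -- The prefix is empty only in the first round, so this emits `a - 1` ones.
      (.letE .a1 (.loop .a .aux (.ite .aux (fun _ => true) (.emit .one) .skip))
        (.loop .a1 .m transG))))),
    forWidthG (.loop .a .m loopG)]

def linG : Gen Stk :=
  .loop .sig .jS (.ite .sig (· == .dist) (.letE .s (countG isDecl .jS) linearityG) .skip)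

def gFactsG : Gen Stk :=
  .loop .sig .jS (.ite .sig (· == .dist)
    (.loop .names .jN (.ite .names (· == .item)
      (.loop .names2 .jN2 (.ite .names2 (· == .item)
        (.seqs [.emit .item, natG .gpos, tokG .names, tokG .names2, .emit .fin]) .skip)) .skip))
    .skip)

def emptyG : Gen Stk :=
  .seqs [.emits [.item, .neg, .ex, .zero, .fin, .ex, .zero, .one, .fin, .rel], natG .gpos,
    .emits [.item, .zero, .fin, .item, .zero, .one, .fin, .fin]]

/-- The number of symbols of a formula for which a symbol of its encoding stands. -/
def Sym.weight : Sym → ℕ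
  | .item => 1
  | .rel => 1
  | .eq => 3
  | .tru => 1
  | .fls => 1
  | .and => 1
  | .or => 1
  | .ex => 2
  | .neg => 1
  | _ => 0

def weightG (k : Stk) : Gen Stk :=
  .loop k .aux (.seqs [.ite k (fun s => 1 ≤ s.weight) (.emit .one) .skip,
    .ite k (fun s => 2 ≤ s.weight) (.emit .one) .skip,
    .ite k (fun s => 3 ≤ s.weight) (.emit .one) .skip])

def widthsG : Gen Stk :=
  -- Three symbols of `Σ ∧ ¬Q` have no counterpart in the encodings: the outer conjunction, the
  -- negation, and the `⊤` at the end of `bigAnd`. The list marker of each constraint stands for its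
  -- conjunction sign.
  .seqs [.emits [.item, .one, .one, .one], weightG .consR, weightG .inp, .emit .fin,
    forBaseG (.seqs [.emit .item, copyG .n, .emit .fin])]

/-- Since `letE` reverses, the stacks bound here and the input stacks whose names end in `R` hold
reversed words, and one more `letE` turns them round. The word emitted into `tauR` is the
declaration of a binary base relation. -/
def outputG : Gen Stk :=
  .letE .sig (copyG .sigR) <|
  .letE .tauR (.seq (copyG .sig) (.emits [.item, .base, .one, .one, .fin])) <|
  .letE .tau (copyG .tauR) <|
  .letE .names (copyG .nameR) <|
  .letE .names2 (copyG .nameR) <|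
  .letE .gpos (countG isDecl .sig) <|
  .letE .ksR widthsG <|
  .letE .ks (copyG .ksR) <|
  .letE .facts (copyG .factR) <|
  .letE .cons (copyG .consR) <|
  .seqs [copyG .tau, .emit .fin, gFactsG, copyG .facts,
    .letE .some (countG (· == .dist) .sig) (.ite .some (fun _ => true) .skip emptyG), linG,
    copyG .cons]

/-- Pushing symbol by symbol leaves a word reversed on the stack `out`; emitting the reversed output
compensates for this. -/
def mainG : Gen Stk := .letE .res outputG (copyG .res)

/-! ### The output of the generator -/

@[simp] theorem run_seqs_nil (ρ : Store Stk) : (Gen.seqs []).run ρ = [] := rfl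

@[simp] theorem run_seqs_cons (p : Gen Stk) (l : List (Gen Stk)) (ρ : Store Stk) :
    (Gen.seqs (p :: l)).run ρ = p.run ρ ++ (Gen.seqs l).run ρ := rfl

@[simp] theorem run_emit (s : Sym) (ρ : Store Stk) : (Gen.emit s).run ρ = [s] := rfl

@[simp] theorem run_seq (p q : Gen Stk) (ρ : Store Stk) :
    (Gen.seq p q).run ρ = p.run ρ ++ q.run ρ := rfl

theorem run_letE (k : Stk) (p q : Gen Stk) (ρ : Store Stk) :
    (Gen.letE k p q).run ρ = q.run (update ρ k (p.run ρ).reverse) := rfl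

@[simp] theorem run_emits (l : List Sym) (ρ : Store Stk) : (Gen.emits l).run ρ = l := by
  induction l with
  | nil => rfl
  | cons s l ih =>
    change [s] ++ (Gen.emits l).run ρ = s :: l
    rw [ih]; rfl

theorem walk_flatMap (g : Sym → List Sym) (l acc : List Sym) :
    walk (fun l _ => l.head?.toList.flatMap g) l acc = l.flatMap g := by
  induction l generalizing acc with
  | nil => rfl
  | cons s l ih => simp [walk, ih]

theorem run_loop_flatMap {k : Stk} {p : Gen Stk} {ρ : Store Stk} {g : Sym → List Sym}
    (h : ∀ l acc, p.run (update (update ρ k l) .aux acc) = l.head?.toList.flatMap g) :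
    (Gen.loop k .aux p).run ρ = (ρ k).flatMap g :=
  (walk_congr h _ _).trans (walk_flatMap g _ _)

theorem run_copyG {k : Stk} (hk : k ≠ .aux) (ρ : Store Stk) : (copyG k).run ρ = ρ k := by
  refine (run_loop_flatMap (g := fun s => [s]) fun l acc => ?_).trans (by simp)
  simp [Gen.run, hk]

theorem flatMap_ite_one (c : Sym → Bool) (l : List Sym) :
    (l.flatMap fun s => if c s then [Sym.one] else []) = ones (l.countP c) := by
  induction l with
  | nil => rfl
  | cons s l ih =>
    cases h : c s
    · simp [h, ih]
    · simp [h, ih, List.replicate_succ]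

theorem run_countG (c : Sym → Bool) {k : Stk} (hk : k ≠ .aux) (ρ : Store Stk) :
    (countG c k).run ρ = ones ((ρ k).countP c) := by
  refine (run_loop_flatMap (g := fun s => if c s then [Sym.one] else []) fun l acc => ?_).trans
    (flatMap_ite_one c _)
  cases l <;> simp [Gen.run, hk]

theorem run_weightG {k : Stk} (hk : k ≠ .aux) (ρ : Store Stk) :
    (weightG k).run ρ = ones ((ρ k).map Sym.weight).sum := by
  refine (run_loop_flatMap (g := fun s => ones s.weight) fun l acc => ?_).trans ?_
  · cases l with
    | nil => simp [Gen.run, hk]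
    | cons s l => cases s <;> simp [Gen.run, hk, Sym.weight, List.replicate_succ]
  · induction ρ k with
    | nil => rfl
    | cons s l ih => simp [ih]

/-- The part of a word up to the first end marker. -/
def takeTok : List Sym → List Sym
  | [] => []
  | s :: l => if s = .fin then [s] else s :: takeTok l

theorem run_tokG {k : Stk} (h1 : k ≠ .aux) (h2 : k ≠ .aux2) (ρ : Store Stk) :
    (tokG k).run ρ = takeTok (ρ k) := by
  have key : ∀ l acc : List Sym,
      walk (fun l acc => if Sym.fin ∈ acc then [] else l.head?.toList) l acc =
        if Sym.fin ∈ acc then [] else takeTok l := by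
    intro l
    induction l with
    | nil => intro acc; simp [walk, takeTok]
    | cons s l ih =>
      intro acc
      by_cases ha : Sym.fin ∈ acc
      · simp [walk, ih, ha]
      · by_cases hs : s = .fin
        · subst hs; simp [walk, ih, ha, takeTok]
        · simp [walk, ih, ha, takeTok, hs, Ne.symm hs]
  refine (walk_congr (fun l acc => ?_) _ _).trans (by simpa using key (ρ k) [])
  have hc : (Gen.loop .aux .aux3 (.ite .aux (· == .fin) (.emit .one) .skip)).run
      (update (update ρ k l) .aux acc) = ones (acc.countP (· == .fin)) := by
    refine (walk_congr (g' := fun l _ => l.head?.toList.flatMap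
      fun s => if s == .fin then [Sym.one] else []) (fun l acc => ?_) _ _).trans
        ((walk_flatMap _ _ _).trans ?_)
    · cases l <;> simp [Gen.run]
    · simpa using flatMap_ite_one (· == .fin) acc
  rw [run_letE, hc]
  by_cases ha : Sym.fin ∈ acc
  · have : 0 < acc.countP (· == .fin) := List.countP_pos_iff.2 ⟨_, ha, by simp⟩
    obtain ⟨c, hc⟩ := Nat.exists_eq_succ_of_ne_zero this.ne'
    simp [Gen.run, ha, hc, List.replicate_succ]
  · have : acc.countP (· == .fin) = 0 := by
      rw [List.countP_eq_zero]
      intro s hs e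
      exact ha (by simpa using (beq_iff_eq.1 e) ▸ hs)
    simp [Gen.run, ha, this, h1, h2]

theorem run_natG {k : Stk} (hk : k ≠ .aux) {n : ℕ} {ρ : Store Stk} (h : ρ k = ones n) :
    (natG k).run ρ = encNat n := by
  simp [natG, run_copyG hk, h, encNat]

theorem encName_zvar (n : ℕ) : encName (zvar n) = .zero :: (ones n ++ [.fin]) := by
  simp [encName, zvar]

theorem encName_wvar (n : ℕ) : encName (wvar n) = .one :: (ones n ++ [.fin]) := by
  simp [encName, wvar]

theorem run_zvarG {k : Stk} (hk : k ≠ .aux) {n : ℕ} {ρ : Store Stk} (h : ρ k = ones n) :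
    (zvarG k).run ρ = encName (zvar n) := by
  simp [zvarG, run_copyG hk, h, encName_zvar]

theorem run_wvarG {k : Stk} (hk : k ≠ .aux) {n : ℕ} {ρ : Store Stk} (h : ρ k = ones n) :
    (wvarG k).run ρ = encName (wvar n) := by
  simp [wvarG, run_copyG hk, h, encName_wvar]

/-! ### Encodings of the axioms -/

theorem walk_ones (g : List Sym → List Sym → List Sym) (n p : ℕ) :
    walk g (ones n) (ones p) =
      (List.range n).flatMap fun t => g (ones (n - t)) (ones (p + t)) := by
  induction n generalizing p with
  | zero => rfl
  | succ n ih =>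
    have := ih (p + 1)
    rw [List.range_succ_eq_map]
    simp only [ones, List.replicate_succ, walk, List.flatMap_cons, List.flatMap_map] at this ⊢
    rw [this]
    simp [List.replicate_succ, Nat.add_comm, Nat.add_left_comm]

theorem run_loop_ones {k k' : Stk} {p : Gen Stk} {ρ : Store Stk} {n : ℕ} (h : ρ k = ones n) :
    (Gen.loop k k' p).run ρ =
      (List.range n).flatMap fun t => p.run (update (update ρ k (ones (n - t))) k' (ones t)) := by
  simp only [Gen.run, h]
  simpa using walk_ones (fun l acc => p.run (update (update ρ k l) k' acc)) n 0

theorem encode_binAtom (S : ℕ) (x y : Name) : (binAtom S x y).encode =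
    .rel :: (encNat S ++ (.item :: (encName x ++ (.item :: (encName y ++ [.fin]))))) := by
  simp [binAtom, Fml.encode, Atom.encode, encList]

theorem run_binG {S : ℕ} {x y : Name} {p q : Gen Stk} {ρ : Store Stk} (hs : ρ .s = ones S)
    (hp : p.run ρ = encName x) (hq : q.run ρ = encName y) :
    (binG p q).run ρ = (binAtom S x y).encode := by
  simp [binG, run_natG (by simp) hs, hp, hq, encode_binAtom]

/-- In prefix notation the nested formula becomes flat: the quantifiers from the outermost variable
inwards, and then the atoms along the path, where each intermediate node ends one atom and starts
the next. Two successive loops can thus emit it. -/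
theorem encode_pathFml (S : ℕ) (x : Name) (m : ℕ) (y : Name) : (pathFml S x m y).encode =
    ((List.range m).flatMap fun t => .ex :: (ones (m - t) ++ [.fin, .and])) ++
      (.rel :: (encNat S ++ (.item :: (encName x ++
        (((List.range m).flatMap fun t => .item :: (encName (wvar t) ++ (.fin :: .rel ::
          (encNat S ++ (.item :: encName (wvar t)))))) ++
          (.item :: (encName y ++ [.fin]))))))) := by
  induction m generalizing y with
  | zero => simp [pathFml, encode_binAtom]
  | succ m ih =>
    rw [pathFml, Fml.encode, Fml.encode, ih, encode_binAtom]
    conv_rhs => rw [List.range_succ_eq_map, List.flatMap_cons, List.flatMap_map,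
      ← List.range_succ_eq_map, List.range_succ]
    simp [encName_wvar, List.replicate_succ]

theorem run_pathG {S m : ℕ} {x y : Name} {p q : Gen Stk} {ρ : Store Stk} (hs : ρ .s = ones S)
    (hm : ρ .m = ones m) (hp : p.run ρ = encName x) (hq : q.run ρ = encName y) :
    (pathG p q).run ρ = (pathFml S x m y).encode := by
  have hA : (Gen.loop .m .x (.seqs [.emit .ex, copyG .m, .emits [.fin, .and]])).run ρ =
      (List.range m).flatMap fun t => .ex :: (ones (m - t) ++ [.fin, .and]) := by
    rw [run_loop_ones hm]
    congr 1
    funext t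
    rw [run_seqs_cons, run_seqs_cons, run_copyG (by simp)]
    simp
  have hB : (Gen.loop .m .x (.seqs [.emit .item, wvarG .x, .emits [.fin, .rel], natG .s,
      .emit .item, wvarG .x])).run ρ =
      (List.range m).flatMap fun t => .item :: (encName (wvar t) ++ (.fin :: .rel ::
          (encNat S ++ (.item :: encName (wvar t))))) := by
    rw [run_loop_ones hm]
    congr 1
    funext t
    simp only [run_seqs_cons]
    rw [run_wvarG (k := .x) (n := t) (by simp) (by simp), run_natG (n := S) (by simp)
      (by simpa using hs)]
    simp
  simp only [encode_pathFml, pathG, run_seqs_cons, hA, hB, run_natG (k := .s) (by simp) hs, hp, hq]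
  simp

theorem encode_exs (xs : List Name) (φ : Fml) :
    (exs xs φ).encode = (xs.flatMap fun x => .ex :: encName x) ++ φ.encode := by
  induction xs with
  | nil => rfl
  | cons x xs ih =>
    change Sym.ex :: encName x ++ (exs xs φ).encode = _
    rw [ih]; simp

theorem run_exZG {n : ℕ} {ρ : Store Stk} (hn : ρ .n3 = ones n) :
    exZG.run ρ = (zvars n).flatMap fun x => .ex :: encName x := by
  rw [exZG, run_loop_ones hn, zvars, List.flatMap_map]
  congr 1
  funext t
  rw [run_seqs_cons, run_seqs_cons, run_zvarG (k := .x) (n := t) (by simp) (by simp)]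
  simp

theorem run_relZG {n R : ℕ} {ρ : Store Stk} (hn : ρ .n3 = ones n) (hr : ρ .r = ones R) :
    relZG.run ρ = (Fml.atom (.rel R (zvars n))).encode := by
  have h : (Gen.loop .n3 .x (.seqs [.emit .item, zvarG .x])).run ρ =
      (zvars n).flatMap fun x => .item :: encName x := by
    rw [run_loop_ones hn, zvars, List.flatMap_map]
    congr 1
    funext t
    rw [run_seqs_cons, run_seqs_cons, run_zvarG (k := .x) (n := t) (by simp) (by simp)]
    simp
  simp only [relZG, run_seqs_cons, h, run_natG (k := .r) (by simp) hr]
  simp [Fml.encode, Atom.encode, encList]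

theorem run_irreflG {S : ℕ} {ρ : Store Stk} (hs : ρ .s = ones S) :
    irreflG.run ρ = .item :: (irreflAx S).encode := by
  have h0 : (Gen.emits [.zero, .fin]).run ρ = encName (zvar 0) := by simp [encName, zvar]
  rw [irreflG, run_seq, run_binG hs h0 h0, irreflAx]
  simp [Fml.encode, encName, zvar]

theorem run_totalG {S R n i j : ℕ} {ρ : Store Stk} (hs : ρ .s = ones S) (hr : ρ .r = ones R)
    (hn : ρ .n3 = ones n) (hi : ρ .i = ones i) (hj : ρ .j = ones j) :
    totalG.run ρ = .item :: (totalAx S R n i j).encode := by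
  have hi' := run_zvarG (k := .i) (by simp) hi
  have hj' := run_zvarG (k := .j) (by simp) hj
  simp only [totalG, run_seqs_cons, run_exZG hn, run_relZG hn hr, run_binG hs hi' hj',
    run_binG hs hj' hi', hi', hj', totalAx, encode_exs, Fml.encode, Atom.encode]
  simp

theorem run_transG {S R n i j m : ℕ} {ρ : Store Stk} (hs : ρ .s = ones S) (hr : ρ .r = ones R)
    (hn : ρ .n3 = ones n) (hi : ρ .i = ones i) (hj : ρ .j = ones j) (hm : ρ .m = ones m) :
    transG.run ρ = .item :: (transAx S R n i j m).encode := by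
  have hi' := run_zvarG (k := .i) (by simp) hi
  have hj' := run_zvarG (k := .j) (by simp) hj
  simp only [transG, run_seqs_cons, run_exZG hn, run_relZG hn hr, run_binG hs hi' hj',
    run_pathG hs hm hi' hj', transAx, encode_exs, Fml.encode]
  simp

theorem run_loopG {S m : ℕ} {ρ : Store Stk} (hs : ρ .s = ones S) (hm : ρ .m = ones m) :
    loopG.run ρ = .item :: (loopAx S m).encode := by
  have h0 : (Gen.emits [.zero, .fin]).run ρ = encName (zvar 0) := by simp [encName, zvar]
  simp only [loopG, run_seqs_cons, run_binG hs h0 h0, run_pathG hs hm h0 h0, loopAx, Fml.encode,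
    Atom.encode]
  simp [encName_zvar]

/-! ### Walks along encoded lists -/

theorem encItems_cons {β : Type} (e : β → List Sym) (b : β) (l : List β) :
    encItems e (b :: l) = (.item :: e b) ++ encItems e l := rfl

theorem encItems_append {β : Type} (e : β → List Sym) (l l' : List β) :
    encItems e (l ++ l') = encItems e l ++ encItems e l' := by simp [encItems]

theorem encItems_flatMap {β γ : Type} (e : β → List Sym) (l : List γ) (f : γ → List β) :
    encItems e (l.flatMap f) = l.flatMap fun c => encItems e (f c) := by
  simp [encItems, List.flatMap_assoc]

theorem encItems_map {β γ : Type} (e : β → List Sym) (l : List γ) (f : γ → β) :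
    encItems e (l.map f) = l.flatMap fun c => .item :: e (f c) := by
  simp [encItems, List.flatMap_map]

theorem walk_skip {g : List Sym → List Sym → List Sym} {u : List Sym}
    (h : ∀ s ∈ u, ∀ l acc, g (s :: l) acc = []) (v acc : List Sym) :
    walk g (u ++ v) acc = walk g v (u.reverse ++ acc) := by
  induction u generalizing acc with
  | nil => rfl
  | cons s u ih =>
    simp only [List.cons_append, walk, h s (by simp), List.nil_append]
    rw [ih fun s' hs' => h s' (by simp [hs'])]
    simp

theorem mem_encNat {n : ℕ} {s : Sym} (h : s ∈ encNat n) : s = .one ∨ s = .fin := by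
  simp only [encNat, List.mem_append, List.mem_singleton] at h
  exact h.imp List.eq_of_mem_replicate id

theorem mem_encName {w : Name} {s : Sym} (h : s ∈ encName w) :
    s = .zero ∨ s = .one ∨ s = .fin := by
  simp only [encName, List.mem_append, List.mem_map, List.mem_singleton] at h
  rcases h with ⟨b, -, rfl⟩ | rfl
  · cases b <;> simp
  · simp

theorem countP_isDecl_decl (d : Decl) : d.encode.countP isDecl = 1 := by
  cases d with
  | base n => simp [Decl.encode, encNat, isDecl, List.countP_replicate]
  | dist => simp [Decl.encode, isDecl]

theorem countP_isDecl_encItems (σ : Sig) : (encItems Decl.encode σ).countP isDecl = σ.length := by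
  induction σ with
  | nil => rfl
  | cons d σ ih =>
    rw [encItems_cons, List.countP_append, List.countP_cons, ih, countP_isDecl_decl]
    simp [isDecl, Nat.add_comm]

/-- An encoded declaration contains exactly one of the symbols `base` and `dist`, so counting them
in the prefix gives the position of a relation in the signature. -/
theorem walk_dist {g : List Sym → List Sym → List Sym} {G : ℕ → List Sym}
    (h0 : ∀ s ≠ .dist, ∀ l acc, g (s :: l) acc = [])
    (h1 : ∀ l acc, g (.dist :: l) acc = G (acc.countP isDecl)) (σ : Sig) (acc : List Sym) :
    walk g (encItems Decl.encode σ) acc = (distPos σ (acc.countP isDecl)).flatMap G := by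
  induction σ generalizing acc with
  | nil => rfl
  | cons d σ ih =>
    cases d with
    | base n =>
      have hs : ∀ s ∈ Sym.item :: (Decl.base n).encode, ∀ l acc, g (s :: l) acc = [] := by
        intro s hs
        refine h0 s ?_
        rintro rfl
        simp only [Decl.encode, List.mem_cons, reduceCtorEq, false_or] at hs
        simpa using mem_encNat hs
      rw [encItems_cons, walk_skip hs, ih]
      simp only [List.countP_append, List.countP_reverse, List.countP_cons, countP_isDecl_decl,
        distPos]
      congr 2
      simp [isDecl, Nat.add_comm]
    | dist =>
      rw [encItems_cons]
      simp only [Decl.encode, List.cons_append, List.nil_append, walk, h1,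
        h0 .item (by simp), ih, distPos, List.flatMap_cons, List.countP_cons]
      simp [isDecl]

theorem walk_base {g : List Sym → List Sym → List Sym} {G : ℕ → ℕ → List Sym}
    (h0 : ∀ s ≠ .base, ∀ l acc, g (s :: l) acc = [])
    (h1 : ∀ n l acc, g (.base :: (encNat n ++ l)) acc = G (acc.countP isDecl) n) (σ : Sig)
    (acc : List Sym) :
    walk g (encItems Decl.encode σ) acc =
      (basePos σ (acc.countP isDecl)).flatMap fun b => G b.1 b.2 := by
  induction σ generalizing acc with
  | nil => rfl
  | cons d σ ih =>
    cases d with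
    | base n =>
      have hs : ∀ s ∈ encNat n, ∀ l acc, g (s :: l) acc = [] := by
        intro s hs
        refine h0 s ?_
        rintro rfl
        simpa using mem_encNat hs
      rw [encItems_cons]
      simp only [Decl.encode, List.cons_append, walk, h1, h0 .item (by simp), walk_skip hs, ih,
        basePos, List.flatMap_cons, List.countP_cons, List.countP_append, List.countP_reverse]
      have : (encNat n).countP isDecl = 0 := by
        simp [encNat, isDecl, List.countP_replicate]
      simp [this]
      simp [isDecl]
    | dist =>
      rw [encItems_cons]
      simp only [Decl.encode, List.cons_append, List.nil_append, walk,
        h0 .item (by simp), h0 .dist (by simp), ih, basePos, List.countP_cons]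
      simp [isDecl]

theorem walk_names {g : List Sym → List Sym → List Sym} {G : Name → List Sym}
    (h0 : ∀ s ≠ .item, ∀ l acc, g (s :: l) acc = [])
    (h1 : ∀ w l acc, g (.item :: (encName w ++ l)) acc = G w) (ws : List Name)
    (l acc : List Sym) :
    ∃ acc', walk g (encItems encName ws ++ l) acc = ws.flatMap G ++ walk g l acc' := by
  induction ws generalizing acc with
  | nil => exact ⟨acc, rfl⟩
  | cons w ws ih =>
    have hs : ∀ s ∈ encName w, ∀ l acc, g (s :: l) acc = [] := by
      intro s hs
      refine h0 s ?_
      rintro rfl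
      simpa using mem_encName hs
    obtain ⟨acc', h⟩ := ih ((encName w).reverse ++ (.item :: acc))
    refine ⟨acc', ?_⟩
    rw [encItems_cons]
    simp only [List.cons_append, List.append_assoc, walk, h1, walk_skip hs, h, List.flatMap_cons]

theorem walk_argLists {g : List Sym → List Sym → List Sym} {G : Name → List Sym}
    (h0 : ∀ s ≠ .item, ∀ l acc, g (s :: l) acc = [])
    (h1 : ∀ w l acc, g (.item :: (encName w ++ l)) acc = G w) (F : List (Fact Name))
    (acc : List Sym) :
    walk g (F.flatMap fun f => encList encName f.args) acc =
      F.flatMap fun f => f.args.flatMap G := by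
  induction F generalizing acc with
  | nil => rfl
  | cons f F ih =>
    obtain ⟨acc', h⟩ := walk_names h0 h1 f.args
      (.fin :: F.flatMap fun f => encList encName f.args) acc
    simp only [List.flatMap_cons, encList_eq, List.append_assoc, List.singleton_append] at h ih ⊢
    rw [h]
    simp only [walk, h0 .fin (by simp), ih, List.nil_append]

theorem takeTok_append {u : List Sym} (hu : .fin ∉ u) (l : List Sym) :
    takeTok (u ++ .fin :: l) = u ++ [.fin] := by
  induction u with
  | nil => simp [takeTok]
  | cons s u ih =>
    simp only [List.mem_cons, not_or] at hu
    simp [takeTok, Ne.symm hu.1, ih hu.2]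

theorem takeTok_encNat (s : Sym) (hs : s ≠ .fin) (n : ℕ) (l : List Sym) :
    takeTok (s :: (encNat n ++ l)) = s :: encNat n := by
  have := takeTok_append (u := s :: ones n) (by simp [hs.symm]) l
  simpa [encNat] using this

theorem takeTok_encName (w : Name) (l : List Sym) :
    takeTok (.item :: (encName w ++ l)) = .item :: encName w := by
  have := takeTok_append (u := .item :: w.map fun b => if b then Sym.one else Sym.zero)
    (by
      simp only [List.mem_cons, reduceCtorEq, List.mem_map, false_or, not_exists, not_and]
      intro b _
      cases b <;> simp) l
  simpa [encName] using this

theorem encName_replicate (n : ℕ) : encName (List.replicate n true) = encNat n := by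
  simp [encName, encNat]

theorem countP_one_encNat (n : ℕ) : (encNat n).countP (· == .one) = n := by
  simp [encNat, List.countP_replicate]

theorem run_ite_head (k : Stk) (c : Sym → Bool) (p q : Gen Stk) {ρ : Store Stk} {s : Sym}
    {l : List Sym} (h : ρ k = s :: l) :
    (Gen.ite k c p q).run ρ = if c s then p.run ρ else q.run ρ := by
  simp [Gen.run, h]

theorem run_skip (ρ : Store Stk) : (Gen.skip : Gen Stk).run ρ = [] := rfl

theorem run_forWidthG {p : Gen Stk} {ρ : Store Stk} {ks : List ℕ} {G : ℕ → List Sym}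
    (hks : ρ .ks = encItems encNat ks)
    (hp : ∀ a l acc tk, p.run (update (update (update (update ρ .ks l) .jK acc) .tokK tk)
      .a (ones a)) = G a) :
    (forWidthG p).run ρ = ks.flatMap G := by
  rw [forWidthG, Gen.run, hks]
  -- A unary number is encoded like a name that consists of ones, so the walk along lists of names
  -- applies.
  have hk : encItems encNat ks = encItems encName (ks.map fun n => List.replicate n true) := by
    simp [encItems, List.flatMap_map, encName_replicate]
  rw [hk]
  obtain ⟨acc', h⟩ := walk_names (G := fun w => G ((encName w).countP (· == .one)))
    (g := fun l acc => (Gen.ite Stk.ks (· == .item) (.letE .tokK (tokG .ks)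
      (.letE .a (countG (· == .one) .tokK) p)) .skip).run (update (update ρ .ks l) .jK acc))
    (fun s hs l acc => by
      rw [run_ite_head _ _ _ _ (s := s) (l := l) (by simp)]
      simp [hs, run_skip])
    (fun w l acc => by
      rw [run_ite_head _ _ _ _ (s := .item) (l := encName w ++ l) (by simp)]
      simp only [beq_self_eq_true, if_true, run_letE]
      rw [run_tokG (by simp) (by simp), run_countG _ (by simp), List.reverse_replicate, hp]
      simp [takeTok_encName])
    (ks.map fun n => List.replicate n true) [] []
  simpa [walk, List.flatMap_map, encName_replicate, countP_one_encNat] using h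

theorem run_forBaseG {p : Gen Stk} {ρ : Store Stk} {τ : Sig} {G : ℕ → ℕ → List Sym}
    (hτ : ρ .tau = encItems Decl.encode τ)
    (hp : ∀ R n l acc tk, p.run (update (update (update (update (update ρ .tau l) .jR acc)
      .r (ones R)) .tok tk) .n (ones n)) = G R n) :
    (forBaseG p).run ρ = (basePos τ 0).flatMap fun b => G b.1 b.2 := by
  rw [forBaseG, Gen.run, hτ]
  refine walk_base (G := G) (fun s hs l acc => ?_) (fun n l acc => ?_) τ []
  · rw [run_ite_head _ _ _ _ (s := s) (l := l) (by simp)]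
    simp [hs, run_skip]
  · rw [run_ite_head _ _ _ _ (s := .base) (l := encNat n ++ l) (by simp)]
    simp only [beq_self_eq_true, if_true, run_letE]
    rw [run_countG _ (by simp), run_tokG (by simp) (by simp), run_countG _ (by simp),
      List.reverse_replicate, List.reverse_replicate, hp]
    simp [takeTok_encNat, countP_one_encNat]

theorem run_pairsG {p : Gen Stk} {ρ : Store Stk} {n : ℕ} {G : ℕ → ℕ → List Sym}
    (hn : ρ .n = ones n)
    (hp : ∀ i j l l', p.run (update (update (update (update (update (update ρ .n2 (ones n))
      .n3 (ones n)) .n l) .i (ones i)) .n2 l') .j (ones j)) = G i j) :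
    (pairsG p).run ρ = (List.range n).flatMap fun i => (List.range n).flatMap fun j => G i j := by
  simp only [pairsG, run_letE]
  rw [run_copyG (by simp), run_copyG (by simp), hn]
  rw [run_loop_ones (n := n) (by simp [hn])]
  congr 1
  funext i
  rw [run_loop_ones (n := n) (by simp)]
  congr 1
  funext j
  simpa [hn] using hp i j (ones (n - i)) (ones (n - j))

theorem run_linearityG {ρ : Store Stk} {S : ℕ} {τ : Sig} {ks : List ℕ} (hs : ρ .s = ones S)
    (hτ : ρ .tau = encItems Decl.encode τ) (hks : ρ .ks = encItems encNat ks) :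
    linearityG.run ρ = encItems Fml.encode (linList [S] (basePos τ 0) ks) := by
  have h1 : (forWidthG (.loop .a .m loopG)).run ρ =
      ks.flatMap fun a => (List.range a).flatMap fun m => .item :: (loopAx S m).encode := by
    refine run_forWidthG hks fun a l acc tk => ?_
    rw [run_loop_ones (n := a) (by simp)]
    congr 1
    funext m
    exact run_loopG (by simpa using hs) (by simp)
  have h2 : (forBaseG (pairsG (.seq totalG (forWidthG
      (.letE .a1 (.loop .a .aux (.ite .aux (fun _ => true) (.emit .one) .skip))
        (.loop .a1 .m transG)))))).run ρ =
      (basePos τ 0).flatMap fun b => (List.range b.2).flatMap fun i =>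
        (List.range b.2).flatMap fun j => (.item :: (totalAx S b.1 b.2 i j).encode) ++
          ks.flatMap fun a => (List.range (a - 1)).flatMap fun m =>
            .item :: (transAx S b.1 b.2 i j m).encode := by
    refine run_forBaseG (G := fun R n => (List.range n).flatMap fun i =>
        (List.range n).flatMap fun j => (.item :: (totalAx S R n i j).encode) ++
          ks.flatMap fun a => (List.range (a - 1)).flatMap fun m =>
            .item :: (transAx S R n i j m).encode) hτ fun R n l acc tk => ?_
    refine run_pairsG (by simp) fun i j l l' => ?_
    rw [run_seq, run_totalG (S := S) (R := R) (n := n) (i := i) (j := j) (by simpa using hs)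
      (by simp) (by simp) (by simp) (by simp)]
    congr 1
    refine run_forWidthG (by simpa using hks) fun a l acc tk => ?_
    have ha : ∀ ρ' : Store Stk, ρ' .a = ones a →
        (Gen.loop .a .aux (.ite .aux (fun _ => true) (.emit .one) .skip)).run ρ' =
          ones (a - 1) := by
      intro ρ' h
      rw [run_loop_ones h]
      cases a with
      | zero => rfl
      | succ a =>
        rw [List.range_succ_eq_map, List.flatMap_cons, List.flatMap_map]
        simp [Gen.run, List.replicate_succ, List.flatMap_def]
    rw [run_letE, ha _ (by simp), List.reverse_replicate, run_loop_ones (n := a - 1) (by simp)]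
    congr 1
    funext m
    exact run_transG (by simpa using hs) (by simp) (by simp) (by simp) (by simp) (by simp)
  simp only [linearityG, run_seqs_cons, run_seqs_nil, run_irreflG hs, h1, h2, linList,
    List.flatMap_cons, List.flatMap_nil, List.append_nil, encItems_cons, encItems_append,
    encItems_flatMap, encItems_map]

theorem run_loop_dist {p : Gen Stk} {ρ : Store Stk} {σ : Sig} {G : ℕ → List Sym}
    (hσ : ρ .sig = encItems Decl.encode σ)
    (hp : ∀ l acc, p.run (update (update ρ .sig l) .jS acc) = G (acc.countP isDecl)) :
    (Gen.loop .sig .jS (.ite .sig (· == .dist) p .skip)).run ρ = (distPos σ 0).flatMap G := by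
  rw [Gen.run, hσ]
  refine walk_dist (G := G) (fun s hs l acc => ?_) (fun l acc => ?_) σ []
  · rw [run_ite_head _ _ _ _ (s := s) (l := l) (by simp)]
    simp [hs, run_skip]
  · rw [run_ite_head _ _ _ _ (s := .dist) (l := l) (by simp)]
    simp [hp]

theorem run_linG {ρ : Store Stk} {σ τ : Sig} {ks : List ℕ}
    (hσ : ρ .sig = encItems Decl.encode σ) (hτ : ρ .tau = encItems Decl.encode τ)
    (hks : ρ .ks = encItems encNat ks) :
    linG.run ρ = encItems Fml.encode (linList (distPos σ 0) (basePos τ 0) ks) := by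
  have : linG.run ρ = (distPos σ 0).flatMap fun S =>
      encItems Fml.encode (linList [S] (basePos τ 0) ks) := by
    refine run_loop_dist hσ fun l acc => ?_
    rw [run_letE, run_countG _ (by simp), List.reverse_replicate]
    exact run_linearityG (by simp) (by simpa using hτ) (by simpa using hks)
  rw [this, ← encItems_flatMap]
  simp [linList]

theorem run_loop_args {k k' : Stk} (hk : k ≠ k') {p : Gen Stk} {ρ : Store Stk}
    {F : List (Fact Name)} {G : Name → List Sym}
    (hF : ρ k = F.flatMap fun f => encList encName f.args)
    (hp : ∀ w l acc, p.run (update (update ρ k (.item :: (encName w ++ l))) k' acc) = G w) :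
    (Gen.loop k k' (.ite k (· == .item) p .skip)).run ρ =
      F.flatMap fun f => f.args.flatMap G := by
  rw [Gen.run, hF]
  refine walk_argLists (G := G) (fun s hs l acc => ?_) (fun w l acc => ?_) F []
  · rw [run_ite_head _ _ _ _ (s := s) (l := l) (by simp [hk])]
    simp [hs, run_skip]
  · rw [run_ite_head _ _ _ _ (s := .item) (l := encName w ++ l) (by simp [hk])]
    simp [hp]

theorem run_gFactsG {ρ : Store Stk} {K : KB} (hσ : ρ .sig = encItems Decl.encode K.sig)
    (h1 : ρ .names = K.facts.flatMap fun f => encList encName f.args)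
    (h2 : ρ .names2 = K.facts.flatMap fun f => encList encName f.args)
    (hg : ρ .gpos = ones K.sig.length) :
    gFactsG.run ρ = encItems encFact (gList K) := by
  simp only [gList, encItems_flatMap, encItems_map]
  refine run_loop_dist (G := fun _ => _) hσ fun l acc => ?_
  refine run_loop_args (by simp) (by simpa using h1) fun a l acc => ?_
  refine run_loop_args (by simp) (by simpa using h2) fun b l acc => ?_
  simp only [run_seqs_cons]
  rw [run_natG (n := K.sig.length) (by simp) (by simpa using hg), run_tokG (by simp) (by simp),
    run_tokG (by simp) (by simp)]
  simp [takeTok_encName, encFact, encList]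

theorem run_emptyG {ρ : Store Stk} {G : ℕ} (hg : ρ .gpos = ones G) :
    emptyG.run ρ = .item :: (emptyAx G).encode := by
  simp only [emptyG, run_seqs_cons, run_natG (k := .gpos) (by simp) hg]
  simp [emptyAx, Fml.encode, encode_binAtom, encName_zvar]

/-! ### Sizes read off the encodings -/

theorem sum_weight_encNat (n : ℕ) : ((encNat n).map Sym.weight).sum = 0 := by
  simp [encNat, Sym.weight]

theorem sum_weight_encName (w : Name) : ((encName w).map Sym.weight).sum = 0 := by
  induction w with
  | nil => rfl
  | cons b w ih => cases b <;> simpa [encName, Sym.weight] using ih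

theorem sum_weight_encItems {β : Type} (e : β → List Sym) (l : List β) :
    ((encItems e l).map Sym.weight).sum = (l.map fun b => 1 + ((e b).map Sym.weight).sum).sum := by
  induction l with
  | nil => rfl
  | cons b l ih =>
    rw [encItems_cons]
    simp only [List.cons_append, List.map_cons, List.map_append, List.sum_cons, List.sum_append,
      ih, Sym.weight]
    omega

theorem sum_weight_encList {β : Type} (e : β → List Sym) (l : List β) :
    ((encList e l).map Sym.weight).sum = (l.map fun b => 1 + ((e b).map Sym.weight).sum).sum := by
  rw [encList_eq]
  simp [sum_weight_encItems, Sym.weight]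

theorem sum_weight_encode (φ : Fml) : (φ.encode.map Sym.weight).sum = φ.size := by
  induction φ with
  | tru => rfl
  | fls => rfl
  | atom A =>
    cases A with
    | rel R xs =>
      simp [Fml.encode, Atom.encode, Fml.size, Atom.size, sum_weight_encNat, sum_weight_encList,
        sum_weight_encName, Sym.weight]
    | eq x y =>
      simp [Fml.encode, Atom.encode, Fml.size, Atom.size, sum_weight_encName, Sym.weight]
  | and φ ψ ih1 ih2 => simp [Fml.encode, Fml.size, ih1, ih2, Sym.weight]; omega
  | or φ ψ ih1 ih2 => simp [Fml.encode, Fml.size, ih1, ih2, Sym.weight]; omega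
  | ex x φ ih => simp [Fml.encode, Fml.size, ih, sum_weight_encName, Sym.weight]
  | neg φ ih => simp [Fml.encode, Fml.size, ih, Sym.weight]

theorem size_bigAnd (Φ : List Fml) : (bigAnd Φ).size = 1 + (Φ.map fun φ => 1 + φ.size).sum := by
  induction Φ with
  | nil => rfl
  | cons φ Φ ih =>
    change φ.size + 1 + (bigAnd Φ).size = _
    rw [ih]
    simp
    omega

theorem run_widthsG {ρ : Store Stk} {K : KB} {Q : Fml}
    (hτ : ρ .tau = encItems Decl.encode K.sig.addG) (hQ : ρ .inp = Q.encode)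
    (hC : ρ .consR = (encList Fml.encode K.constraints).reverse) :
    widthsG.run ρ = encItems encNat (widths K Q) := by
  have h1 : (forBaseG (.seqs [.emit .item, copyG .n, .emit .fin])).run ρ =
      (basePos K.sig.addG 0).flatMap fun b => .item :: encNat b.2 := by
    refine run_forBaseG (G := fun _ n => .item :: encNat n) hτ fun R n l acc tk => ?_
    rw [run_seqs_cons, run_seqs_cons, run_copyG (by simp)]
    simp [encNat]
  have h2 : (Fml.and (bigAnd K.constraints) (Fml.neg Q)).size =
      3 + (((encList Fml.encode K.constraints).map Sym.weight).sum + Q.size) := by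
    simp only [Fml.size, size_bigAnd, sum_weight_encList, sum_weight_encode]
    omega
  simp only [widthsG, run_seqs_cons, h1, run_weightG (k := .consR) (by simp),
    run_weightG (k := .inp) (by simp), hC, hQ, sum_weight_encode, widths, encItems_cons,
    encItems_map, h2, List.map_reverse, List.sum_reverse]
  rw [encNat, List.replicate_add, List.replicate_add]
  simp [List.replicate_succ, - List.replicate_append_replicate]

theorem distPos_eq_nil {σ : Sig} {p : ℕ} :
    distPos σ p = [] ↔ (encItems Decl.encode σ).countP (· == .dist) = 0 := by
  induction σ generalizing p with
  | nil => simp [distPos, encItems]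
  | cons d σ ih =>
    rw [encItems_cons, List.countP_append]
    cases d with
    | base n => simp [distPos, ih (p := p + 1), Decl.encode, encNat, List.countP_replicate]
    | dist => simp [distPos, Decl.encode]

theorem run_outputG (K : KB) (Q : Fml) :
    outputG.run (storeOf Q.encode [] (encItems Decl.encode K.sig).reverse
      (encList encFact K.facts).reverse
      (K.facts.flatMap fun f => encList encName f.args).reverse
      (encList Fml.encode K.constraints).reverse) = (reduction (K, Q)).encode := by
  rw [outputG]
  simp only [run_letE, run_copyG (k := .sigR) (by simp), run_copyG (k := .sig) (by simp),
    run_copyG (k := .tauR) (by simp), run_copyG (k := .nameR) (by simp),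
    run_copyG (k := .ksR) (by simp), run_copyG (k := .factR) (by simp),
    run_copyG (k := .consR) (by simp), run_seq, run_emits]
  have hτ : encItems Decl.encode K.sig.addG =
      encItems Decl.encode K.sig ++ [.item, .base, .one, .one, .fin] := by
    rw [Sig.addG, encItems_append]; rfl
  rw [run_countG _ (by simp), run_widthsG (K := K) (Q := Q) (by simp [storeOf, hτ])
    (by simp [storeOf]) (by simp [storeOf])]
  simp only [run_seqs_cons, run_letE, run_seqs_nil]
  rw [run_copyG (by simp), run_copyG (by simp), run_copyG (by simp), run_countG _ (by simp),
    run_gFactsG (K := K) (by simp [storeOf]) (by simp [storeOf]) (by simp [storeOf])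
      (by simp [storeOf, countP_isDecl_encItems]),
    run_linG (σ := K.sig) (τ := K.sig.addG) (ks := widths K Q) (by simp [storeOf])
      (by simp [storeOf, hτ]) (by simp [storeOf])]
  have he : (Gen.ite .some (fun _ => true) .skip emptyG).run = fun ρ : Store Stk =>
      if ρ .some = [] then emptyG.run ρ else [] := by
    funext ρ
    cases h : ρ .some <;> simp [Gen.run, h]
  rw [he]
  simp only [run_emit]
  rw [run_emptyG (G := K.sig.length) (by simp [storeOf, countP_isDecl_encItems])]
  simp only [reduction, KB.encode, encList_eq, encItems_append]
  by_cases hd : distPos K.sig 0 = []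
  · have := distPos_eq_nil.1 hd
    simp [storeOf, hτ, hd, this, encItems_cons]
    simp [encItems]
  · have := mt distPos_eq_nil.2 hd
    simp [storeOf, hτ, hd, this]
    simp [encItems]

/-! ### The whole program and its running time -/

theorem wf_mainG : mainG.WF {.inp, .sigR, .factR, .nameR, .consR}
    {.inp, .sigR, .factR, .nameR, .consR, .out} := by
  simp [mainG, outputG, copyG, countG, tokG, widthsG, weightG, forBaseG, Gen.seqs, Gen.emits,
    natG, Gen.WF, gFactsG, emptyG, linG, linearityG, pairsG, forWidthG, loopG, transG, totalG,
    relZG, exZG, irreflG, pathG, binG, wvarG, zvarG]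

/-- The whole program. -/
def mainProg : Prog Stk :=
  .seq readInput (.seq (mainG.prog .out) (.seq (.clear .inp) (.seq (.clear .sigR)
    (.seq (.clear .factR) (.seq (.clear .nameR) (.clear .consR))))))

theorem length_argLists_le (F : List (Fact Name)) :
    (F.flatMap fun f => encList encName f.args).length ≤ (encList encFact F).length := by
  rw [encList_eq]
  induction F with
  | nil => simp
  | cons f F ih =>
    rw [encItems_cons]
    simp only [List.flatMap_cons, List.length_append, encFact, List.cons_append,
      List.length_cons, List.length_nil] at ih ⊢
    omega

theorem polyTime_reduction :
    Nonempty (Turing.TM2ComputableInPolyTime encInput KB.encode reduction) := by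
  refine Prog.polyTime .inp .out mainProg encInput KB.encode reduction
    -- Reading takes at most `60 N + 60` steps; the rest of the linear term covers clearing the five
    -- input stacks.
    (mainG.time + 100 * .X + 100) ?_
  rintro ⟨K, Q⟩
  set N := (encInput (K, Q)).length with hN
  set ρ := storeOf Q.encode [] (encItems Decl.encode K.sig).reverse
      (encList encFact K.facts).reverse
      (K.facts.flatMap fun f => encList encName f.args).reverse
      (encList Fml.encode K.constraints).reverse with hρ
  have hlen : (encItems Decl.encode K.sig).length + (encList encFact K.facts).length +
      (encList Fml.encode K.constraints).length + Q.encode.length ≤ N := by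
    simp only [hN, encInput, KB.encode, List.length_append, encList_eq]
    omega
  have hnames := length_argLists_le K.facts
  obtain ⟨t, ht, e⟩ := Gen.exec wf_mainG (by simp) (o := .out) (by simp) (by simp) (ρ := ρ)
    (N := N) (fun k hk => by cases k <;> simp [hρ, storeOf] at hk ⊢)
    (fun k hk => by
      simp only [Finset.mem_insert, Finset.mem_singleton] at hk
      rcases hk with rfl | rfl | rfl | rfl | rfl <;> simp only [hρ, storeOf, List.length_reverse]
        <;> omega)
  have hrun : mainG.run ρ = (reduction (K, Q)).encode.reverse := by
    rw [mainG, run_letE, run_copyG (by simp), Function.update_self, run_outputG]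
  rw [hrun, List.reverse_reverse] at e
  obtain ⟨t', ht', e'⟩ := (runs_readInput K Q).seq ((e.runs rfl).seq
    (((Exec.clear .inp _).runs rfl).seq (((Exec.clear .sigR _).runs rfl).seq
      (((Exec.clear .factR _).runs rfl).seq (((Exec.clear .nameR _).runs rfl).seq
        ((Exec.clear .consR _).runs rfl))))))
  refine ⟨t', ht'.trans ?_, e'.of_eq ?_ rfl⟩
  · simp [hρ, storeOf, ← hN] at hlen hnames ⊢
    omega
  · funext k
    cases k <;> simp [hρ, storeOf]

/-! ### Formulas depend on their free variables only -/

theorem Fml.sat_congr {α : Type} {F : Set (Fact α)} {φ : Fml} {v v' : Name → α}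
    (h : ∀ x ∈ φ.fv, v x = v' x) : φ.Sat F v ↔ φ.Sat F v' := by
  induction φ generalizing v v' with
  | tru => rfl
  | fls => rfl
  | atom a =>
    cases a with
    | rel R xs =>
      simp only [Fml.Sat, Atom.Sat]
      rw [List.map_congr_left fun x hx => h x (by simpa [Fml.fv, Atom.vars] using hx)]
    | eq x y =>
      simp only [Fml.Sat, Atom.Sat]
      rw [h x (by simp [Fml.fv, Atom.vars]), h y (by simp [Fml.fv, Atom.vars])]
  | and φ ψ ih1 ih2 =>
    simp only [Fml.fv, Finset.mem_union] at h
    simp only [Fml.Sat, ih1 fun x hx => h x (.inl hx), ih2 fun x hx => h x (.inr hx)]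
  | or φ ψ ih1 ih2 =>
    simp only [Fml.fv, Finset.mem_union] at h
    simp only [Fml.Sat, ih1 fun x hx => h x (.inl hx), ih2 fun x hx => h x (.inr hx)]
  | ex x φ ih =>
    simp only [Fml.Sat]
    refine exists_congr fun a => and_congr_right fun _ => ih fun y hy => ?_
    by_cases hyx : y = x
    · subst hyx; simp
    · simpa [hyx] using h y (by simp [Fml.fv, hyx, hy])
  | neg φ ih => simp only [Fml.Sat, ih h]

/-- The number of quantifiers. -/
def Fml.exCount : Fml → ℕ
  | .tru => 0
  | .fls => 0
  | .atom _ => 0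
  | .and φ ψ => φ.exCount + ψ.exCount
  | .or φ ψ => φ.exCount + ψ.exCount
  | .ex _ φ => 1 + φ.exCount
  | .neg φ => φ.exCount

/-- The left side bounds the size of a bag with the values of the free variables and one witness per
quantifier. Hence bags of `k` elements suffice for formulas of size at most `k`. -/
theorem Fml.card_fv_add_exCount_le (φ : Fml) : φ.fv.card + φ.exCount ≤ φ.size := by
  induction φ with
  | tru => simp [Fml.fv, Fml.exCount, Fml.size]
  | fls => simp [Fml.fv, Fml.exCount, Fml.size]
  | atom a =>
    cases a with
    | rel R xs =>
      have := List.toFinset_card_le xs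
      simp [Fml.fv, Fml.exCount, Fml.size, Atom.vars, Atom.size]
      omega
    | eq x y =>
      have := Finset.card_le_two (a := x) (b := y)
      simp [Fml.fv, Fml.exCount, Fml.size, Atom.vars, Atom.size]
      omega
  | and φ ψ ih1 ih2 =>
    have := Finset.card_union_le φ.fv ψ.fv
    simp only [Fml.fv, Fml.exCount, Fml.size]
    omega
  | or φ ψ ih1 ih2 =>
    have := Finset.card_union_le φ.fv ψ.fv
    simp only [Fml.fv, Fml.exCount, Fml.size]
    omega
  | ex x φ ih =>
    have := Finset.card_erase_le (s := φ.fv) (a := x)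
    simp only [Fml.fv, Fml.exCount, Fml.size]
    omega
  | neg φ ih =>
    simp only [Fml.fv, Fml.exCount, Fml.size]
    omega

/-! ### Unravelling -/

section Unravel

variable {α : Type}

/-- Two elements occur together in a fact over one of the relations `B`. -/
def Guarded (F : Set (Fact α)) (B : ℕ → Prop) (a b : α) : Prop :=
  ∃ f ∈ F, B f.rel ∧ a ∈ f.args ∧ b ∈ f.args

/-- A node of the unravelling is a path from the root; a step consists of the new bag and of the
elements that it shares with the previous bag. -/
abbrev Node (α : Type) := List (Finset α × Finset α)

def Node.bag (P : Set α) : Node α → Set α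
  | [] => P
  | (X, _) :: _ => X

/-- Bags have at most `k` elements, and the elements shared with the previous bag are guarded. -/
def Node.Valid (F : Set (Fact α)) (B : ℕ → Prop) (P : Set α) (k : ℕ) : Node α → Prop
  | [] => True
  | (X, Y) :: w => Node.Valid F B P k w ∧ X.card ≤ k ∧ (∀ a ∈ Y, a ∈ Node.bag P w) ∧
      ∀ a ∈ Y, ∀ b ∈ Y, a = b ∨ Guarded F B a b

open scoped Classical in
/-- The copy of an element in the bag of a node: the node where it was introduced, and itself. -/
noncomputable def Node.copy : Node α → α → Node α × α
  | [], a => ([], a)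
  | (X, Y) :: w, a => if a ∈ Y then Node.copy w a else ((X, Y) :: w, a)

/-- The unravelling of `F`, where the bag of the root is `P`. -/
def unravel (F : Set (Fact α)) (B : ℕ → Prop) (P : Set α) (k : ℕ) : Set (Fact (Node α × α)) :=
  {g | ∃ w, Node.Valid F B P k w ∧ ∃ f ∈ F, (∀ a ∈ f.args, a ∈ w.bag P) ∧ g = f.map w.copy}

@[simp] theorem Node.copy_snd (w : Node α) (a : α) : (w.copy a).2 = a := by
  induction w with
  | nil => rfl
  | cons p w ih =>
    simp only [Node.copy]
    split
    · exact ih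
    · rfl

theorem Node.copy_cons_of_mem {X Y : Finset α} {w : Node α} {a : α} (h : a ∈ Y) :
    Node.copy ((X, Y) :: w) a = w.copy a := by simp [Node.copy, h]

theorem Node.copy_cons_of_notMem {X Y : Finset α} {w : Node α} {a : α} (h : a ∉ Y) :
    Node.copy ((X, Y) :: w) a = ((X, Y) :: w, a) := by simp [Node.copy, h]

theorem Node.length_copy_le (w : Node α) (a : α) : (w.copy a).1.length ≤ w.length := by
  induction w with
  | nil => simp [Node.copy]
  | cons p w ih =>
    simp only [Node.copy]
    split
    · simp only [List.length_cons]; omega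
    · rfl

variable {F : Set (Fact α)} {B : ℕ → Prop} {P : Set α} {k : ℕ}

theorem map_snd_mem_of_mem_unravel {g : Fact (Node α × α)} (h : g ∈ unravel F B P k) :
    g.map Prod.snd ∈ F := by
  obtain ⟨w, -, f, hf, -, rfl⟩ := h
  have : (f.map w.copy).map Prod.snd = f := by
    ext1
    · rfl
    · simp [Fact.map, Function.comp_def]
  rwa [this]

theorem exists_copy_of_mem_elems {p : Node α × α} (h : p ∈ elems (unravel F B P k)) :
    ∃ w, Node.Valid F B P k w ∧ ∃ a ∈ elems F, a ∈ w.bag P ∧ p = w.copy a := by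
  obtain ⟨g, ⟨w, hw, f, hf, hb, rfl⟩, hp⟩ := h
  obtain ⟨a, ha, rfl⟩ := List.mem_map.1 hp
  exact ⟨w, hw, a, ⟨f, hf, ha⟩, hb a ha, rfl⟩

theorem snd_mem_elems {p : Node α × α} (h : p ∈ elems (unravel F B P k)) : p.2 ∈ elems F := by
  obtain ⟨w, -, a, ha, -, rfl⟩ := exists_copy_of_mem_elems h
  simpa using ha

/-- No fact on `a` need fit into the bag of `w`. But a child bag formed by the arguments of such a
fact may share just `a` with `w`, and there `a` has the same copy. -/
theorem copy_mem_elems (hk : ∀ f ∈ F, f.args.length ≤ k) {w : Node α}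
    (hw : Node.Valid F B P k w) {a : α} (ha : a ∈ w.bag P) (haF : a ∈ elems F) :
    w.copy a ∈ elems (unravel F B P k) := by
  classical
  obtain ⟨f, hf, hfa⟩ := haF
  refine ⟨f.map (Node.copy ((f.args.toFinset, {a}) :: w)),
    ⟨(f.args.toFinset, {a}) :: w, ⟨hw, ?_, ?_, ?_⟩, f, hf, ?_, rfl⟩, ?_⟩
  · exact (List.toFinset_card_le _).trans (hk f hf)
  · simpa using ha
  · simp
  · intro b hb
    simpa [Node.bag] using hb
  · exact List.mem_map.2 ⟨a, hfa, Node.copy_cons_of_mem (by simp)⟩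

theorem sat_of_mem_guards {α : Type} {F : Set (Fact α)} {σ : Sig} {φ : Fml} {v : Name → α}
    (h : φ.Sat F v) : ∀ A ∈ φ.guards σ, A.IsBaseGuard σ ∧ A.Sat F v := by
  induction φ with
  | atom a =>
    rintro A ⟨rfl, hA⟩
    exact ⟨hA, h⟩
  | and φ ψ ih1 ih2 =>
    rintro A (hA | hA)
    · exact ih1 h.1 A hA
    · exact ih2 h.2 A hA
  | _ => intro A hA; exact hA.elim

/-- Guarded-negation formulas cannot distinguish a set of facts from its unravelling. -/
theorem sat_unravel {σ : Sig} (hB : ∀ R n, σ[R]? = some (Decl.base n) → B R)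
    (hk : ∀ f ∈ F, f.args.length ≤ k) (φ : Fml) (hφ : φ.size ≤ k) (Γ : Set Atom)
    (hΓ : φ.BaseGNFIn σ Γ) :
    (∀ v : Name → Node α × α, (∀ x ∈ φ.fv, v x ∈ elems (unravel F B P k)) →
      (∀ A ∈ Γ, A.IsBaseGuard σ ∧ A.Sat (unravel F B P k) v) →
      φ.Sat (unravel F B P k) v → φ.Sat F (fun x => (v x).2)) ∧
    ∀ u : Name → α, (∀ x ∈ φ.fv, u x ∈ elems F) → φ.Sat F u →
      ∃ W : Finset α, W.card ≤ φ.exCount ∧ ∀ w, Node.Valid F B P k w →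
        (∀ x ∈ φ.fv, u x ∈ w.bag P) → (∀ a ∈ W, a ∈ w.bag P) →
        ∀ v, (∀ x ∈ φ.fv, v x = w.copy (u x)) → φ.Sat (unravel F B P k) v := by
  classical
  -- The two directions are asymmetric. Satisfaction goes down for every valuation that satisfies
  -- the guards, even if its values are spread over several bags. It goes up only at nodes whose bag
  -- contains the values together with a set `W` of witnesses.
  induction φ generalizing Γ with
  | tru => exact ⟨fun _ _ _ _ => trivial, fun u _ _ => ⟨∅, by simp, fun _ _ _ _ _ _ => trivial⟩⟩
  | fls => exact ⟨fun _ _ _ h => h.elim, fun u _ h => h.elim⟩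
  | atom a =>
    cases a with
    | rel R xs =>
      refine ⟨fun v _ _ h => ?_, fun u _ h => ⟨∅, by simp, fun w hw hx _ v hv => ?_⟩⟩
      · simpa [Fact.map, Fml.Sat, Atom.Sat, Function.comp_def] using map_snd_mem_of_mem_unravel h
      · simp only [Fml.fv, Atom.vars, List.mem_toFinset] at hx hv
        refine ⟨w, hw, _, h, ?_, ?_⟩
        · simpa using hx
        · simpa [Fact.map] using hv
    | eq x y =>
      refine ⟨fun v _ _ h => ?_, fun u _ h => ⟨∅, by simp, fun w hw hx _ v hv => ?_⟩⟩
      · exact congrArg Prod.snd h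
      · simp only [Fml.Sat, Atom.Sat] at h ⊢
        rw [hv x (by simp [Fml.fv, Atom.vars]), hv y (by simp [Fml.fv, Atom.vars]), h]
  | and φ ψ ih1 ih2 =>
    simp only [Fml.size] at hφ
    obtain ⟨A1, B1⟩ := ih1 (by omega) _ hΓ.1
    obtain ⟨A2, B2⟩ := ih2 (by omega) _ hΓ.2
    simp only [Fml.fv, Finset.mem_union]
    refine ⟨fun v hv hg h => ⟨?_, ?_⟩, fun u hu h => ?_⟩
    · refine A1 v (fun x hx => hv x (.inl hx)) ?_ h.1
      rintro A (hA | hA)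
      · exact hg A hA
      · exact sat_of_mem_guards h.2 A hA
    · refine A2 v (fun x hx => hv x (.inr hx)) ?_ h.2
      rintro A (hA | hA)
      · exact hg A hA
      · exact sat_of_mem_guards h.1 A hA
    · obtain ⟨W1, c1, h1⟩ := B1 u (fun x hx => hu x (.inl hx)) h.1
      obtain ⟨W2, c2, h2⟩ := B2 u (fun x hx => hu x (.inr hx)) h.2
      refine ⟨W1 ∪ W2, ?_, fun w hw hx hW v hv => ⟨?_, ?_⟩⟩
      · have := Finset.card_union_le W1 W2
        simp only [Fml.exCount]; omega
      · exact h1 w hw (fun x h => hx x (.inl h)) (fun a h => hW a (by simp [h])) v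
          fun x h => hv x (.inl h)
      · exact h2 w hw (fun x h => hx x (.inr h)) (fun a h => hW a (by simp [h])) v
          fun x h => hv x (.inr h)
  | or φ ψ ih1 ih2 =>
    simp only [Fml.size] at hφ
    obtain ⟨A1, B1⟩ := ih1 (by omega) _ hΓ.1
    obtain ⟨A2, B2⟩ := ih2 (by omega) _ hΓ.2
    simp only [Fml.fv, Finset.mem_union]
    refine ⟨fun v hv hg h => ?_, fun u hu h => ?_⟩
    · rcases h with h | h
      · exact .inl (A1 v (fun x hx => hv x (.inl hx)) (by simp) h)
      · exact .inr (A2 v (fun x hx => hv x (.inr hx)) (by simp) h)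
    · rcases h with h | h
      · obtain ⟨W1, c1, h1⟩ := B1 u (fun x hx => hu x (.inl hx)) h
        refine ⟨W1, by simp only [Fml.exCount]; omega, fun w hw hx hW v hv => .inl ?_⟩
        exact h1 w hw (fun x h => hx x (.inl h)) hW v fun x h => hv x (.inl h)
      · obtain ⟨W1, c1, h1⟩ := B2 u (fun x hx => hu x (.inr hx)) h
        refine ⟨W1, by simp only [Fml.exCount]; omega, fun w hw hx hW v hv => .inr ?_⟩
        exact h1 w hw (fun x h => hx x (.inr h)) hW v fun x h => hv x (.inr h)
  | ex x φ ih =>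
    simp only [Fml.size] at hφ
    obtain ⟨A1, B1⟩ := ih (by omega) _ hΓ
    simp only [Fml.fv, Finset.mem_erase]
    refine ⟨fun v hv hg h => ?_, fun u hu h => ?_⟩
    · obtain ⟨c, hc, h⟩ := h
      refine ⟨c.2, snd_mem_elems hc, ?_⟩
      have := A1 _ (fun y hy => ?_) (by simp) h
      · refine (Fml.sat_congr fun y _ => ?_).1 this
        by_cases hyx : y = x
        · subst hyx; simp
        · simp [hyx]
      · by_cases hyx : y = x
        · subst hyx; simpa using hc
        · simpa [hyx] using hv y ⟨hyx, hy⟩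
    · obtain ⟨a, ha, h⟩ := h
      obtain ⟨W, c, h1⟩ := B1 _ (fun y hy => by
        by_cases hyx : y = x
        · subst hyx; simpa using ha
        · simpa [hyx] using hu y ⟨hyx, hy⟩) h
      refine ⟨insert a W, ?_, fun w hw hx hW v hv => ?_⟩
      · have := Finset.card_insert_le a W
        simp only [Fml.exCount]; omega
      · refine ⟨w.copy a, copy_mem_elems hk hw (hW a (by simp)) ha, ?_⟩
        refine h1 w hw (fun y hy => ?_) (fun b hb => hW b (by simp [hb])) _ fun y hy => ?_
        · by_cases hyx : y = x
          · subst hyx; simpa using hW a (by simp)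
          · simpa [hyx] using hx y ⟨hyx, hy⟩
        · by_cases hyx : y = x
          · subst hyx; simp
          · simpa [hyx] using hv y ⟨hyx, hy⟩
  | neg φ ih =>
    simp only [Fml.size] at hφ
    obtain ⟨A1, B1⟩ := ih (by omega) _ hΓ.2
    simp only [Fml.fv]
    refine ⟨fun v hv hg h hF => h ?_, fun u hu h => ⟨∅, by simp, fun w hw hx _ v hv hF => h ?_⟩⟩
    · obtain ⟨W, hW, h1⟩ := B1 _ (fun x hx => snd_mem_elems (hv x hx)) hF
      -- Here the guard is used: it puts all values of the free variables into one bag and makes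
      -- them pairwise guarded. A guard `x = x` leaves a single value, and a sentence leaves none.
      have hw : ∃ w, Node.Valid F B P k w ∧ ∀ x ∈ φ.fv, v x = w.copy (v x).2 ∧
          (v x).2 ∈ w.bag P ∧ ∀ y ∈ φ.fv, (v x).2 = (v y).2 ∨ Guarded F B (v x).2 (v y).2 := by
        rcases hΓ.1 with h0 | ⟨A, hA, hsub⟩
        · exact ⟨[], trivial, by simp [h0]⟩
        · obtain ⟨hbase, hsat⟩ := hg A hA
          cases A with
          | rel R xs =>
            obtain ⟨n, hn⟩ := hbase
            obtain ⟨w, hw, f, hf, hb, he⟩ := hsat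
            have hrel : R = f.rel := congrArg Fact.rel he
            have hargs : xs.map v = f.args.map w.copy := congrArg Fact.args he
            have hmem : ∀ x ∈ φ.fv, (v x).2 ∈ f.args ∧ v x = w.copy (v x).2 := by
              intro x hx
              have h1 : x ∈ xs := by simpa [Atom.vars] using hsub hx
              have h2 : v x ∈ f.args.map w.copy := hargs ▸ List.mem_map_of_mem h1
              obtain ⟨a, ha, he⟩ := List.mem_map.1 h2
              rw [← he]
              simpa using ha
            exact ⟨w, hw, fun x hx => ⟨(hmem x hx).2, hb _ (hmem x hx).1, fun y hy =>
              .inr ⟨f, hf, hrel ▸ hB R n hn, (hmem x hx).1, (hmem y hy).1⟩⟩⟩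
          | eq x y =>
            obtain rfl : x = y := hbase
            have hx : ∀ y ∈ φ.fv, y = x := fun y hy => by simpa [Atom.vars] using hsub hy
            by_cases hne : x ∈ φ.fv
            · obtain ⟨w, hw, a, ha, hb, he⟩ := exists_copy_of_mem_elems (hv x hne)
              refine ⟨w, hw, fun y hy => ?_⟩
              obtain rfl := hx y hy
              refine ⟨by simp [he], by simpa [he] using hb, fun z hz => ?_⟩
              obtain rfl := hx z hz
              exact .inl rfl
            · exact ⟨[], trivial, fun y hy => absurd (hx y hy ▸ hy) hne⟩
      obtain ⟨w, hw, hwv⟩ := hw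
      set Y : Finset α := φ.fv.image fun x => (v x).2 with hY
      have hYmem : ∀ x ∈ φ.fv, (v x).2 ∈ Y := fun x hx => Finset.mem_image_of_mem _ hx
      -- A child of `w` that shares exactly the values `Y` and holds all the witnesses besides.
      refine h1 ((Y ∪ W, Y) :: w) ⟨hw, ?_, ?_, ?_⟩ (fun x hx => ?_) (fun a ha => ?_) v
        fun x hx => ?_
      · have h2 := Finset.card_union_le Y W
        have h3 : Y.card ≤ φ.fv.card := Finset.card_image_le
        have h4 := φ.card_fv_add_exCount_le
        omega
      · intro a ha
        obtain ⟨x, hx, rfl⟩ := Finset.mem_image.1 ha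
        exact (hwv x hx).2.1
      · intro a ha b hb
        obtain ⟨x, hx, rfl⟩ := Finset.mem_image.1 ha
        obtain ⟨y, hy, rfl⟩ := Finset.mem_image.1 hb
        exact (hwv x hx).2.2 y hy
      · simpa [Node.bag] using Or.inl (hYmem x hx)
      · simp [Node.bag, ha]
      · rw [Node.copy_cons_of_mem (hYmem x hx)]
        exact (hwv x hx).1
    · have := A1 v (fun x hx' => ?_) (by simp) hF
      · refine (Fml.sat_congr fun x hx => ?_).1 this
        simp [hv x hx]
      · rw [hv x hx']
        exact copy_mem_elems hk hw (hx x hx') (hu x hx')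

end Unravel

/-! ### Paths and cycles -/

/-- There is a path with `m + 1` edges. -/
def PathRel {α : Type} (E : α → α → Prop) : ℕ → α → α → Prop
  | 0, a, b => E a b
  | m + 1, a, b => ∃ c, PathRel E m a c ∧ E c b

theorem PathRel.mono {α : Type} {E E' : α → α → Prop} (h : ∀ a b, E a b → E' a b) {m : ℕ}
    {a b : α} (hp : PathRel E m a b) : PathRel E' m a b := by
  induction m generalizing b with
  | zero => exact h _ _ hp
  | succ m ih =>
    obtain ⟨c, h1, h2⟩ := hp
    exact ⟨c, ih h1, h _ _ h2⟩

theorem exists_pathRel_of_transGen {α : Type} {E : α → α → Prop} {a b : α} (h : TransGen E a b) :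
    ∃ m, PathRel E m a b := by
  induction h with
  | single h => exact ⟨0, h⟩
  | tail _ h ih =>
    obtain ⟨m, hm⟩ := ih
    exact ⟨m + 1, _, hm, h⟩

theorem PathRel.exists_seq {α : Type} {E : α → α → Prop} {m : ℕ} {a b : α}
    (h : PathRel E m a b) :
    ∃ c : ℕ → α, c 0 = a ∧ c (m + 1) = b ∧ ∀ i ≤ m, E (c i) (c (i + 1)) := by
  induction m generalizing b with
  | zero =>
    refine ⟨fun i => if i = 0 then a else b, by simp, by simp, fun i hi => ?_⟩
    obtain rfl : i = 0 := by omega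
    simpa [PathRel] using h
  | succ m ih =>
    obtain ⟨d, h1, h2⟩ := h
    obtain ⟨c, c0, c1, hc⟩ := ih h1
    refine ⟨fun i => if i ≤ m + 1 then c i else b, by simp [c0], by simp, fun i hi => ?_⟩
    by_cases him : i = m + 1
    · subst him
      simpa [c1] using h2
    · have h3 : i ≤ m + 1 := by omega
      have h4 : i + 1 ≤ m + 1 := by omega
      simp only [h3, h4, if_true]
      exact hc i (by omega)

theorem pathRel_of_seq {α : Type} {E : α → α → Prop} (c : ℕ → α) (m : ℕ)
    (h : ∀ i ≤ m, E (c i) (c (i + 1))) : PathRel E m (c 0) (c (m + 1)) := by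
  induction m with
  | zero => exact h 0 le_rfl
  | succ m ih => exact ⟨c (m + 1), ih fun i hi => h i (by omega), h (m + 1) le_rfl⟩

/-- A relation without cycles of length at most `k` has no cycle inside a set of at most `k`
elements. -/
theorem not_transGen_of_card_le {α : Type} {E : α → α → Prop} {k : ℕ}
    (hE : ∀ m a, m + 1 ≤ k → ¬ PathRel E m a a) (X : Finset α) (hX : X.card ≤ k) (a : α) :
    ¬ TransGen (fun a b => E a b ∧ a ∈ X ∧ b ∈ X) a a := by
  classical
  intro h
  -- A shortest cycle inside `X` has more than `k` edges, hence visits an element twice, and the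
  -- part between the two visits is a shorter cycle.
  have hex : ∃ m, ∃ a, PathRel (fun a b => E a b ∧ a ∈ X ∧ b ∈ X) m a a := by
    obtain ⟨m, hm⟩ := exists_pathRel_of_transGen h
    exact ⟨m, a, hm⟩
  obtain ⟨b, hb⟩ := Nat.find_spec hex
  set m := Nat.find hex with hm
  have hmk : k < m + 1 := by
    by_contra hlt
    exact hE m b (by omega) (hb.mono fun _ _ h => h.1)
  obtain ⟨c, c0, c1, hc⟩ := hb.exists_seq
  obtain ⟨i, hi, j, hj, hij, hcij⟩ := Finset.exists_ne_map_eq_of_card_lt_of_maps_to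
    (s := Finset.range (m + 1)) (t := X) (f := c) (by simp; omega)
    (fun i hi => (hc i (by simpa [Nat.lt_succ_iff] using hi)).2.1)
  simp only [Finset.mem_range] at hi hj
  have key : ∀ i j, i < j → j < m + 1 → c i = c j → False := by
    intro i j hlt hj he
    -- `PathRel` with index `m` means `m + 1` edges, so `j - i` edges have index `j - i - 1`.
    refine Nat.find_min hex (m := j - i - 1) (by omega) ⟨c i, ?_⟩
    have := pathRel_of_seq (E := fun a b => E a b ∧ a ∈ X ∧ b ∈ X) (fun t => c (i + t))
      (j - i - 1) fun t ht => hc (i + t) (by omega)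
    simp only [Nat.add_zero] at this
    rw [show i + (j - i - 1 + 1) = j by omega, ← he] at this
    exact this
  rcases Nat.lt_or_gt_of_ne hij with hlt | hlt
  · exact key i j hlt hj hcij
  · exact key j i hlt hi hcij.symm

/-- A relation without cycles of length at most three has no cycle inside a set on which it is
total. -/
theorem not_transGen_of_total {α : Type} {E : α → α → Prop}
    (hE : ∀ m a, m + 1 ≤ 3 → ¬ PathRel E m a a) (P : Set α)
    (hP : ∀ a ∈ P, ∀ b ∈ P, a = b ∨ E a b ∨ E b a) (a : α) :
    ¬ TransGen (fun a b => E a b ∧ a ∈ P ∧ b ∈ P) a a := by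
  have key : ∀ a b, TransGen (fun a b => E a b ∧ a ∈ P ∧ b ∈ P) a b → E a b ∧ a ∈ P ∧ b ∈ P := by
    intro a b h
    induction h with
    | single h => exact h
    | @tail b c _ h ih =>
      refine ⟨?_, ih.2.1, h.2.2⟩
      -- Totality makes `E` transitive on `P`: the case `a = c` gives a cycle of length two, and an
      -- edge from `c` to `a` one of length three.
      rcases hP a ih.2.1 c h.2.2 with rfl | h1 | h1
      · exact absurd ⟨b, ih.1, h.1⟩ (hE 1 a (by omega))
      · exact h1
      · exact absurd ⟨c, ⟨b, ih.1, h.1⟩, h1⟩ (hE 2 a (by omega))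
  intro h
  exact hE 0 a (by omega) (key a a h).1

/-! ### The edges of the unravelling are acyclic -/

section Acyclic

variable {α : Type} {F : Set (Fact α)} {B : ℕ → Prop} {P : Set α} {k : ℕ} {E : α → α → Prop}

/-- The edges inside the bag of a node. -/
def BagEdge (P : Set α) (E : α → α → Prop) (w : Node α) (a b : α) : Prop :=
  E a b ∧ a ∈ w.bag P ∧ b ∈ w.bag P

/-- The edges of the unravelling that are present in a node of depth at most `n`. -/
def StageEdge (F : Set (Fact α)) (B : ℕ → Prop) (P : Set α) (k : ℕ) (E : α → α → Prop) (n : ℕ)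
    (p q : Node α × α) : Prop :=
  ∃ w a b, Node.Valid F B P k w ∧ w.length ≤ n ∧ BagEdge P E w a b ∧ p = w.copy a ∧ q = w.copy b

theorem Node.copy_eq_of_length_le {w : Node α} {a : α} (h : w.length ≤ (w.copy a).1.length) :
    w.copy a = (w, a) := by
  cases w with
  | nil => rfl
  | cons p w =>
    obtain ⟨X, Y⟩ := p
    by_cases ha : a ∈ Y
    · have := Node.length_copy_le w a
      rw [Node.copy_cons_of_mem ha] at h
      simp only [List.length_cons] at h
      omega
    · exact Node.copy_cons_of_notMem ha

theorem Node.mem_of_length_copy_lt {X Y : Finset α} {w : Node α} {a : α}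
    (h : (Node.copy ((X, Y) :: w) a).1.length ≤ w.length) : a ∈ Y := by
  by_contra ha
  rw [Node.copy_cons_of_notMem ha] at h
  simp at h

theorem StageEdge.mono {n n' : ℕ} (h : n ≤ n') {p q : Node α × α}
    (he : StageEdge F B P k E n p q) : StageEdge F B P k E n' p q := by
  obtain ⟨w, a, b, hw, hl, h1⟩ := he
  exact ⟨w, a, b, hw, hl.trans h, h1⟩

/-- A bag of depth `n + 1` contains elements of smaller depth only as elements shared with its
parent, so the parent carries the edge too. -/
theorem StageEdge.pred {n : ℕ} {p q : Node α × α} (he : StageEdge F B P k E (n + 1) p q)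
    (hp : p.1.length ≤ n) (hq : q.1.length ≤ n) : StageEdge F B P k E n p q := by
  obtain ⟨w, a, b, hw, hl, h1, rfl, rfl⟩ := he
  by_cases hn : w.length ≤ n
  · exact ⟨w, a, b, hw, hn, h1, rfl, rfl⟩
  · cases w with
    | nil => simp at hn
    | cons s w =>
      obtain ⟨X, Y⟩ := s
      simp only [List.length_cons] at hl hn
      have ha : a ∈ Y := Node.mem_of_length_copy_lt (X := X) (w := w) (by omega)
      have hb : b ∈ Y := Node.mem_of_length_copy_lt (X := X) (w := w) (by omega)
      refine ⟨w, a, b, hw.1, by omega, ⟨h1.1, hw.2.2.1 a ha, hw.2.2.1 b hb⟩, ?_, ?_⟩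
      · exact Node.copy_cons_of_mem ha
      · exact Node.copy_cons_of_mem hb

theorem StageEdge.length_le {n : ℕ} {p q : Node α × α} (he : StageEdge F B P k E n p q) :
    p.1.length ≤ n ∧ q.1.length ≤ n := by
  obtain ⟨w, a, b, hw, hl, h1, rfl, rfl⟩ := he
  exact ⟨(Node.length_copy_le w a).trans hl, (Node.length_copy_le w b).trans hl⟩

/-- An edge at an element of maximal depth is present in the node where it was introduced. -/
theorem StageEdge.of_left {n : ℕ} {p q : Node α × α} (he : StageEdge F B P k E n p q)
    (hp : p.1.length = n) :
    Node.Valid F B P k p.1 ∧ BagEdge P E p.1 p.2 q.2 ∧ p = Node.copy p.1 p.2 ∧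
      q = Node.copy p.1 q.2 := by
  obtain ⟨w, a, b, hw, hl, h1, rfl, rfl⟩ := he
  have h2 : w.copy a = (w, a) := Node.copy_eq_of_length_le (by omega)
  have h3 : (w.copy a).1 = w := by rw [h2]
  rw [h3]
  simpa using ⟨hw, h1⟩

theorem StageEdge.of_right {n : ℕ} {p q : Node α × α} (he : StageEdge F B P k E n p q)
    (hq : q.1.length = n) :
    Node.Valid F B P k q.1 ∧ BagEdge P E q.1 p.2 q.2 ∧ p = Node.copy q.1 p.2 ∧
      q = Node.copy q.1 q.2 := by
  obtain ⟨w, a, b, hw, hl, h1, rfl, rfl⟩ := he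
  have h2 : w.copy b = (w, b) := Node.copy_eq_of_length_le (by omega)
  have h3 : (w.copy b).1 = w := by rw [h2]
  rw [h3]
  simpa using ⟨hw, h1⟩

theorem BagEdge.mem_left {w : Node α} {a b : α} (h : TransGen (BagEdge P E w) a b) :
    a ∈ w.bag P := by
  induction h with
  | single h => exact h.2.1
  | tail _ _ ih => exact ih

theorem BagEdge.mem_right {w : Node α} {a b : α} (h : TransGen (BagEdge P E w) a b) :
    b ∈ w.bag P := by
  cases h with
  | single h => exact h.2.2
  | tail _ h => exact h.2.2

/-- Paths from an element of depth at most `n`: the detours to elements of depth `n + 1` can be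
cut short. -/
theorem transGen_stage_succ
    (htot : ∀ a b, Guarded F B a b → a = b ∨ E a b ∨ E b a)
    (hbag : ∀ w, Node.Valid F B P k w → ∀ a, ¬ TransGen (BagEdge P E w) a a) {n : ℕ}
    {x y : Node α × α} (h : TransGen (StageEdge F B P k E (n + 1)) x y) (hx : x.1.length ≤ n) :
    (y.1.length ≤ n ∧ TransGen (StageEdge F B P k E n) x y) ∨
      (y.1.length = n + 1 ∧ ∃ e, (Node.copy y.1 e).1.length ≤ n ∧
        ReflTransGen (StageEdge F B P k E n) x (Node.copy y.1 e) ∧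
        TransGen (BagEdge P E y.1) e y.2) := by
  have step : ∀ y z, ReflTransGen (StageEdge F B P k E n) x y → y.1.length ≤ n →
      StageEdge F B P k E (n + 1) y z →
      (z.1.length ≤ n ∧ TransGen (StageEdge F B P k E n) x z) ∨
      (z.1.length = n + 1 ∧ ∃ e, (Node.copy z.1 e).1.length ≤ n ∧
        ReflTransGen (StageEdge F B P k E n) x (Node.copy z.1 e) ∧
        TransGen (BagEdge P E z.1) e z.2) := by
    intro y z hxy hy hyz
    by_cases hz : z.1.length ≤ n
    · exact .inl ⟨hz, TransGen.tail' hxy (hyz.pred hy hz)⟩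
    · have hz' : z.1.length = n + 1 := by have := hyz.length_le; omega
      obtain ⟨-, he, h1, -⟩ := hyz.of_right hz'
      refine .inr ⟨hz', y.2, ?_, ?_, .single he⟩
      · rwa [← h1]
      · rwa [← h1]
  induction h with
  | single h => exact step x _ .refl hx h
  | @tail y z _ hyz ih =>
    rcases ih with ⟨hy, hxy⟩ | ⟨hy, e, he, hxe, hey⟩
    · exact step y z hxy.to_reflTransGen hy hyz
    · obtain ⟨hval, hedge, -, hz⟩ := hyz.of_left hy
      have hez : TransGen (BagEdge P E y.1) e z.2 := hey.tail hedge
      by_cases hzn : z.1.length ≤ n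
      · refine .inl ⟨hzn, TransGen.tail' hxe ?_⟩
        generalize hw : y.1 = w at *
        cases w with
        | nil => simp at hy
        | cons s w =>
          obtain ⟨X, Y⟩ := s
          have hwn : w.length = n := by simpa using hy
          have heY : e ∈ Y := Node.mem_of_length_copy_lt (X := X) (w := w) (by omega)
          have hzY : z.2 ∈ Y :=
            Node.mem_of_length_copy_lt (X := X) (w := w) (by rw [← hz]; omega)
          -- The detour starts and ends in the shared set, so its ends are equal or comparable.
          -- Equality or the reverse edge would close a cycle inside the bag.
          have hE : E e z.2 := by
            rcases (hval.2.2.2 e heY z.2 hzY).imp_right (htot _ _) with h1 | h1 | h1 | h1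
            · exact absurd (h1 ▸ hez) (hbag _ hval _)
            · exact absurd (h1 ▸ hez) (hbag _ hval _)
            · exact h1
            · exact absurd (hez.tail ⟨h1, BagEdge.mem_right hez, BagEdge.mem_left hez⟩)
                (hbag _ hval _)
          refine ⟨w, e, z.2, hval.1, hwn.le, ⟨hE, hval.2.2.1 e heY, hval.2.2.1 _ hzY⟩, ?_, ?_⟩
          · exact Node.copy_cons_of_mem heY
          · rw [hz]
            simpa using Node.copy_cons_of_mem hzY
      · have hz' : z.1.length = n + 1 := by have := hyz.length_le; omega
        -- An edge at `y` lies in the bag where `y` was introduced; a neighbour of the same depth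
        -- was introduced there as well.
        have hzy : z.1 = y.1 := by
          have := Node.copy_eq_of_length_le (w := y.1) (a := z.2) (by rw [← hz]; omega)
          rw [hz, this]
        rw [hzy]
        exact .inr ⟨hy, e, he, hxe, hez⟩

/-- The path stays in the bag of its first node until it meets an element of smaller depth. So a
cycle at depth `n + 1` either lies in one bag or passes through such an element. -/
theorem transGen_stage_of_depth {n : ℕ} {x y : Node α × α}
    (h : TransGen (StageEdge F B P k E (n + 1)) x y) (hx : x.1.length = n + 1) :
    (y.1 = x.1 ∧ TransGen (BagEdge P E x.1) x.2 y.2) ∨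
      ∃ e : Node α × α, e.1.length ≤ n ∧ TransGen (StageEdge F B P k E (n + 1)) x e ∧
        ReflTransGen (StageEdge F B P k E (n + 1)) e y := by
  induction h with
  | @single y h =>
    obtain ⟨-, he, -, hy⟩ := h.of_left hx
    by_cases hyn : y.1.length ≤ n
    · exact .inr ⟨y, hyn, .single h, .refl⟩
    · have := h.length_le
      have h2 := Node.copy_eq_of_length_le (w := x.1) (a := y.2) (by rw [← hy]; omega)
      exact .inl ⟨by rw [hy, h2], .single he⟩
  | @tail y z hxy hyz ih =>
    rcases ih with ⟨hy, hp⟩ | ⟨e, he, hxe, hey⟩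
    · obtain ⟨-, hedge, -, hz⟩ := hyz.of_left (by rw [hy]; exact hx)
      rw [hy] at hedge hz
      by_cases hzn : z.1.length ≤ n
      · exact .inr ⟨z, hzn, hxy.tail hyz, .refl⟩
      · have := hyz.length_le
        have h2 := Node.copy_eq_of_length_le (w := x.1) (a := z.2) (by rw [← hz]; omega)
        exact .inl ⟨by rw [hz, h2], hp.tail hedge⟩
    · exact .inr ⟨e, he, hxe, hey.tail hyz⟩

/-- By induction on the depth: a cycle through an element of depth at most `n` shrinks to a cycle of
stage `n` by cutting its detours, and any other cycle lies in a single bag. -/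
theorem not_transGen_stage
    (htot : ∀ a b, Guarded F B a b → a = b ∨ E a b ∨ E b a)
    (hbag : ∀ w, Node.Valid F B P k w → ∀ a, ¬ TransGen (BagEdge P E w) a a) (n : ℕ)
    (p : Node α × α) : ¬ TransGen (StageEdge F B P k E n) p p := by
  induction n generalizing p with
  | zero =>
    intro h
    refine hbag [] trivial p.2 (TransGen.lift Prod.snd (fun p q hpq => ?_) _ _ h)
    obtain ⟨w, a, b, hw, hl, h1, rfl, rfl⟩ := hpq
    obtain rfl : w = [] := by simpa using hl
    simpa [Function.onFun] using h1
  | succ n ih =>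
    have low : ∀ p : Node α × α, p.1.length ≤ n →
        ¬ TransGen (StageEdge F B P k E (n + 1)) p p := by
      intro p hp h
      rcases transGen_stage_succ htot hbag h hp with ⟨-, h1⟩ | ⟨h1, -⟩
      · exact ih p h1
      · omega
    intro h
    by_cases hp : p.1.length ≤ n
    · exact low p hp h
    · have hp' : p.1.length = n + 1 := by
        cases h with
        | single h => have := h.length_le; omega
        | tail _ h => have := h.length_le; omega
      have hval : Node.Valid F B P k p.1 := by
        cases h with
        | single h => exact (h.of_left hp').1
        | tail _ h => exact (h.of_right hp').1
      rcases transGen_stage_of_depth h hp' with ⟨-, h1⟩ | ⟨e, he, hpe, hep⟩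
      · exact hbag _ hval _ h1
      · exact low e he (TransGen.trans_right hep hpe)

/-- If `E` relates the elements of guarded pairs and has no cycles inside a bag, then the
corresponding relation on the unravelling has no cycles. -/
theorem not_transGen_unravel
    (htot : ∀ a b, Guarded F B a b → a = b ∨ E a b ∨ E b a)
    (hbag : ∀ w, Node.Valid F B P k w → ∀ a, ¬ TransGen (BagEdge P E w) a a)
    (p : Node α × α) : ¬ TransGen (fun p q => ∃ n, StageEdge F B P k E n p q) p p := by
  -- A path has finitely many edges and therefore lives at a finite stage.
  have key : ∀ p q, TransGen (fun p q => ∃ n, StageEdge F B P k E n p q) p q →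
      ∃ n, TransGen (StageEdge F B P k E n) p q := by
    intro p q h
    induction h with
    | single h => exact h.imp fun n h => .single h
    | tail _ h ih =>
      obtain ⟨n, hn⟩ := ih
      obtain ⟨n', hn'⟩ := h
      exact ⟨max n n', (TransGen.mono (fun _ _ => StageEdge.mono (le_max_left _ _)) _ _ hn).tail
        (hn'.mono (le_max_right _ _))⟩
  intro h
  obtain ⟨n, hn⟩ := key p p h
  exact not_transGen_stage htot hbag n p hn

end Acyclic

/-! ### The meaning of the axioms -/

theorem mem_zvars {n : ℕ} {x : Name} : x ∈ zvars n ↔ ∃ t < n, zvar t = x := by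
  simp [zvars]

theorem wvar_injective : Function.Injective wvar := by
  intro i j h
  simpa [wvar] using congrArg List.length h

theorem wvar_ne_zvar (i j : ℕ) : wvar i ≠ zvar j := by simp [wvar, zvar]

theorem mem_elems_of_mem {α : Type} {F : Set (Fact α)} {R : ℕ} {args : List α}
    (h : (⟨R, args⟩ : Fact α) ∈ F) {a : α} (ha : a ∈ args) : a ∈ elems F := ⟨_, h, ha⟩

theorem sat_exs {α : Type} {F : Set (Fact α)} {xs : List Name} {φ : Fml} {v : Name → α} :
    (exs xs φ).Sat F v ↔
      ∃ v', (∀ x ∈ xs, v' x ∈ elems F) ∧ (∀ x ∉ xs, v' x = v x) ∧ φ.Sat F v' := by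
  induction xs generalizing v with
  | nil =>
    refine ⟨fun h => ⟨v, by simp, by simp, h⟩, ?_⟩
    rintro ⟨v', -, h1, h2⟩
    rwa [show v = v' from funext fun x => (h1 x (by simp)).symm]
  | cons x xs ih =>
    change (∃ a ∈ elems F, (exs xs φ).Sat F (update v x a)) ↔ _
    simp only [ih]
    constructor
    · rintro ⟨a, ha, v', h1, h2, h3⟩
      refine ⟨v', ?_, ?_, h3⟩
      · intro y hy
        by_cases hys : y ∈ xs
        · exact h1 y hys
        · obtain rfl : y = x := by simpa [hys] using hy
          rw [h2 y hys]
          simpa using ha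
      · intro y hy
        simp only [List.mem_cons, not_or] at hy
        rw [h2 y hy.2]
        simp [hy.1]
    · rintro ⟨v', h1, h2, h3⟩
      refine ⟨v' x, h1 x (by simp), v', fun y hy => h1 y (by simp [hy]), fun y hy => ?_, h3⟩
      by_cases hyx : y = x
      · subst hyx; simp
      · simp [hyx, h2 y (by simp [hyx, hy])]

/-- The edges given by a binary relation. -/
def Edge {α : Type} (F : Set (Fact α)) (S : ℕ) (a b : α) : Prop := (⟨S, [a, b]⟩ : Fact α) ∈ F

theorem sat_binAtom {α : Type} {F : Set (Fact α)} {S : ℕ} {x y : Name} {v : Name → α} :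
    (binAtom S x y).Sat F v ↔ Edge F S (v x) (v y) := Iff.rfl

/-- The conditions on `x` and `y` prevent capture. That quantifiers range over `elems F` only is no
restriction, since the inner nodes of a path occur in facts. -/
theorem sat_pathFml {α : Type} {F : Set (Fact α)} {S : ℕ} {x : Name} {m : ℕ} {y : Name}
    {v : Name → α} (hx : ∀ t < m, wvar t ≠ x) (hy : ∀ t < m, wvar t ≠ y) :
    (pathFml S x m y).Sat F v ↔ PathRel (Edge F S) m (v x) (v y) := by
  induction m generalizing y v with
  | zero => rfl
  | succ m ih =>
    simp only [pathFml, Fml.Sat, PathRel]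
    have h1 : ∀ a, (pathFml S x m (wvar m)).Sat F (update v (wvar m) a) ↔
        PathRel (Edge F S) m (v x) a := by
      intro a
      rw [ih (fun t ht => hx t (by omega)) (fun t ht h => by
        have := wvar_injective h
        omega)]
      simp [(hx m (by omega)).symm]
    simp only [h1, sat_binAtom, Function.update_self,
      Function.update_of_ne (hy m (by omega)).symm]
    constructor
    · rintro ⟨a, -, h⟩
      exact ⟨a, h⟩
    · rintro ⟨a, h⟩
      exact ⟨a, mem_elems_of_mem h.2 (by simp), h⟩

theorem exists_valuation {α : Type} (v : Name → α) (args : List α) :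
    ∃ v' : Name → α, (zvars args.length).map v' = args ∧
      (∀ t (h : t < args.length), v' (zvar t) = args[t]) ∧
      ∀ x ∉ zvars args.length, v' x = v x := by
  classical
  -- The word `zvar t` has `t + 1` letters, so the index of a variable is read off its length; the
  -- default of `getD` is never taken on these variables.
  have h : ∀ t (h : t < args.length),
      (if zvar t ∈ zvars args.length then args.getD ((zvar t).length - 1) (v (zvar t))
        else v (zvar t)) = args[t] := by
    intro t ht
    rw [if_pos (mem_zvars.2 ⟨t, ht, rfl⟩)]
    simp [zvar, ht]
  refine ⟨fun x => if x ∈ zvars args.length then args.getD (x.length - 1) (v x) else v x,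
    ?_, h, fun x hx => if_neg hx⟩
  refine List.ext_getElem (by simp [zvars]) fun t h1 h2 => ?_
  simpa [zvars] using h t h2

theorem edge_of_models_totalAx {α : Type} [Nonempty α] {F : Set (Fact α)} {S R n i j : ℕ}
    (h : Models F (totalAx S R n i j)) {args : List α} (hF : (⟨R, args⟩ : Fact α) ∈ F)
    (hn : args.length = n) (hi : i < args.length) (hj : j < args.length) :
    args[i] = args[j] ∨ Edge F S args[i] args[j] ∨ Edge F S args[j] args[i] := by
  obtain ⟨v⟩ : Nonempty (Name → α) := inferInstance
  obtain ⟨v', h1, h2, h3⟩ := exists_valuation v args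
  subst hn
  by_contra hc
  refine h v (sat_exs.2 ⟨v', ?_, h3, ?_, ?_⟩)
  · intro x hx
    obtain ⟨t, ht, rfl⟩ := mem_zvars.1 hx
    rw [h2 t ht]
    exact mem_elems_of_mem hF (List.getElem_mem ht)
  · simpa [Fml.Sat, Atom.Sat, h1] using hF
  · simpa [Fml.Sat, Atom.Sat, sat_binAtom, h2 i hi, h2 j hj] using hc

theorem not_edge_of_models_irreflAx {α : Type} [Nonempty α] {F : Set (Fact α)} {S : ℕ}
    (h : Models F (irreflAx S)) (a : α) : ¬ Edge F S a a := by
  obtain ⟨v⟩ : Nonempty (Name → α) := inferInstance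
  intro hE
  refine h v ⟨a, mem_elems_of_mem hE (by simp), ?_⟩
  simpa [sat_binAtom] using hE

/-- The axiom turns a cycle into a loop, which irreflexivity forbids. -/
theorem not_pathRel_of_models_loopAx {α : Type} [Nonempty α] {F : Set (Fact α)} {S m : ℕ}
    (h : Models F (loopAx S m)) (h0 : Models F (irreflAx S)) (a : α) :
    ¬ PathRel (Edge F S) m a a := by
  obtain ⟨v⟩ : Nonempty (Name → α) := inferInstance
  intro hp
  have hmem : a ∈ elems F := by
    cases m with
    | zero => exact mem_elems_of_mem hp (by simp)
    | succ m =>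
      obtain ⟨c, -, hc⟩ := hp
      exact mem_elems_of_mem hc (by simp)
  refine h v ⟨a, hmem, ?_, rfl, ?_⟩
  · rw [sat_pathFml (fun t _ => wvar_ne_zvar _ _) (fun t _ => wvar_ne_zvar _ _)]
    simpa using hp
  · simpa [Fml.Sat, sat_binAtom] using not_edge_of_models_irreflAx h0 a

theorem IsLinear.irrefl {α : Type} {F : Set (Fact α)} {S : ℕ} (h : IsLinear F S) (a : α) :
    ¬ Edge F S a a := fun hE =>
  h.toIsStrictOrder.toIrrefl.irrefl ⟨a, mem_elems_of_mem hE (by simp)⟩ hE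

theorem IsLinear.trans {α : Type} {F : Set (Fact α)} {S : ℕ} (h : IsLinear F S) {a b c : α}
    (h1 : Edge F S a b) (h2 : Edge F S b c) : Edge F S a c :=
  h.toIsStrictOrder.toIsTrans.trans ⟨a, mem_elems_of_mem h1 (by simp)⟩
    ⟨b, mem_elems_of_mem h1 (by simp)⟩ ⟨c, mem_elems_of_mem h2 (by simp)⟩ h1 h2

theorem IsLinear.total {α : Type} {F : Set (Fact α)} {S : ℕ} (h : IsLinear F S) {a b : α}
    (ha : a ∈ elems F) (hb : b ∈ elems F) : a = b ∨ Edge F S a b ∨ Edge F S b a := by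
  by_contra hc
  simp only [not_or] at hc
  exact hc.1 (congrArg Subtype.val
    (h.toTrichotomous.trichotomous ⟨a, ha⟩ ⟨b, hb⟩ hc.2.1 hc.2.2))

theorem IsLinear.of_pathRel {α : Type} {F : Set (Fact α)} {S : ℕ} (h : IsLinear F S) {m : ℕ}
    {a b : α} (hp : PathRel (Edge F S) m a b) : Edge F S a b := by
  induction m generalizing b with
  | zero => exact hp
  | succ m ih =>
    obtain ⟨c, h1, h2⟩ := hp
    exact h.trans (ih h1) h2

theorem IsLinear.models_linAxioms {α : Type} {F : Set (Fact α)} {τ : Sig} {k : ℕ}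
    (h : ∀ S, τ[S]? = some Decl.dist → IsLinear F S) {φ : Fml} (hφ : φ ∈ linAxioms τ k) :
    Models F φ := by
  intro v
  obtain ⟨S, hS, rfl | ⟨R, n, i, j, hR, hi, hj, rfl | ⟨m, hm, rfl⟩⟩ | ⟨m, hm, rfl⟩⟩ := hφ
  · rintro ⟨a, -, ha⟩
    exact (h S hS).irrefl a (by simpa [sat_binAtom] using ha)
  · intro hs
    obtain ⟨v', h1, -, -, h3⟩ := sat_exs.1 hs
    refine h3 ?_
    simpa [Fml.Sat, Atom.Sat, sat_binAtom] using
      (h S hS).total (h1 _ (mem_zvars.2 ⟨i, hi, rfl⟩)) (h1 _ (mem_zvars.2 ⟨j, hj, rfl⟩))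
  · intro hs
    obtain ⟨v', -, -, h1, -, h3⟩ := sat_exs.1 hs
    rw [sat_pathFml (fun t _ => wvar_ne_zvar _ _) (fun t _ => wvar_ne_zvar _ _)] at h1
    exact h3 ((h S hS).of_pathRel h1)
  · rintro ⟨a, -, h1, -, h3⟩
    rw [sat_pathFml (fun t _ => wvar_ne_zvar _ _) (fun t _ => wvar_ne_zvar _ _)] at h1
    exact h3 ((h S hS).of_pathRel h1)

/-- For an acyclic relation the reflexive transitive closure is a partial order. By Szpilrajn's
theorem it extends to a linear order, whose strict part is taken. -/
theorem exists_linear_extension {β : Type} {E : β → β → Prop} (h : ∀ p, ¬ TransGen E p p) :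
    ∃ lt : β → β → Prop, IsStrictTotalOrder β lt ∧ ∀ p q, E p q → lt p q := by
  have hpo : IsPartialOrder β (ReflTransGen E) :=
    { refl := fun _ => .refl
      trans := fun _ _ _ => ReflTransGen.trans
      antisymm := fun a b h1 h2 => by
        rcases Relation.reflTransGen_iff_eq_or_transGen.1 h1 with h3 | h3
        · exact h3.symm
        · exact absurd (h3.trans_left h2) (h a) }
  obtain ⟨s, hs, hle⟩ := extend_partialOrder (ReflTransGen E)
  refine ⟨fun a b => s a b ∧ a ≠ b, ?_, fun p q hpq => ⟨hle p q (.single hpq), ?_⟩⟩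
  · exact
      { irrefl := fun a h => h.2 rfl
        trans := fun a b c h1 h2 => ⟨hs.trans _ _ _ h1.1 h2.1, fun e => by
          subst e
          exact h1.2 (hs.antisymm _ _ h1.1 h2.1)⟩
        trichotomous := fun a b h1 h2 => by
          by_contra hne
          rcases hs.total a b with h3 | h3
          · exact h1 ⟨h3, hne⟩
          · exact h2 ⟨h3, Ne.symm hne⟩ }
  · rintro rfl
    exact h p (.single hpq)

/-! ### Adding unguarded facts -/

section Covered

variable {β : Type} {F₁ F₂ : Set (Fact β)} {σ : Sig}

theorem Atom.IsBaseGuard.sat_iff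
    (hbase : ∀ f : Fact β, (∃ n, σ[f.rel]? = some (Decl.base n)) → (f ∈ F₁ ↔ f ∈ F₂)) {A : Atom}
    (hA : A.IsBaseGuard σ) (v : Name → β) : A.Sat F₁ v ↔ A.Sat F₂ v := by
  cases A with
  | rel R xs => exact hbase _ hA
  | eq x y => rfl

theorem guarded_of_sat {A : Atom} (hA : A.IsBaseGuard σ) {v : Name → β} (hs : A.Sat F₂ v)
    {x y : Name} (hx : x ∈ A.vars) (hy : y ∈ A.vars) :
    v x = v y ∨ Guarded F₂ (fun R => ∃ n, σ[R]? = some (Decl.base n)) (v x) (v y) := by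
  cases A with
  | rel R xs =>
    simp only [Atom.vars, List.mem_toFinset] at hx hy
    exact .inr ⟨_, hs, hA, List.mem_map_of_mem hx, List.mem_map_of_mem hy⟩
  | eq z z' =>
    obtain rfl : z = z' := hA
    simp only [Atom.vars, Finset.mem_insert, Finset.mem_singleton, or_self] at hx hy
    exact .inl (by rw [hx, hy])

/-- A covered distinguished atom speaks about a base-guarded pair or a single element, and there
`F₂` has no edge beyond those of `F₁`. -/
theorem edge_of_covered
    (hguard : ∀ S a b, σ[S]? = some Decl.dist → Edge F₂ S a b →
      (a = b ∨ Guarded F₂ (fun R => ∃ n, σ[R]? = some (Decl.base n)) a b) → Edge F₁ S a b)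
    {R : ℕ} {xs : List Name} (hR : σ[R]? = some Decl.dist)
    (hover : (Atom.rel R xs).Over σ) {v : Name → β} (hs : (Atom.rel R xs).Sat F₂ v)
    {A : Atom} (hA : A.IsBaseGuard σ) (hAs : A.Sat F₂ v)
    (hsub : (Atom.rel R xs).vars ⊆ A.vars) : (Atom.rel R xs).Sat F₁ v := by
  obtain ⟨d, hd, hl⟩ := hover
  obtain rfl : d = Decl.dist := by simpa [hR] using hd.symm
  obtain ⟨x, y, rfl⟩ : ∃ x y, xs = [x, y] := List.length_eq_two.1 hl
  refine hguard R (v x) (v y) hR hs (guarded_of_sat hA hAs (hsub ?_) (hsub ?_)) <;>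
    simp [Atom.vars]

/-- Base-covered formulas are preserved when facts over distinguished relations are added for
pairs that are not base-guarded. -/
theorem sat_of_covered (helems : elems F₁ = elems F₂)
    (hbase : ∀ f : Fact β, (∃ n, σ[f.rel]? = some (Decl.base n)) → (f ∈ F₁ ↔ f ∈ F₂))
    (hdist : ∀ f : Fact β, σ[f.rel]? = some Decl.dist → f ∈ F₁ → f ∈ F₂)
    (hguard : ∀ S a b, σ[S]? = some Decl.dist → Edge F₂ S a b →
      (a = b ∨ Guarded F₂ (fun R => ∃ n, σ[R]? = some (Decl.base n)) a b) → Edge F₁ S a b)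
    (φ : Fml) (hover : ∀ a ∈ φ.atoms, a.Over σ) (pol : Bool) (Γ : Set Atom)
    (hcov : φ.CoveredIn σ pol Γ) (v : Name → β)
    (hΓ : ∀ A ∈ Γ, A.IsBaseGuard σ ∧ A.Sat F₂ v) :
    (pol = true → φ.Sat F₁ v → φ.Sat F₂ v) ∧ (pol = false → φ.Sat F₂ v → φ.Sat F₁ v) := by
  induction φ generalizing pol Γ v with
  | tru => exact ⟨fun _ _ => trivial, fun _ _ => trivial⟩
  | fls => exact ⟨fun _ h => h, fun _ h => h⟩
  | atom a =>
    have ha : a.Over σ := hover a (by simp [Fml.atoms])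
    cases a with
    | eq x y => exact ⟨fun _ h => h, fun _ h => h⟩
    | rel R xs =>
      obtain ⟨d, hd, -⟩ := id ha
      cases d with
      | base n =>
        have := hbase ⟨R, xs.map v⟩ ⟨n, hd⟩
        exact ⟨fun _ h => this.1 h, fun _ h => this.2 h⟩
      | dist =>
        refine ⟨fun _ h => hdist _ hd h, fun hp h => ?_⟩
        obtain ⟨A, hA, hsub⟩ := hcov hp hd
        exact edge_of_covered hguard hd ha h (hΓ A hA).1 (hΓ A hA).2 hsub
  | and φ ψ ih1 ih2 =>
    simp only [Fml.atoms, List.mem_append] at hover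
    -- The guards of a conjunct hold in `F₂` no matter in which of the two sets the conjunct holds,
    -- since base facts agree.
    have key : (φ.Sat F₁ v ∨ φ.Sat F₂ v) → (ψ.Sat F₁ v ∨ ψ.Sat F₂ v) →
        (∀ A ∈ Γ ∪ ψ.guards σ, A.IsBaseGuard σ ∧ A.Sat F₂ v) ∧
        ∀ A ∈ Γ ∪ φ.guards σ, A.IsBaseGuard σ ∧ A.Sat F₂ v := by
      have key' : ∀ φ : Fml, (φ.Sat F₁ v ∨ φ.Sat F₂ v) →
          ∀ A ∈ Γ ∪ φ.guards σ, A.IsBaseGuard σ ∧ A.Sat F₂ v := by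
        rintro φ h A (hA | hA)
        · exact hΓ A hA
        · rcases h with h | h
          · have := sat_of_mem_guards h A hA
            exact ⟨this.1, (this.1.sat_iff hbase v).1 this.2⟩
          · exact sat_of_mem_guards h A hA
      exact fun h1 h2 => ⟨key' ψ h2, key' φ h1⟩
    constructor
    · rintro hp ⟨h1, h2⟩
      obtain ⟨k1, k2⟩ := key (.inl h1) (.inl h2)
      exact ⟨(ih1 (fun a ha => hover a (.inl ha)) _ _ hcov.1 v k1).1 hp h1,
        (ih2 (fun a ha => hover a (.inr ha)) _ _ hcov.2 v k2).1 hp h2⟩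
    · rintro hp ⟨h1, h2⟩
      obtain ⟨k1, k2⟩ := key (.inr h1) (.inr h2)
      exact ⟨(ih1 (fun a ha => hover a (.inl ha)) _ _ hcov.1 v k1).2 hp h1,
        (ih2 (fun a ha => hover a (.inr ha)) _ _ hcov.2 v k2).2 hp h2⟩
  | or φ ψ ih1 ih2 =>
    simp only [Fml.atoms, List.mem_append] at hover
    have k1 := ih1 (fun a ha => hover a (.inl ha)) _ _ hcov.1 v hΓ
    have k2 := ih2 (fun a ha => hover a (.inr ha)) _ _ hcov.2 v hΓ
    exact ⟨fun hp h => h.imp (k1.1 hp) (k2.1 hp), fun hp h => h.imp (k1.2 hp) (k2.2 hp)⟩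
  | ex x φ ih =>
    have key : ∀ a, ∀ A ∈ {A ∈ Γ | x ∉ A.vars}, A.IsBaseGuard σ ∧ A.Sat F₂ (update v x a) := by
      rintro a A ⟨hA, hx⟩
      refine ⟨(hΓ A hA).1, ?_⟩
      refine (Fml.sat_congr (φ := .atom A) fun y hy => ?_).1 (hΓ A hA).2
      have : y ≠ x := fun e => hx (e ▸ hy)
      simp [this]
    constructor
    · rintro hp ⟨a, ha, h⟩
      exact ⟨a, helems ▸ ha, (ih hover _ _ hcov _ (key a)).1 hp h⟩
    · rintro hp ⟨a, ha, h⟩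
      exact ⟨a, helems ▸ ha, (ih hover _ _ hcov _ (key a)).2 hp h⟩
  | neg φ ih =>
    have k := ih hover _ _ hcov v hΓ
    refine ⟨fun hp h h' => h (k.2 (by simp [hp]) h'), fun hp h h' => h (k.1 (by simp [hp]) h')⟩

/-- A query is positive, yet it has to be transferred from the larger set to the smaller one. All
its atoms hold under the same valuation, so any of them can serve as the guard of another. -/
theorem sat_atomConj_of_covered
    (hbase : ∀ f : Fact β, (∃ n, σ[f.rel]? = some (Decl.base n)) → (f ∈ F₁ ↔ f ∈ F₂))
    (hguard : ∀ S a b, σ[S]? = some Decl.dist → Edge F₂ S a b →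
      (a = b ∨ Guarded F₂ (fun R => ∃ n, σ[R]? = some (Decl.base n)) a b) → Edge F₁ S a b)
    {φ : Fml} (hφ : φ.IsAtomConj) (hover : ∀ a ∈ φ.atoms, a.Over σ) (hcov : φ.CQCovered σ)
    {v : Name → β} (h : φ.Sat F₂ v) : φ.Sat F₁ v := by
  have hatoms : ∀ φ : Fml, φ.IsAtomConj → φ.Sat F₂ v → ∀ a ∈ φ.atoms, a.Sat F₂ v := by
    intro φ hφ h
    induction φ with
    | tru => simp [Fml.atoms]
    | atom a => simpa [Fml.atoms, Fml.Sat] using h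
    | and φ ψ ih1 ih2 =>
      simp only [Fml.atoms, List.mem_append]
      rintro a (ha | ha)
      · exact ih1 hφ.1 h.1 a ha
      · exact ih2 hφ.2 h.2 a ha
    | _ => exact hφ.elim
  have hsat : ∀ a ∈ φ.atoms, a.Sat F₁ v := by
    intro a ha
    have h2 := hatoms φ hφ h a ha
    cases a with
    | eq x y => exact h2
    | rel R xs =>
      obtain ⟨d, hd, -⟩ := hover _ ha
      cases d with
      | base n => exact (hbase ⟨R, xs.map v⟩ ⟨n, hd⟩).2 h2
      | dist =>
        obtain ⟨A, hA, hAb, hsub⟩ := hcov _ ha hd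
        exact edge_of_covered hguard hd (hover _ ha) h2 hAb (hatoms φ hφ h A hA) hsub
  clear hover hcov h hatoms
  induction φ with
  | tru => trivial
  | atom a => exact hsat a (by simp [Fml.atoms])
  | and φ ψ ih1 ih2 =>
    simp only [Fml.atoms, List.mem_append] at hsat
    exact ⟨ih1 hφ.1 fun a ha => hsat a (.inl ha), ih2 hφ.2 fun a ha => hsat a (.inr ha)⟩
  | _ => exact hφ.elim

theorem sat_cq_of_covered (helems : elems F₁ = elems F₂)
    (hbase : ∀ f : Fact β, (∃ n, σ[f.rel]? = some (Decl.base n)) → (f ∈ F₁ ↔ f ∈ F₂))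
    (hguard : ∀ S a b, σ[S]? = some Decl.dist → Edge F₂ S a b →
      (a = b ∨ Guarded F₂ (fun R => ∃ n, σ[R]? = some (Decl.base n)) a b) → Edge F₁ S a b)
    {φ : Fml} (hφ : φ.IsCQ) (hover : ∀ a ∈ φ.atoms, a.Over σ) (hcov : φ.CQCovered σ)
    {v : Name → β} (h : φ.Sat F₂ v) : φ.Sat F₁ v := by
  induction φ generalizing v with
  | ex x φ ih =>
    obtain ⟨a, ha, h⟩ := h
    exact ⟨a, helems ▸ ha, ih hφ hover hcov h⟩
  | _ => exact sat_atomConj_of_covered hbase hguard hφ hover hcov h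

theorem sat_ucq_of_covered (helems : elems F₁ = elems F₂)
    (hbase : ∀ f : Fact β, (∃ n, σ[f.rel]? = some (Decl.base n)) → (f ∈ F₁ ↔ f ∈ F₂))
    (hguard : ∀ S a b, σ[S]? = some Decl.dist → Edge F₂ S a b →
      (a = b ∨ Guarded F₂ (fun R => ∃ n, σ[R]? = some (Decl.base n)) a b) → Edge F₁ S a b)
    {φ : Fml} (hφ : φ.IsBaseCoveredUCQ σ) (hover : ∀ a ∈ φ.atoms, a.Over σ)
    {v : Name → β} (h : φ.Sat F₂ v) : φ.Sat F₁ v := by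
  induction φ with
  | fls => exact h
  | or φ ψ ih1 ih2 =>
    simp only [Fml.atoms, List.mem_append] at hover
    exact h.imp (ih1 hφ.1 fun a ha => hover a (.inl ha)) (ih2 hφ.2 fun a ha => hover a (.inr ha))
  | _ => exact sat_cq_of_covered helems hbase hguard hφ.1 hover hφ.2 h

end Covered

/-! ### The lists of the reduction -/

theorem mem_distPos {σ : Sig} {p S : ℕ} :
    S ∈ distPos σ p ↔ ∃ i, σ[i]? = some Decl.dist ∧ S = p + i := by
  induction σ generalizing p with
  | nil => simp [distPos]
  | cons d σ ih =>
    have hsucc : (∃ i, (d :: σ)[i]? = some Decl.dist ∧ S = p + i) ↔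
        (d = .dist ∧ S = p) ∨ ∃ i, σ[i]? = some Decl.dist ∧ S = p + 1 + i := by
      constructor
      · rintro ⟨i, hi, rfl⟩
        cases i with
        | zero => exact .inl ⟨by simpa using hi, rfl⟩
        | succ i => exact .inr ⟨i, by simpa using hi, by omega⟩
      · rintro (⟨rfl, rfl⟩ | ⟨i, hi, rfl⟩)
        · exact ⟨0, by simp⟩
        · exact ⟨i + 1, by simpa using hi, by omega⟩
    rw [hsucc, ← ih]
    cases d <;> simp [distPos]

theorem mem_basePos {σ : Sig} {p R n : ℕ} :
    (R, n) ∈ basePos σ p ↔ ∃ i, σ[i]? = some (Decl.base n) ∧ R = p + i := by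
  induction σ generalizing p with
  | nil => simp [basePos]
  | cons d σ ih =>
    have hsucc : (∃ i, (d :: σ)[i]? = some (Decl.base n) ∧ R = p + i) ↔
        (d = .base n ∧ R = p) ∨ ∃ i, σ[i]? = some (Decl.base n) ∧ R = p + 1 + i := by
      constructor
      · rintro ⟨i, hi, rfl⟩
        cases i with
        | zero => exact .inl ⟨by simpa using hi, rfl⟩
        | succ i => exact .inr ⟨i, by simpa using hi, by omega⟩
      · rintro (⟨rfl, rfl⟩ | ⟨i, hi, rfl⟩)
        · exact ⟨0, by simp⟩
        · exact ⟨i + 1, by simpa using hi, by omega⟩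
    rw [hsucc, ← ih]
    cases d with
    | base n' =>
      simp only [basePos, List.mem_cons, Prod.mk.injEq, Decl.base.injEq]
      refine or_congr ⟨fun h => ⟨h.2.symm, h.1⟩, fun h => ⟨h.2, h.1.symm⟩⟩ Iff.rfl
    | dist => simp [basePos]

theorem getElem?_addG_of_some {σ : Sig} {R : ℕ} {d : Decl} (h : σ[R]? = some d) :
    σ.addG[R]? = some d := by
  rw [Sig.addG, List.getElem?_append_left (List.getElem?_eq_some_iff.1 h).1, h]

theorem getElem?_addG_length (σ : Sig) : σ.addG[σ.length]? = some (.base 2) := by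
  simp [Sig.addG]

theorem getElem?_addG {σ : Sig} {R : ℕ} {d : Decl} (h : σ.addG[R]? = some d) :
    σ[R]? = some d ∨ (R = σ.length ∧ d = .base 2) := by
  rcases Nat.lt_trichotomy R σ.length with hlt | heq | hgt
  · rw [Sig.addG, List.getElem?_append_left hlt] at h
    exact .inl h
  · subst heq
    rw [getElem?_addG_length] at h
    exact .inr ⟨rfl, by simpa using h.symm⟩
  · rw [Sig.addG, List.getElem?_eq_none (by simp; omega)] at h
    simp at h

theorem getElem?_addG_dist {σ : Sig} {S : ℕ} :
    σ.addG[S]? = some Decl.dist ↔ σ[S]? = some Decl.dist :=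
  ⟨fun h => (getElem?_addG h).resolve_right fun h => by simp at h, getElem?_addG_of_some⟩

theorem le_maxArity_iff {σ : Sig} {t : ℕ} (ht : 0 < t) :
    t ≤ σ.maxArity ↔ ∃ d ∈ σ, t ≤ d.arity := by
  induction σ with
  | nil => simp [Sig.maxArity]; omega
  | cons d σ ih =>
    change t ≤ max d.arity (Sig.maxArity σ) ↔ _
    simp [ih]

/-- The distinguished relations contribute only the arity two, which `G` contributes anyway, so the
arities of the base relations suffice. -/
theorem le_width_iff {K : KB} {Q : Fml} {t : ℕ} (ht : 0 < t) :
    t ≤ width K Q ↔ ∃ a ∈ widths K Q, t ≤ a := by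
  rw [width, le_max_iff, le_maxArity_iff ht, widths]
  simp only [List.mem_cons, List.mem_map, Prod.exists, exists_eq_right, mem_basePos,
    exists_eq_or_imp, Nat.zero_add, exists_eq_right']
  refine or_congr Iff.rfl ⟨?_, ?_⟩
  · rintro ⟨d, hd, h⟩
    cases d with
    | base n =>
      obtain ⟨i, hi⟩ := List.mem_iff_getElem?.1 hd
      exact ⟨n, ⟨i, hi⟩, h⟩
    | dist => exact ⟨2, ⟨_, getElem?_addG_length K.sig⟩, h⟩
  · rintro ⟨n, ⟨i, hi⟩, h⟩
    exact ⟨_, List.mem_iff_getElem?.2 ⟨i, hi⟩, h⟩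

/-- A lower bound on a maximum is attained at some member of the list. For the transitivity axioms,
`m + 1 ≤ k - 1` means `m + 2 ≤ k`. -/
theorem mem_linList {K : KB} {Q : Fml} {φ : Fml} :
    φ ∈ linList (distPos K.sig 0) (basePos K.sig.addG 0) (widths K Q) ↔
      φ ∈ linAxioms K.sig.addG (width K Q) := by
  simp only [linList, List.mem_flatMap, mem_distPos, Nat.zero_add, exists_eq_right', List.mem_cons,
    List.mem_append, List.mem_map, List.mem_range, Prod.exists, mem_basePos, linAxioms,
    Set.mem_ofPred_eq, getElem?_addG_dist]
  constructor
  · rintro ⟨S, hS, rfl | ⟨R, n, hR, i, hi, j, hj, rfl | ⟨a, ha, m, hm, rfl⟩⟩ |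
      ⟨a, ha, m, hm, rfl⟩⟩
    · exact ⟨S, hS, .inl rfl⟩
    · exact ⟨S, hS, .inr (.inl ⟨R, n, i, j, hR, hi, hj, .inl rfl⟩)⟩
    · have := (le_width_iff (t := m + 2) (by omega)).2 ⟨a, ha, by omega⟩
      exact ⟨S, hS, .inr (.inl ⟨R, n, i, j, hR, hi, hj, .inr ⟨m, by omega, rfl⟩⟩)⟩
    · have := (le_width_iff (t := m + 1) (by omega)).2 ⟨a, ha, by omega⟩
      exact ⟨S, hS, .inr (.inr ⟨m, this, rfl⟩)⟩
  · rintro ⟨S, hS, rfl | ⟨R, n, i, j, hR, hi, hj, rfl | ⟨m, hm, rfl⟩⟩ | ⟨m, hm, rfl⟩⟩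
    · exact ⟨S, hS, .inl rfl⟩
    · exact ⟨S, hS, .inr (.inl ⟨R, n, hR, i, hi, j, hj, .inl rfl⟩)⟩
    · obtain ⟨a, ha, h⟩ := (le_width_iff (t := m + 2) (by omega)).1
        (show m + 2 ≤ width K Q by omega)
      exact ⟨S, hS, .inr (.inl ⟨R, n, hR, i, hi, j, hj,
        .inr ⟨a, ha, m, by omega, rfl⟩⟩)⟩
    · obtain ⟨a, ha, h⟩ := (le_width_iff (t := m + 1) (by omega)).1 hm
      exact ⟨S, hS, .inr (.inr ⟨a, ha, m, by omega, rfl⟩)⟩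

theorem mem_gList {K : KB} (hd : distPos K.sig 0 ≠ []) {f : Fact Name} :
    f ∈ gList K ↔ f ∈ gFacts K := by
  obtain ⟨S, hS⟩ := List.exists_mem_of_ne_nil _ hd
  simp only [gList, List.mem_flatMap, List.mem_map, gFacts, elems, Set.mem_ofPred_eq]
  constructor
  · rintro ⟨-, -, g, hg, a, ha, g', hg', b, hb, rfl⟩
    exact ⟨a, ⟨g, hg, ha⟩, b, ⟨g', hg', hb⟩, rfl⟩
  · rintro ⟨a, ⟨g, hg, ha⟩, b, ⟨g', hg', hb⟩, rfl⟩
    exact ⟨S, hS, g, hg, a, ha, g', hg', b, hb, rfl⟩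

/-! ### The output lies in the guarded-negation fragment -/

theorem Atom.Over.addG {σ : Sig} {A : Atom} (h : A.Over σ) : A.Over σ.addG := by
  cases A with
  | rel R xs =>
    obtain ⟨d, hd, hl⟩ := h
    exact ⟨d, getElem?_addG_of_some hd, hl⟩
  | eq x y => trivial

theorem Fact.Over.addG {α : Type} {σ : Sig} {f : Fact α} (h : f.Over σ) : f.Over σ.addG := by
  obtain ⟨d, hd, hl⟩ := h
  exact ⟨d, getElem?_addG_of_some hd, hl⟩

theorem guards_subset_addG (σ : Sig) (φ : Fml) : φ.guards σ ⊆ φ.guards σ.addG := by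
  induction φ with
  | atom a =>
    rintro A ⟨rfl, hA⟩
    refine ⟨rfl, ?_⟩
    cases A with
    | rel R xs =>
      obtain ⟨n, hn⟩ := hA
      exact ⟨n, getElem?_addG_of_some hn⟩
    | eq x y => exact hA
  | and φ ψ ih1 ih2 => exact Set.union_subset_union ih1 ih2
  | _ => exact Set.Subset.rfl

theorem Fml.BaseGNFIn.addG {σ : Sig} {φ : Fml} {Γ Γ' : Set Atom} (h : φ.BaseGNFIn σ Γ)
    (hΓ : Γ ⊆ Γ') : φ.BaseGNFIn σ.addG Γ' := by
  induction φ generalizing Γ Γ' with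
  | tru => trivial
  | fls => trivial
  | atom a => trivial
  | and φ ψ ih1 ih2 =>
    exact ⟨ih1 h.1 (Set.union_subset_union hΓ (guards_subset_addG σ ψ)),
      ih2 h.2 (Set.union_subset_union hΓ (guards_subset_addG σ φ))⟩
  | or φ ψ ih1 ih2 => exact ⟨ih1 h.1 Set.Subset.rfl, ih2 h.2 Set.Subset.rfl⟩
  | ex x φ ih => exact ih h Set.Subset.rfl
  | neg φ ih =>
    exact ⟨h.1.imp_right fun ⟨A, hA, hs⟩ => ⟨A, hΓ hA, hs⟩, ih h.2 Set.Subset.rfl⟩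

theorem fv_exs (xs : List Name) (φ : Fml) : (exs xs φ).fv = φ.fv \ xs.toFinset := by
  induction xs with
  | nil => simp [exs]
  | cons x xs ih =>
    change (exs xs φ).fv.erase x = _
    rw [ih]
    ext y
    simp only [Finset.mem_erase, Finset.mem_sdiff, List.mem_toFinset, List.mem_cons]
    tauto

theorem atoms_exs (xs : List Name) (φ : Fml) : (exs xs φ).atoms = φ.atoms := by
  induction xs with
  | nil => rfl
  | cons x xs ih => exact ih

theorem baseGNFIn_exs {τ : Sig} {xs : List Name} {φ : Fml} (h : φ.BaseGNFIn τ ∅) :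
    (exs xs φ).BaseGNFIn τ ∅ := by
  induction xs with
  | nil => exact h
  | cons x xs ih => exact ih

theorem fv_pathFml_subset (S : ℕ) (x : Name) (m : ℕ) (y : Name) :
    (pathFml S x m y).fv ⊆ {x, y} := by
  induction m generalizing y with
  | zero => simp [pathFml, binAtom, Fml.fv, Atom.vars]
  | succ m ih =>
    intro z hz
    simp only [pathFml, binAtom, Fml.fv, Atom.vars, Finset.mem_erase, Finset.mem_union,
      List.mem_toFinset, List.mem_cons, List.not_mem_nil, or_false] at hz
    rcases hz with ⟨h1, h2 | h2 | h2⟩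
    · have := ih _ h2
      simp only [Finset.mem_insert, Finset.mem_singleton] at this
      simp [this.resolve_right h1]
    · exact absurd h2 h1
    · simp [h2]

theorem over_of_mem_atoms_pathFml {τ : Sig} {S : ℕ} (hS : τ[S]? = some Decl.dist) (x : Name)
    (m : ℕ) (y : Name) : ∀ a ∈ (pathFml S x m y).atoms, a.Over τ := by
  have hb : ∀ x y, (Atom.rel S [x, y]).Over τ := fun x y => ⟨_, hS, rfl⟩
  induction m generalizing y with
  | zero => simpa [pathFml, binAtom, Fml.atoms] using hb x y
  | succ m ih =>
    simp only [pathFml, binAtom, Fml.atoms, List.mem_append, List.mem_singleton]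
    rintro a (ha | rfl)
    · exact ih _ a ha
    · exact hb _ _

theorem baseGNFIn_pathFml (τ : Sig) (S : ℕ) (x : Name) (m : ℕ) (y : Name) (Γ : Set Atom) :
    (pathFml S x m y).BaseGNFIn τ Γ := by
  induction m generalizing y Γ with
  | zero => trivial
  | succ m ih => exact ⟨ih _ _, trivial⟩

theorem isSentence_baseGNF_of_mem_linAxioms {τ : Sig} {k : ℕ} {φ : Fml}
    (h : φ ∈ linAxioms τ k) : φ.IsSentence τ ∧ φ.BaseGNF τ := by
  obtain ⟨S, hS, rfl | ⟨R, n, i, j, hR, hi, hj, rfl | ⟨m, hm, rfl⟩⟩ | ⟨m, hm, rfl⟩⟩ := h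
  · have hfv : (irreflAx S).fv = ∅ := by
      simp [irreflAx, binAtom, Fml.fv, Atom.vars]
    refine ⟨⟨hfv, ?_⟩, .inl hfv, trivial⟩
    simpa [irreflAx, binAtom, Fml.atoms] using ⟨_, hS, rfl⟩
  · have hzi : zvar i ∈ zvars n := mem_zvars.2 ⟨i, hi, rfl⟩
    have hzj : zvar j ∈ zvars n := mem_zvars.2 ⟨j, hj, rfl⟩
    have hfv : (totalAx S R n i j).fv = ∅ := by
      simp only [totalAx, Fml.fv, fv_exs, Finset.sdiff_eq_empty_iff_subset, binAtom, Atom.vars]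
      intro x hx
      simp only [Finset.mem_union, List.mem_toFinset, Finset.mem_insert, Finset.mem_singleton,
        List.mem_cons, List.not_mem_nil, or_false] at hx
      rcases hx with h | (rfl | rfl) | (rfl | rfl) | rfl | rfl <;> simp [*]
    refine ⟨⟨hfv, ?_⟩, .inl hfv, baseGNFIn_exs ⟨trivial, .inr ⟨.rel R (zvars n), ?_, ?_⟩, ?_⟩⟩
    · simp only [totalAx, Fml.atoms, atoms_exs, binAtom, List.mem_append, List.mem_singleton]
      rintro a (rfl | rfl | rfl | rfl)
      · exact ⟨_, hR, by simp [zvars, Decl.arity]⟩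
      · trivial
      · exact ⟨_, hS, rfl⟩
      · exact ⟨_, hS, rfl⟩
    · exact .inr ⟨rfl, n, hR⟩
    · intro x hx
      simp only [Fml.fv, binAtom, Atom.vars, Finset.mem_union, List.mem_toFinset,
        Finset.mem_insert, Finset.mem_singleton, List.mem_cons, List.not_mem_nil, or_false] at hx
      rcases hx with (rfl | rfl) | (rfl | rfl) | rfl | rfl <;> simp [Atom.vars, *]
    · exact ⟨trivial, trivial, trivial⟩
  · have hzi : zvar i ∈ zvars n := mem_zvars.2 ⟨i, hi, rfl⟩
    have hzj : zvar j ∈ zvars n := mem_zvars.2 ⟨j, hj, rfl⟩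
    have hfv : (transAx S R n i j m).fv = ∅ := by
      simp only [transAx, Fml.fv, fv_exs, Finset.sdiff_eq_empty_iff_subset, binAtom, Atom.vars]
      intro x hx
      simp only [Finset.mem_union, List.mem_toFinset, List.mem_cons, List.not_mem_nil,
        or_false] at hx
      rcases hx with h | h | rfl | rfl
      · have := fv_pathFml_subset _ _ _ _ h
        simp only [Finset.mem_insert, Finset.mem_singleton] at this
        rcases this with rfl | rfl <;> simp [*]
      all_goals simp [*]
    refine ⟨⟨hfv, ?_⟩, .inl hfv, baseGNFIn_exs ⟨baseGNFIn_pathFml _ _ _ _ _ _, trivial,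
      .inr ⟨.rel R (zvars n), ?_, ?_⟩, trivial⟩⟩
    · simp only [transAx, Fml.atoms, atoms_exs, binAtom, List.mem_append, List.mem_singleton]
      rintro a (h | rfl | rfl)
      · exact over_of_mem_atoms_pathFml hS _ _ _ a h
      · exact ⟨_, hR, by simp [zvars, Decl.arity]⟩
      · exact ⟨_, hS, rfl⟩
    · exact .inr ⟨rfl, n, hR⟩
    · intro x hx
      simp only [Fml.fv, binAtom, Atom.vars, List.mem_toFinset, List.mem_cons, List.not_mem_nil,
        or_false] at hx
      rcases hx with rfl | rfl <;> simp [Atom.vars, *]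
  · have hfv : (loopAx S m).fv = ∅ := by
      simp only [loopAx, Fml.fv, binAtom, Atom.vars]
      ext x
      simp only [Finset.mem_erase, Finset.mem_union, Finset.mem_insert, Finset.mem_singleton,
        List.mem_toFinset, List.mem_cons, List.not_mem_nil, or_false, or_self, Finset.notMem_empty,
        iff_false, not_and, not_or]
      refine fun hx => ⟨fun h => ?_, hx⟩
      have := fv_pathFml_subset _ _ _ _ h
      simp [hx] at this
    refine ⟨⟨hfv, ?_⟩, .inl hfv, baseGNFIn_pathFml _ _ _ _ _ _, trivial,
      .inr ⟨.eq (zvar 0) (zvar 0), .inr ⟨rfl, rfl⟩, ?_⟩, trivial⟩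
    · simp only [loopAx, Fml.atoms, binAtom, List.mem_append, List.mem_singleton]
      rintro a (h | rfl | rfl)
      · exact over_of_mem_atoms_pathFml hS _ _ _ a h
      · trivial
      · exact ⟨_, hS, rfl⟩
    · simp [Fml.fv, binAtom, Atom.vars]

theorem isSentence_baseGNF_emptyAx (σ : Sig) :
    (emptyAx σ.length).IsSentence σ.addG ∧ (emptyAx σ.length).BaseGNF σ.addG := by
  have hfv : (emptyAx σ.length).fv = ∅ := by
    simp only [emptyAx, binAtom, Fml.fv, Atom.vars]
    ext x
    simp only [Finset.mem_erase, List.mem_toFinset, List.mem_cons, List.not_mem_nil, or_false,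
      Finset.notMem_empty, iff_false]
    tauto
  refine ⟨⟨hfv, ?_⟩, .inl hfv, trivial⟩
  simpa [emptyAx, binAtom, Fml.atoms] using ⟨_, getElem?_addG_length σ, rfl⟩

theorem baseGNFIn_of_isAtomConj {σ : Sig} {φ : Fml} (h : φ.IsAtomConj) (Γ : Set Atom) :
    φ.BaseGNFIn σ Γ := by
  induction φ generalizing Γ with
  | tru => trivial
  | atom a => trivial
  | and φ ψ ih1 ih2 => exact ⟨ih1 h.1 _, ih2 h.2 _⟩
  | _ => exact h.elim

theorem baseGNFIn_of_isCQ {σ : Sig} {φ : Fml} (h : φ.IsCQ) (Γ : Set Atom) :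
    φ.BaseGNFIn σ Γ := by
  induction φ generalizing Γ with
  | ex x φ ih => exact ih h _
  | _ => exact baseGNFIn_of_isAtomConj h _

theorem baseGNFIn_of_isBaseCoveredUCQ {σ : Sig} {φ : Fml} (h : φ.IsBaseCoveredUCQ σ)
    (Γ : Set Atom) : φ.BaseGNFIn σ Γ := by
  induction φ generalizing Γ with
  | fls => trivial
  | or φ ψ ih1 ih2 => exact ⟨ih1 h.1 _, ih2 h.2 _⟩
  | _ => exact baseGNFIn_of_isCQ h.1 _

/-! ### Linear orders on a set of facts -/

/-- The set of facts where the distinguished relations are replaced by the given relations. -/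
def linearize {β : Type} (σ : Sig) (F : Set (Fact β)) (lt : ℕ → β → β → Prop) : Set (Fact β) :=
  {g | g ∈ F ∧ ∃ n, σ[g.rel]? = some (Decl.base n)} ∪
    {g | ∃ S p q, σ[S]? = some Decl.dist ∧ p ∈ elems F ∧ q ∈ elems F ∧ lt S p q ∧ g = ⟨S, [p, q]⟩}

section linearize

variable {β : Type} {σ : Sig} {F : Set (Fact β)} {lt : ℕ → β → β → Prop}

theorem mem_linearize_of_base {f : Fact β} (h : ∃ n, σ[f.rel]? = some (Decl.base n)) :
    f ∈ linearize σ F lt ↔ f ∈ F := by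
  refine ⟨?_, fun hf => .inl ⟨hf, h⟩⟩
  rintro (hf | ⟨S, p, q, hS, -, -, -, rfl⟩)
  · exact hf.1
  · obtain ⟨n, hn⟩ := h
    simp [hS] at hn

theorem edge_linearize {S : ℕ} (hS : σ[S]? = some Decl.dist) {p q : β} :
    Edge (linearize σ F lt) S p q ↔ p ∈ elems F ∧ q ∈ elems F ∧ lt S p q := by
  constructor
  · rintro (⟨-, n, hn⟩ | ⟨S', p', q', -, hp, hq, hlt, he⟩)
    · simp [hS] at hn
    · simp only [Fact.mk.injEq, List.cons.injEq, and_true] at he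
      obtain ⟨rfl, rfl, rfl⟩ := he
      exact ⟨hp, hq, hlt⟩
  · rintro ⟨hp, hq, hlt⟩
    exact .inr ⟨S, p, q, hS, hp, hq, hlt, rfl⟩

/-- Facts over `G` are dropped here, but no element is lost: each is comparable with a second
element and thus occurs in a fact of some distinguished relation. -/
theorem elems_linearize (hdist : ∃ S : ℕ, σ[S]? = some Decl.dist)
    (hlt : ∀ S : ℕ, σ[S]? = some Decl.dist → IsStrictTotalOrder β (lt S))
    (htwo : ∀ p ∈ elems F, ∃ q ∈ elems F, q ≠ p) : elems (linearize σ F lt) = elems F := by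
  ext p
  constructor
  · rintro ⟨f, hf | ⟨S, a, b, -, ha, hb, -, rfl⟩, hp⟩
    · exact ⟨f, hf.1, hp⟩
    · simp only [List.mem_cons, List.not_mem_nil, or_false] at hp
      rcases hp with rfl | rfl
      · exact ha
      · exact hb
  · intro hp
    obtain ⟨S, hS⟩ := hdist
    obtain ⟨q, hq, hne⟩ := htwo p hp
    have := hlt S hS
    rcases trichotomous_of (lt S) p q with h | h | h
    · exact ⟨_, (edge_linearize hS).2 ⟨hp, hq, h⟩, by simp⟩
    · exact absurd h.symm hne
    · exact ⟨_, (edge_linearize hS).2 ⟨hq, hp, h⟩, by simp⟩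

theorem isLinear_linearize (he : elems (linearize σ F lt) = elems F) {S : ℕ}
    (hS : σ[S]? = some Decl.dist) (hlt : IsStrictTotalOrder β (lt S)) :
    IsLinear (linearize σ F lt) S := by
  have hrel : (fun a b : elems (linearize σ F lt) =>
      (⟨S, [a.1, b.1]⟩ : Fact β) ∈ linearize σ F lt) = fun a b => lt S a.1 b.1 := by
    ext a b
    have := edge_linearize (F := F) (lt := lt) hS (p := a.1) (q := b.1)
    rw [← he] at this
    exact this.trans ⟨fun h => h.2.2, fun h => ⟨a.2, b.2, h⟩⟩
  rw [IsLinear, hrel]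
  exact (Subtype.relEmbedding (lt S) (· ∈ elems (linearize σ F lt))).isStrictTotalOrder

theorem over_of_mem_linearize {σ' : Sig} (hF : ∀ f ∈ F, f.Over σ')
    (hσ : ∀ (R : ℕ) (d : Decl), σ[R]? = some d → σ'[R]? = some d) {f : Fact β}
    (hf : f ∈ linearize σ F lt) : f.Over σ := by
  rcases hf with ⟨hf, n, hn⟩ | ⟨S, p, q, hS, -, -, -, rfl⟩
  · obtain ⟨d, hd, hl⟩ := hF f hf
    have := (hσ _ _ hn).symm.trans hd
    simp only [Option.some.injEq] at this
    exact ⟨_, hn, this ▸ hl⟩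
  · exact ⟨_, hS, rfl⟩

end linearize

/-! ### Properties of the unravelling -/

section

variable {α : Type} {F : Set (Fact α)} {B : ℕ → Prop} {P : Set α} {k : ℕ}

theorem models_unravel [Nonempty α] {σ : Sig} (hB : ∀ R n, σ[R]? = some (Decl.base n) → B R)
    (hk : ∀ f ∈ F, f.args.length ≤ k) {φ : Fml} (hφ : φ.size ≤ k) (hfv : φ.fv = ∅)
    (hgnf : φ.BaseGNF σ) : Models F φ ↔ Models (unravel F B P k) φ := by
  obtain ⟨h1, h2⟩ := sat_unravel (P := P) hB hk φ hφ ∅ hgnf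
  constructor
  · intro h v
    obtain ⟨W, hW, hw⟩ := h2 (fun x => (v x).2) (by simp [hfv]) (h _)
    have := φ.card_fv_add_exCount_le
    -- For a sentence it is enough to hang below the root a bag of witnesses that shares nothing
    -- with it.
    exact hw [(W, ∅)] ⟨trivial, by omega, by simp, by simp⟩ (by simp [hfv]) (fun a ha => ha) v
      (by simp [hfv])
  · intro h u
    exact h1 (fun x => ([], u x)) (by simp [hfv]) (by simp) (h _)

/-- A bag may share nothing with its parent, so an element has fresh copies at every positive depth;
those at depths one and two are distinct. -/
theorem exists_ne_mem_elems_unravel (hk : ∀ f ∈ F, f.args.length ≤ k) {p : Node α × α}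
    (hp : p ∈ elems (unravel F B P k)) : ∃ q ∈ elems (unravel F B P k), q ≠ p := by
  classical
  obtain ⟨f, hf, ha⟩ := snd_mem_elems hp
  have hc := (List.toFinset_card_le f.args).trans (hk f hf)
  have h1 : Node.Valid F B P k [(f.args.toFinset, ∅)] := ⟨trivial, hc, by simp, by simp⟩
  have h2 : Node.Valid F B P k [(f.args.toFinset, ∅), (f.args.toFinset, ∅)] :=
    ⟨h1, hc, by simp, by simp⟩
  have m1 := copy_mem_elems hk h1 (a := p.2) (by simpa [Node.bag] using ha) ⟨f, hf, ha⟩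
  have m2 := copy_mem_elems hk h2 (a := p.2) (by simpa [Node.bag] using ha) ⟨f, hf, ha⟩
  rw [Node.copy_cons_of_notMem (by simp)] at m1 m2
  by_contra! h
  have := (h _ m1).trans (h _ m2).symm
  simp at this

theorem stageEdge_of_edge {S : ℕ} {p q : Node α × α} (h : Edge (unravel F B P k) S p q) :
    ∃ n, StageEdge F B P k (Edge F S) n p q := by
  obtain ⟨w, hw, ⟨R, args⟩, hf, hb, he⟩ := h
  simp only [Fact.map, Fact.mk.injEq] at he
  obtain ⟨rfl, he⟩ := he
  match args, he with
  | [a, b], he =>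
    simp only [List.map_cons, List.map_nil, List.cons.injEq, and_true] at he
    exact ⟨w.length, w, a, b, hw, le_rfl, ⟨hf, hb a (by simp), hb b (by simp)⟩, he.1, he.2⟩

/-- A base fact of the unravelling lies in one bag and projects to a base fact of `F`. Guarded
totality of `F` therefore gives an edge between distinct members of the pair already in that bag,
and `lt` extends this edge, so the two agree in direction. -/
theorem edge_of_guarded {σ : Sig} {S : ℕ} {lt : ℕ → Node α × α → Node α × α → Prop}
    (hB : ∀ R n, σ[R]? = some (Decl.base n) → B R) (hS : σ[S]? = some Decl.dist)
    (htot : ∀ a b, Guarded F B a b → a = b ∨ Edge F S a b ∨ Edge F S b a)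
    (hlt : IsStrictTotalOrder (Node α × α) (lt S))
    (hext : ∀ p q, Edge (unravel F B P k) S p q → lt S p q) {p q : Node α × α}
    (h : Edge (linearize σ (unravel F B P k) lt) S p q)
    (hg : p = q ∨ Guarded (linearize σ (unravel F B P k) lt)
      (fun R => ∃ n, σ[R]? = some (Decl.base n)) p q) : Edge (unravel F B P k) S p q := by
  obtain ⟨-, -, h⟩ := (edge_linearize hS).1 h
  rcases hg with rfl | ⟨g, hg, hgb, hp, hq⟩
  · exact absurd h (irrefl_of (lt S) p)
  · obtain ⟨w, hw, f, hf, hb, rfl⟩ := (mem_linearize_of_base hgb).1 hg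
    obtain ⟨a, ha, rfl⟩ := List.mem_map.1 hp
    obtain ⟨b, hb', rfl⟩ := List.mem_map.1 hq
    have hedge : ∀ a b, a ∈ f.args → b ∈ f.args → Edge F S a b →
        Edge (unravel F B P k) S (w.copy a) (w.copy b) := fun a b ha' hb' he =>
      ⟨w, hw, _, he, by simp [hb _ ha', hb _ hb'], rfl⟩
    obtain ⟨n, hn⟩ := hgb
    rcases htot a b ⟨f, hf, hB _ n hn, ha, hb'⟩ with rfl | he | he
    · exact absurd h (irrefl_of (lt S) _)
    · exact hedge a b ha hb' he
    · exact absurd (hext _ _ (hedge b a hb' ha he)) (asymm_of (lt S) h)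

end

/-! ### Correctness of the reduction -/

theorem dist_mem_iff {σ : Sig} : Decl.dist ∈ σ ↔ distPos σ 0 ≠ [] := by
  rw [List.mem_iff_getElem?]
  constructor
  · rintro ⟨i, hi⟩
    exact List.ne_nil_of_mem (mem_distPos.2 ⟨i, hi, rfl⟩)
  · intro h
    obtain ⟨S, hS⟩ := List.exists_mem_of_ne_nil _ h
    obtain ⟨i, hi, -⟩ := mem_distPos.1 hS
    exact ⟨i, hi⟩

theorem sat_iff_of_reduct {α : Type} {σ : Sig} {F F' : Set (Fact α)} (he : elems F = elems F')
    (hF : ∀ f : Fact α, (∃ d, σ[f.rel]? = some d) → (f ∈ F ↔ f ∈ F')) {φ : Fml}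
    (hφ : ∀ a ∈ φ.atoms, a.Over σ) (v : Name → α) : φ.Sat F v ↔ φ.Sat F' v := by
  induction φ generalizing v with
  | tru => rfl
  | fls => rfl
  | atom a =>
    cases a with
    | rel R xs =>
      obtain ⟨d, hd, -⟩ := hφ (.rel R xs) (by simp [Fml.atoms])
      exact hF _ ⟨d, hd⟩
    | eq x y => rfl
  | and φ ψ ih1 ih2 =>
    simp only [Fml.atoms, List.mem_append] at hφ
    exact and_congr (ih1 (fun a ha => hφ a (.inl ha)) v) (ih2 (fun a ha => hφ a (.inr ha)) v)
  | or φ ψ ih1 ih2 =>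
    simp only [Fml.atoms, List.mem_append] at hφ
    exact or_congr (ih1 (fun a ha => hφ a (.inl ha)) v) (ih2 (fun a ha => hφ a (.inr ha)) v)
  | ex x φ ih =>
    simp only [Fml.Sat, he]
    exact exists_congr fun a => and_congr_right fun _ => ih hφ _
  | neg φ ih => exact not_congr (ih hφ v)

theorem size_le_size_bigAnd {Φ : List Fml} {φ : Fml} (h : φ ∈ Φ) : φ.size ≤ (bigAnd Φ).size := by
  induction Φ with
  | nil => simp at h
  | cons ψ Φ ih =>
    change φ.size ≤ ψ.size + 1 + (bigAnd Φ).size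
    rcases List.mem_cons.1 h with rfl | h
    · omega
    · have := ih h
      omega

theorem Fml.size_pos (φ : Fml) : 0 < φ.size := by
  cases φ with
  | atom a => cases a <;> simp [Fml.size, Atom.size]
  | _ => simp [Fml.size]; try omega

theorem size_add_le_width (K : KB) (Q : Fml) :
    (bigAnd K.constraints).size + Q.size + 2 ≤ width K Q :=
  le_trans (by simp only [Fml.size]; omega) (le_max_left _ _)

theorem arity_le_width {K : KB} (Q : Fml) {R : ℕ} {d : Decl} (h : K.sig.addG[R]? = some d) :
    d.arity ≤ width K Q := by
  rcases Nat.eq_zero_or_pos d.arity with h0 | h0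
  · omega
  · exact ((le_maxArity_iff h0).2 ⟨d, List.mem_iff_getElem?.2 ⟨R, h⟩, le_rfl⟩).trans
      (le_max_right _ _)

theorem mem_facts_reduction {K : KB} {Q : Fml} (hd : Decl.dist ∈ K.sig) {g : Fact Name} :
    g ∈ (reduction (K, Q)).facts ↔ g ∈ K.facts ∨ g ∈ gFacts K := by
  simp only [reduction, List.mem_append, mem_gList (dist_mem_iff.1 hd)]
  exact or_comm

theorem mem_constraints_reduction {K : KB} {Q : Fml} (hd : Decl.dist ∈ K.sig) {φ : Fml} :
    φ ∈ (reduction (K, Q)).constraints ↔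
      φ ∈ K.constraints ∨ φ ∈ linAxioms K.sig.addG (width K Q) := by
  simp only [reduction, if_neg (dist_mem_iff.1 hd), List.mem_append, mem_linList,
    List.not_mem_nil, false_or]
  exact or_comm

theorem over_of_mem_facts_reduction {K : KB} {Q : Fml} (hK : ∀ g ∈ K.facts, g.Over K.sig) :
    ∀ g ∈ (reduction (K, Q)).facts, g.Over K.sig.addG := by
  intro g hg
  rcases List.mem_append.1 hg with hg | hg
  · simp only [gList, List.mem_flatMap, List.mem_map] at hg
    obtain ⟨-, -, -, -, a, -, -, -, b, -, rfl⟩ := hg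
    exact ⟨_, getElem?_addG_length _, rfl⟩
  · exact (hK g hg).addG

theorem baseGNF_of_mem_constraints_reduction {K : KB} {Q : Fml}
    (hK : ∀ φ ∈ K.constraints, φ.IsSentence K.sig ∧ φ.BaseCovGNF K.sig) :
    ∀ φ ∈ (reduction (K, Q)).constraints, φ.IsSentence K.sig.addG ∧ φ.BaseGNF K.sig.addG := by
  intro φ hφ
  simp only [reduction, List.mem_append, mem_linList] at hφ
  rcases hφ with hφ | hφ | hφ
  · split at hφ
    · rw [List.mem_singleton.1 hφ]
      exact isSentence_baseGNF_emptyAx _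
    · simp at hφ
  · exact isSentence_baseGNF_of_mem_linAxioms hφ
  · obtain ⟨hs, hg, -⟩ := hK φ hφ
    exact ⟨⟨hs.1, fun a ha => (hs.2 a ha).addG⟩, hg.addG Set.Subset.rfl⟩

/-- The axiom against facts over `G` makes the models of input and output literally the same sets of
facts, and linearity is a vacuous condition. -/
theorem QAlin_iff_of_not_dist {K : KB} {Q : Fml} (hd : Decl.dist ∉ K.sig) :
    QAlin K Q ↔ QA (reduction (K, Q)) Q := by
  have hpos : distPos K.sig 0 = [] := by simpa using mt dist_mem_iff.2 hd
  have hmodel : ∀ (α : Type) (ι : Name ↪ α) (F : Set (Fact α)),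
      K.IsModel ι F ↔ (reduction (K, Q)).IsModel ι F := by
    intro α ι F
    have hfacts : (reduction (K, Q)).facts = K.facts := by simp [reduction, gList, hpos]
    have hcons : (reduction (K, Q)).constraints = emptyAx K.sig.length :: K.constraints := by
      simp [reduction, linList, hpos]
    simp only [KB.IsModel, hfacts, hcons, List.mem_cons, forall_eq_or_imp]
    constructor
    · rintro ⟨h1, h2, h3⟩
      refine ⟨fun f hf => (h1 f hf).addG, h2, ?_, h3⟩
      rintro v ⟨a, -, b, -, hab⟩
      obtain ⟨d, hdd, -⟩ := h1 _ hab
      simp at hdd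
    · rintro ⟨h1, h2, h4, h3⟩
      refine ⟨fun f hf => ?_, h2, h3⟩
      obtain ⟨d, hdd, hl⟩ := h1 f hf
      rcases getElem?_addG hdd with h | ⟨hR, rfl⟩
      · exact ⟨d, h, hl⟩
      · obtain ⟨R, args⟩ := f
        obtain rfl : R = K.sig.length := hR
        match args, hl with
        | [a, b], _ =>
          refine absurd ?_ (h4 ι)
          refine ⟨a, mem_elems_of_mem hf (by simp), b, mem_elems_of_mem hf (by simp), ?_⟩
          rw [sat_binAtom]
          simpa [zvar, Edge] using hf
  refine forall_congr' fun α => forall_congr' fun ι => forall_congr' fun F => ?_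
  rw [hmodel]
  refine imp_congr_right fun _ => ⟨fun h => h fun S hS => ?_, fun h _ => h⟩
  exact absurd (List.mem_iff_getElem?.2 ⟨S, hS⟩) hd

/-- The added `G`-facts mention no new elements, so the orders remain linear and formulas over the
input signature keep their truth values. -/
theorem QAlin_of_QA_reduction {K : KB} {Q : Fml} (hd : Decl.dist ∈ K.sig)
    (hC : ∀ φ ∈ K.constraints, φ.IsSentence K.sig) (hQ : Q.IsSentence K.sig)
    (h : QA (reduction (K, Q)) Q) : QAlin K Q := by
  intro α ι F ⟨hover, hfacts, hcons⟩ hlin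
  have hold : ∀ f : Fact α, (∃ d, K.sig[f.rel]? = some d) →
      (f ∈ F ↔ f ∈ F ∪ Set.image (Fact.map ι) (gFacts K)) := by
    rintro f ⟨d, hd⟩
    refine ⟨.inl, ?_⟩
    rintro (hf | ⟨g, ⟨a, -, b, -, rfl⟩, rfl⟩)
    · exact hf
    · simp [Fact.map] at hd
  have helems : elems F = elems (F ∪ Set.image (Fact.map ι) (gFacts K)) := by
    ext a
    constructor
    · rintro ⟨f, hf, ha⟩
      exact ⟨f, .inl hf, ha⟩
    · rintro ⟨f, hf | ⟨g, ⟨b, ⟨f₁, hf₁, hb⟩, c, ⟨f₂, hf₂, hc⟩, rfl⟩, rfl⟩, ha⟩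
      · exact ⟨f, hf, ha⟩
      · simp only [Fact.map, List.map_cons, List.map_nil, List.mem_cons, List.not_mem_nil,
          or_false] at ha
        rcases ha with rfl | rfl
        · exact ⟨_, hfacts f₁ hf₁, List.mem_map_of_mem hb⟩
        · exact ⟨_, hfacts f₂ hf₂, List.mem_map_of_mem hc⟩
  have hlin' : ∀ S, K.sig.addG[S]? = some Decl.dist →
      IsLinear (F ∪ Set.image (Fact.map ι) (gFacts K)) S := by
    intro S hS
    rw [getElem?_addG_dist] at hS
    have := hlin S hS
    rw [IsLinear] at this ⊢
    rw [← helems]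
    convert this using 3
    exact (hold _ ⟨_, hS⟩).symm
  have hmodel : (reduction (K, Q)).IsModel ι (F ∪ Set.image (Fact.map ι) (gFacts K)) := by
    refine ⟨?_, ?_, ?_⟩
    · rintro f (hf | ⟨g, ⟨a, -, b, -, rfl⟩, rfl⟩)
      · exact (hover f hf).addG
      · exact ⟨_, getElem?_addG_length _, rfl⟩
    · intro f hf
      rcases (mem_facts_reduction hd).1 hf with hf | hf
      · exact .inl (hfacts f hf)
      · exact .inr ⟨f, hf, rfl⟩
    · intro φ hφ
      rcases (mem_constraints_reduction hd).1 hφ with hφ | hφ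
      · exact fun v => (sat_iff_of_reduct helems hold (hC φ hφ).2 v).1 (hcons φ hφ v)
      · exact IsLinear.models_linAxioms hlin' hφ
  exact fun v => (sat_iff_of_reduct helems hold hQ.2 v).2 (h α ι _ hmodel v)

/-- The root bag may have more than `k` elements, but it is pairwise guarded, so that `S` is total
on it; this is the purpose of `G`. The remaining bags are small enough for the cycle axioms up to
`k`. -/
theorem acyclic_unravel {α : Type} [Nonempty α] {F : Set (Fact α)} {τ : Sig} {P : Set α} {k S : ℕ}
    (hover : ∀ f ∈ F, f.Over τ) (hax : ∀ φ ∈ linAxioms τ k, Models F φ) (hk : 3 ≤ k)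
    (hP : ∀ a ∈ P, ∀ b ∈ P, Guarded F (fun R => ∃ n, τ[R]? = some (Decl.base n)) a b)
    (hS : τ[S]? = some Decl.dist) :
    (∀ a b, Guarded F (fun R => ∃ n, τ[R]? = some (Decl.base n)) a b →
      a = b ∨ Edge F S a b ∨ Edge F S b a) ∧
    ∀ p, ¬ TransGen (Edge (unravel F (fun R => ∃ n, τ[R]? = some (Decl.base n)) P k) S) p p := by
  have htot : ∀ a b, Guarded F (fun R => ∃ n, τ[R]? = some (Decl.base n)) a b →
      a = b ∨ Edge F S a b ∨ Edge F S b a := by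
    rintro a b ⟨⟨R, args⟩, hf, ⟨n, hn⟩, ha, hb⟩
    obtain ⟨i, hi, rfl⟩ := List.mem_iff_getElem.1 ha
    obtain ⟨j, hj, rfl⟩ := List.mem_iff_getElem.1 hb
    have hl : args.length = n := by
      obtain ⟨d, hd, hl⟩ := hover _ hf
      obtain rfl : Decl.base n = d := by simpa [hn] using hd
      exact hl
    exact edge_of_models_totalAx
      (hax _ ⟨S, hS, .inr (.inl ⟨R, n, i, j, hn, hl ▸ hi, hl ▸ hj, .inl rfl⟩)⟩) hf hl hi hj
  have hcyc : ∀ m a, m + 1 ≤ k → ¬ PathRel (Edge F S) m a a := fun m a hm =>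
    not_pathRel_of_models_loopAx (hax _ ⟨S, hS, .inr (.inr ⟨m, hm, rfl⟩)⟩)
      (hax _ ⟨S, hS, .inl rfl⟩) a
  refine ⟨htot, fun p hp => ?_⟩
  refine not_transGen_unravel htot (k := k) (P := P) (fun w hw a => ?_) p
    (TransGen.mono (fun _ _ => stageEdge_of_edge) _ _ hp)
  match w, hw with
  | [], _ =>
    exact not_transGen_of_total (fun m a hm => hcyc m a (by omega)) P
      (fun a ha b hb => htot a b (hP a ha b hb)) a
  | (X, Y) :: w, hw => exact not_transGen_of_card_le hcyc X hw.2.1 a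

theorem QA_reduction_of_QAlin {K : KB} {Q : Fml} (hd : Decl.dist ∈ K.sig)
    (hK : ∀ g ∈ K.facts, g.Over K.sig)
    (hC : ∀ φ ∈ K.constraints, φ.IsSentence K.sig ∧ φ.BaseCovGNF K.sig)
    (hQ : Q.IsSentence K.sig) (hQc : Q.IsBaseCoveredUCQ K.sig)
    (h : QAlin K Q) : QA (reduction (K, Q)) Q := by
  intro α ι F ⟨hover, hfacts, hcons⟩
  change ∀ f ∈ F, f.Over K.sig.addG at hover
  have : Nonempty α := ⟨ι []⟩
  have hw := size_add_le_width K Q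
  have hk : ∀ f ∈ F, f.args.length ≤ width K Q := by
    intro f hf
    obtain ⟨d, hd, hl⟩ := hover f hf
    exact hl.trans_le (arity_le_width Q hd)
  let B : ℕ → Prop := fun R => ∃ n, K.sig.addG[R]? = some (Decl.base n)
  -- With the input elements as the root bag, the input facts reappear at the root, where the name
  -- `a` is interpreted by the copy `([], ι a)`.
  let P : Set α := Set.image ι (elems {g | g ∈ K.facts})
  let F' := unravel F B P (width K Q)
  have hB : ∀ R n, K.sig[R]? = some (Decl.base n) → B R :=
    fun R n hn => ⟨n, getElem?_addG_of_some hn⟩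
  have hac : ∀ S, K.sig[S]? = some Decl.dist →
      (∀ a b, Guarded F B a b → a = b ∨ Edge F S a b ∨ Edge F S b a) ∧
      ∀ p, ¬ TransGen (Edge F' S) p p := by
    intro S hS
    refine acyclic_unravel hover
      (fun φ hφ => hcons φ ((mem_constraints_reduction hd).2 (.inr hφ))) ?_ ?_
      (getElem?_addG_dist.2 hS)
    · have := Q.size_pos
      have := (bigAnd K.constraints).size_pos
      omega
    · rintro _ ⟨a, ha, rfl⟩ _ ⟨b, hb, rfl⟩
      exact ⟨_, hfacts _ ((mem_facts_reduction hd).2 (.inr ⟨a, ha, b, hb, rfl⟩)),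
        ⟨2, getElem?_addG_length _⟩, by simp [Fact.map], by simp [Fact.map]⟩
  have hex : ∀ S, ∃ lt : Node α × α → Node α × α → Prop, K.sig[S]? = some Decl.dist →
      IsStrictTotalOrder _ lt ∧ ∀ p q, Edge F' S p q → lt p q := by
    intro S
    by_cases hS : K.sig[S]? = some Decl.dist
    · obtain ⟨lt, hlt⟩ := exists_linear_extension (hac S hS).2
      exact ⟨lt, fun _ => hlt⟩
    · exact ⟨fun _ _ => False, fun h => absurd h hS⟩
  choose lt hlt using hex
  have helems : elems (linearize K.sig F' lt) = elems F' :=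
    elems_linearize (List.mem_iff_getElem?.1 hd) (fun S hS => (hlt S hS).1)
      fun p hp => exists_ne_mem_elems_unravel hk hp
  have hbase : ∀ f : Fact (Node α × α), (∃ n, K.sig[f.rel]? = some (Decl.base n)) →
      (f ∈ F' ↔ f ∈ linearize K.sig F' lt) := fun f hf => (mem_linearize_of_base hf).symm
  have hguard : ∀ S p q, K.sig[S]? = some Decl.dist → Edge (linearize K.sig F' lt) S p q →
      (p = q ∨ Guarded (linearize K.sig F' lt) (fun R => ∃ n, K.sig[R]? = some (Decl.base n)) p q) →
      Edge F' S p q := fun S p q hS =>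
    edge_of_guarded hB hS (hac S hS).1 (hlt S hS).1 (hlt S hS).2
  have hover' : ∀ g ∈ F', g.Over K.sig.addG := by
    rintro _ ⟨w, -, f, hf, -, rfl⟩
    obtain ⟨d, hd, hl⟩ := hover f hf
    exact ⟨d, hd, by simpa [Fact.map] using hl⟩
  have hdist : ∀ g : Fact (Node α × α), K.sig[g.rel]? = some Decl.dist → g ∈ F' →
      g ∈ linearize K.sig F' lt := by
    rintro ⟨S, args⟩ hS hg
    have hl : args.length = 2 := by
      obtain ⟨d, hd, hl⟩ := hover' _ hg
      obtain rfl : Decl.dist = d := by simpa [getElem?_addG_of_some hS] using hd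
      exact hl
    match args, hl with
    | [p, q], _ =>
      exact (edge_linearize hS).2 ⟨mem_elems_of_mem hg (by simp), mem_elems_of_mem hg (by simp),
        (hlt S hS).2 p q hg⟩
  have hmodel : K.IsModel (ι.trans ⟨fun a => (([] : Node α), a), Prod.mk_right_injective _⟩)
      (linearize K.sig F' lt) := by
    refine ⟨fun f => over_of_mem_linearize hover' fun _ _ => getElem?_addG_of_some, ?_, ?_⟩
    · intro f hf
      have hf' : f.map (ι.trans ⟨fun a => (([] : Node α), a), Prod.mk_right_injective _⟩) ∈ F' := by
        refine ⟨[], trivial, f.map ι, hfacts f ((mem_facts_reduction hd).2 (.inl hf)), ?_, ?_⟩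
        · intro a ha
          obtain ⟨b, hb, rfl⟩ := List.mem_map.1 ha
          exact ⟨b, ⟨f, hf, hb⟩, rfl⟩
        · ext1
          · rfl
          · simp [Fact.map, Node.copy]
      obtain ⟨d, hd, -⟩ := hK f hf
      cases d with
      | base n => exact (hbase _ ⟨n, hd⟩).1 hf'
      | dist => exact hdist _ hd hf'
    · intro φ hφ
      obtain ⟨hs, hgnf, hcov⟩ := hC φ hφ
      have hm : Models F' φ := (models_unravel hB hk
        (by have := size_le_size_bigAnd hφ; omega) hs.1 hgnf).1
        (hcons φ ((mem_constraints_reduction hd).2 (.inl hφ)))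
      exact fun v => (sat_of_covered helems.symm hbase hdist hguard φ hs.2 true ∅ hcov v
        (by simp)).1 rfl (hm v)
  have hq := h _ _ _ hmodel fun S hS => isLinear_linearize helems hS (hlt S hS).1
  -- The query travels back: from the linear model to the unravelling because it is base-covered,
  -- and from there to `F` because it is a guarded-negation sentence.
  refine (models_unravel (P := P) hB hk (by omega) hQ.1
    (baseGNFIn_of_isBaseCoveredUCQ hQc ∅)).2 fun v => ?_
  exact sat_ucq_of_covered helems.symm hbase hguard hQc hQ.2 (hq v)

end LinQA

theorem mainTheorem3 :
    ∃ f : KB × Fml → KB,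
      Nonempty (Turing.TM2ComputableInPolyTime encInput KB.encode f) ∧
      ∀ (K : KB) (Q : Fml),
        (∀ g ∈ K.facts, g.Over K.sig) →
        (∀ φ ∈ K.constraints, φ.IsSentence K.sig ∧ φ.BaseCovGNF K.sig) →
        Q.IsSentence K.sig → Q.IsBaseCoveredUCQ K.sig →
        (f (K, Q)).sig = K.sig.addG ∧
        (∀ g ∈ (f (K, Q)).facts, g.Over K.sig.addG) ∧
        (∀ φ ∈ (f (K, Q)).constraints, φ.IsSentence K.sig.addG ∧ φ.BaseGNF K.sig.addG) ∧
        (QAlin K Q ↔ QA (f (K, Q)) Q) ∧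
        (Decl.dist ∈ K.sig →
          {g | g ∈ (f (K, Q)).facts} = {g | g ∈ K.facts} ∪ gFacts K ∧
          {φ | φ ∈ (f (K, Q)).constraints} =
            {φ | φ ∈ K.constraints} ∪ linAxioms K.sig.addG (width K Q)) := by
  refine ⟨reduction, polyTime_reduction, fun K Q hK hC hQ hQc => ⟨rfl,
    over_of_mem_facts_reduction hK, baseGNF_of_mem_constraints_reduction hC, ?_, fun hd =>
    ⟨Set.ext fun _ => mem_facts_reduction hd, Set.ext fun _ => mem_constraints_reduction hd⟩⟩⟩
  by_cases hd : Decl.dist ∈ K.sig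
  · exact ⟨QA_reduction_of_QAlin hd hK hC hQ hQc,
      QAlin_of_QA_reduction hd (fun φ hφ => (hC φ hφ).1) hQ⟩
  · exact QAlin_iff_of_not_dist hd
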